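/- **Setting.** Let $d,\lambda_1,\lambda_2>0$, $\Omega=\mathbb R^2\times(-d,0)$, $\Lambda=\lambda_1\mathbb Z\times\lambda_2\mathbb Z$, and let $\Lambda^*=\frac{2\pi}{\lambda_1}\mathbb Z\times\frac{2\pi}{\lambda_2}\mathbb Z$ be the dual lattice. Write $x=(x',x_3)$, $x'=(x_1,x_2)$, and let $R_j$ be the reflection of the $j$-th coordinate, $j=1,2$. A vector field $v$ is $(+)$-symmetric if $v\circ R_j=(-1)^jR_jv$, and a scalar field $f$ is $(+)$-symmetric if $f\circ R_j=f$, for $j=1,2$. The subscript $+$ marks spaces of $(+)$-symmetric functions that are $\Lambda$-periodic in $x'$; spaces of $C^2$ functions carry the $C^2$ norm. Put $$\mathcal X=C^2_+(\overline\Omega;\mathbb R^3)\times C^2_+(\overline\Omega)\times C^2_+(\mathbb R^2).$$ For $(u,\wp,\eta)\in\mathcal X$ with $\eta>-d$ let $\varphi(x)=(1+x_3/d)\,\eta(x')$, $\rho=1+\partial_3\varphi$ and $M=\rho^{-1}(I+e_3\otimes\nabla\varphi)$. The *flattened Euler equations* with kinematic boundary condition are $$M^\top(u\cdot\nabla)(Mu)+\nabla\wp=0,\quad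 \nabla\cdot u=0\ \text{ in }\Omega,\qquad u_3=0\ \text{ on }\partial\Omega. \tag{E}$$ The *capillary-gravity dynamic boundary condition* with constants $g,\sigma>0$ is $$\wp-g\eta+\sigma\nabla\cdot\Big(\frac{\nabla\eta}{\sqrt{1+|\nabla\eta|^2}}\Big)=0\quad\text{on }S=\{x_3=0\}. \tag{D}$$ **Theorem.** Let $U\in C^2([-d,0])$ be non-constant and without zeros. Let $\epsilon\mapsto w^\epsilon=(u^\epsilon,\wp^\epsilon,\eta^\epsilon)\in\mathcal X$ be a $C^2$ curve, defined in a neighbourhood of $\epsilon=0$, of solutions of (E) with $u^0=(U(x_3),0,0)$, $\wp^0=0$, $\eta^0=0$. Then the curve has an expansion $$w^\epsilon=w^0+\epsilon\,(u^{(1)},\wp^{(1)},\eta^{(1)})+\epsilon^2(u^{(2)},\wp^{(2)},\eta^{(2)})+o(\epsilon^2)\quad\text{in }\mathcal X\text{ as }\epsilon\to0,$$ and its first-order term satisfies $$u^{(1)}_2\equiv0\quad\text{and}\quad\partial_2\big(u^{(1)}_3,\wp^{(1)},\eta^{(1)}\big)\equiv0 \tag{2D}$$ in each of the following two cases. 1.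 There are $g,\sigma>0$ such that $(u^\epsilon,\wp^\epsilon,\eta^\epsilon)$ satisfies (D) for all $\epsilon$ near $0$. 2. (Other dynamic boundary conditions.) $B(u^\epsilon,\wp^\epsilon,\eta^\epsilon)=0$ for all $\epsilon$ near $0$, where $B$ is a map from $\mathcal X$ to a real normed space that is Fréchet differentiable at $w^0$ with derivative $L$, and the set $N$ defined as follows is finite and satisfies $k_1\neq0$ for all $k\in N$. Let $K$ be the set of all $(u,\wp,\eta)\in\mathcal X$ with $L(u,\wp,\eta)=0$ that solve the linearization of (E) at $w^0$, namely $$u_3U'e_1+U\partial_1u+U^2\partial_1\big(\nabla\times(\varphi e_2)\big)+\nabla\wp=0,\quad\nabla\cdot u=0\ \text{ in }\Omega,\qquad u_3=0\ \text{ on }\partial\Omega,$$ with $\varphi=(1+x_3/d)\eta$. Then $N$ is the set of all $k\in\Lambda^*\setminus\{0\}$ for which some $(u,\wp,\eta)\in K$ has $k$-th horizontal Fourier coefficient $\eta_k\neq0$ or $\wp_k(x_3)\neq0$ for some $x_3\in[-d,0]$. -/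

import Mathlib

open Set Filter Topology Asymptotics
open scoped BoundedContinuousFunction Matrix

set_option maxSynthPendingDepth 3
set_option linter.unusedSectionVars false

noncomputable section

namespace WaterWave

/-- Horizontal positions `x' = (x₁, x₂)`; the coordinates are indexed by `0, 1`. -/
abbrev R2 := Fin 2 → ℝ

/-- Positions `x = (x₁, x₂, x₃)` and velocities; the coordinates are indexed by `0, 1, 2`. -/
abbrev R3 := Fin 3 → ℝ

/-! ### Spaces of twice continuously differentiable functions -/

section C2

variable {E F : Type*} [NormedAddCommGroup E] [NormedSpace ℝ E]
  [NormedAddCommGroup F] [NormedSpace ℝ F]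

/-- Extension by zero of a function on `S`. -/
def zeroExt (S : Set E) (f : S → F) : E → F := Function.extend Subtype.val f 0

theorem zeroExt_zero (S : Set E) : zeroExt S (fun _ => (0 : F)) = fun _ => 0 := by
  classical
  funext x
  simp [zeroExt, Function.extend]

theorem zeroExt_add (S : Set E) (f g : S → F) :
    zeroExt S (fun x => f x + g x) = fun x => zeroExt S f x + zeroExt S g x := by
  classical
  funext x
  by_cases h : ∃ a : S, a.1 = x
  · simp [zeroExt, Function.extend, h]
  · simp only [zeroExt, Function.extend, h, dite_false]
    simp

theorem zeroExt_smul (S : Set E) (c : ℝ) (f : S → F) :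
    zeroExt S (fun x => c • f x) = fun x => c • zeroExt S f x := by
  classical
  funext x
  by_cases h : ∃ a : S, a.1 = x
  · simp [zeroExt, Function.extend, h]
  · simp only [zeroExt, Function.extend, h, dite_false]
    simp

/-- The `C²` functions `S → F` that are bounded together with their first and second
derivatives, for `S` the closure of a convex open set (so that derivatives within `S` are unique).
A function is stored with its two derivatives as a triple `(f, Df, D²f)` of bounded continuous
functions on `S`. The norm, inherited from the product of the spaces of bounded continuous
functions, is the usual `C²` norm `max (sup ‖f‖, sup ‖Df‖, sup ‖D²f‖)`. -/
def c2Submodule {E : Type*} [NormedAddCommGroup E] [NormedSpace ℝ E] (S : Set E)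
    (F : Type*) [NormedAddCommGroup F] [NormedSpace ℝ F] : Submodule ℝ
    ((S →ᵇ F) × (S →ᵇ (E →L[ℝ] F)) × (S →ᵇ (E →L[ℝ] E →L[ℝ] F))) where
  carrier := {j | ∀ x : S,
    HasFDerivWithinAt (zeroExt S j.1) (j.2.1 x) S x ∧
    HasFDerivWithinAt (zeroExt S j.2.1) (j.2.2 x) S x}
  zero_mem' := fun x => by
    constructor
    · change HasFDerivWithinAt (zeroExt S (fun _ => (0 : F))) 0 S x
      rw [zeroExt_zero]; exact hasFDerivWithinAt_const _ _ _
    · change HasFDerivWithinAt (zeroExt S (fun _ => (0 : E →L[ℝ] F))) 0 S x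
      rw [zeroExt_zero]; exact hasFDerivWithinAt_const _ _ _
  add_mem' := fun {a b} ha hb x => by
    constructor
    · change HasFDerivWithinAt (zeroExt S (fun y => a.1 y + b.1 y)) (a.2.1 x + b.2.1 x) S x
      rw [zeroExt_add]; exact (ha x).1.add (hb x).1
    · change HasFDerivWithinAt (zeroExt S (fun y => a.2.1 y + b.2.1 y)) (a.2.2 x + b.2.2 x) S x
      rw [zeroExt_add]; exact (ha x).2.add (hb x).2
  smul_mem' := fun c a ha x => by
    constructor
    · change HasFDerivWithinAt (zeroExt S (fun y => c • a.1 y)) (c • a.2.1 x) S x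
      rw [zeroExt_smul]; exact (ha x).1.const_smul c
    · change HasFDerivWithinAt (zeroExt S (fun y => c • a.2.1 y)) (c • a.2.2 x) S x
      rw [zeroExt_smul]; exact (ha x).2.const_smul c

/-- The space `C²(S; F)` with its norm. -/
def C2 {E : Type*} [NormedAddCommGroup E] [NormedSpace ℝ E] (S : Set E)
    (F : Type*) [NormedAddCommGroup F] [NormedSpace ℝ F] : Type _ := c2Submodule S F

variable {S : Set E}

instance : NormedAddCommGroup (C2 S F) :=
  Submodule.normedAddCommGroup (c2Submodule S F)

instance : NormedSpace ℝ (C2 S F) :=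
  Submodule.normedSpace (c2Submodule S F)

/-- The underlying function of an element of `C2 S F` (extended by zero outside `S`). -/
def C2.fn (f : C2 S F) : E → F := zeroExt S f.1.1

theorem C2.fn_zero : C2.fn (0 : C2 S F) = fun _ => 0 := zeroExt_zero S

theorem C2.fn_add (f g : C2 S F) : C2.fn (f + g) = fun x => C2.fn f x + C2.fn g x :=
  zeroExt_add S f.1.1 g.1.1

theorem C2.fn_smul (c : ℝ) (f : C2 S F) : C2.fn (c • f) = fun x => c • C2.fn f x :=
  zeroExt_smul S c f.1.1

end C2

/-! ### The domain, periodicity and symmetry -/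

/-- The flattened fluid domain `Ω = ℝ² × (-d, 0)`. -/
def domain (d : ℝ) : Set R3 := {x | x 2 ∈ Ioo (-d) 0}

/-- Its closure `ℝ² × [-d, 0]`. -/
def closedDomain (d : ℝ) : Set R3 := {x | x 2 ∈ Icc (-d) 0}

/-- Reflection of the `j`-th coordinate. -/
def reflect {n : ℕ} (j : Fin n) (x : Fin n → ℝ) : Fin n → ℝ := Function.update x j (-x j)

/-- `Λ`-periodicity in the two horizontal variables, `Λ = l₁ℤ × l₂ℤ`. -/
def IsPeriodic {n : ℕ} [NeZero n] {F : Type*} (l₁ l₂ : ℝ) (f : (Fin n → ℝ) → F) : Prop :=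
  (∀ x, f (x + Pi.single 0 l₁) = f x) ∧ (∀ x, f (x + Pi.single 1 l₂) = f x)

/-- `(+)`-symmetry of a scalar field: `f ∘ R_j = f` for `j = 1, 2`. -/
def IsSymmScalar {n : ℕ} [NeZero n] (f : (Fin n → ℝ) → ℝ) : Prop :=
  (∀ x, f (reflect 0 x) = f x) ∧ (∀ x, f (reflect 1 x) = f x)

/-- `(+)`-symmetry of a vector field: `v ∘ R_j = (-1)^j R_j v` for `j = 1, 2`. -/
def IsSymmVector (v : R3 → R3) : Prop :=
  (∀ x, v (reflect 0 x) = -reflect 0 (v x)) ∧ (∀ x, v (reflect 1 x) = reflect 1 (v x))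

theorem reflect_zero {n : ℕ} (j : Fin n) : reflect j (0 : Fin n → ℝ) = 0 := by
  funext i
  by_cases h : i = j
  · subst h; simp [reflect]
  · simp [reflect, h]

theorem reflect_add {n : ℕ} (j : Fin n) (x y : Fin n → ℝ) :
    reflect j (x + y) = reflect j x + reflect j y := by
  funext i
  by_cases h : i = j
  · subst h; simp [reflect]; ring
  · simp [reflect, h]

theorem reflect_smul {n : ℕ} (j : Fin n) (c : ℝ) (x : Fin n → ℝ) :
    reflect j (c • x) = c • reflect j x := by
  funext i
  by_cases h : i = j
  · subst h; simp [reflect]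
  · simp [reflect, h]

/-- The space `C²₊(closure Ω; ℝ³)`. -/
def VelocitySpace (d l₁ l₂ : ℝ) : Submodule ℝ (C2 (closedDomain d) R3) where
  carrier := {u | IsPeriodic l₁ l₂ (C2.fn u) ∧ IsSymmVector (C2.fn u)}
  zero_mem' := by
    simp [IsPeriodic, IsSymmVector, C2.fn_zero,
      reflect_zero]
  add_mem' := fun {a b} ha hb => by
    obtain ⟨⟨h1, h2⟩, h3, h4⟩ := ha
    obtain ⟨⟨k1, k2⟩, k3, k4⟩ := hb
    simp only [mem_ofPred_eq, IsPeriodic, IsSymmVector, C2.fn_add, reflect_add]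
    refine ⟨⟨fun x => by rw [h1, k1], fun x => by rw [h2, k2]⟩,
      fun x => by rw [h3, k3]; abel, fun x => by rw [h4, k4]⟩
  smul_mem' := fun c a ha => by
    obtain ⟨⟨h1, h2⟩, h3, h4⟩ := ha
    simp only [mem_ofPred_eq, IsPeriodic, IsSymmVector, C2.fn_smul, reflect_smul]
    refine ⟨⟨fun x => by rw [h1], fun x => by rw [h2]⟩,
      fun x => by rw [h3, smul_neg], fun x => by rw [h4]⟩

/-- The space `C²₊(S)` of scalar functions, for `S ⊆ ℝⁿ`. -/
def ScalarSpace {n : ℕ} [NeZero n] (S : Set (Fin n → ℝ)) (l₁ l₂ : ℝ) :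
    Submodule ℝ (C2 S ℝ) where
  carrier := {f | IsPeriodic l₁ l₂ (C2.fn f) ∧ IsSymmScalar (C2.fn f)}
  zero_mem' := by
    simp [IsPeriodic, IsSymmScalar, C2.fn_zero]
  add_mem' := fun {a b} ha hb => by
    obtain ⟨⟨h1, h2⟩, h3, h4⟩ := ha
    obtain ⟨⟨k1, k2⟩, k3, k4⟩ := hb
    simp only [mem_ofPred_eq, IsPeriodic, IsSymmScalar, C2.fn_add]
    refine ⟨⟨fun x => by rw [h1, k1], fun x => by rw [h2, k2]⟩,
      fun x => by rw [h3, k3], fun x => by rw [h4, k4]⟩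
  smul_mem' := fun c a ha => by
    obtain ⟨⟨h1, h2⟩, h3, h4⟩ := ha
    simp only [mem_ofPred_eq, IsPeriodic, IsSymmScalar, C2.fn_smul]
    refine ⟨⟨fun x => by rw [h1], fun x => by rw [h2]⟩,
      fun x => by rw [h3], fun x => by rw [h4]⟩

/-- The Banach space `C²₊(closure Ω; ℝ³) × C²₊(closure Ω) × C²₊(ℝ²)` of triples `(u, ℘, η)`. -/
abbrev State (d l₁ l₂ : ℝ) : Type :=
  VelocitySpace d l₁ l₂ × ScalarSpace (closedDomain d) l₁ l₂ × ScalarSpace (univ : Set R2) l₁ l₂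

section Components

variable {d l₁ l₂ : ℝ}

/-- The velocity field `u`. -/
def State.u (w : State d l₁ l₂) : R3 → R3 := C2.fn w.1.1

/-- The flattened dynamic pressure `℘`. -/
def State.p (w : State d l₁ l₂) : R3 → ℝ := C2.fn w.2.1.1

/-- The surface elevation `η`. -/
def State.eta (w : State d l₁ l₂) : R2 → ℝ := C2.fn w.2.2.1

end Components

/-! ### The flattened equations -/

/-- The partial derivative `∂ᵢ f`. -/
def pd {n : ℕ} (i : Fin n) (f : (Fin n → ℝ) → ℝ) (x : Fin n → ℝ) : ℝ :=
  lineDeriv ℝ f x (Pi.single i 1)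

/-- `φ(x) = (1 + x₃ / d) η(x')`. -/
def phi (d : ℝ) (η : R2 → ℝ) (x : R3) : ℝ := (1 + x 2 / d) * η ![x 0, x 1]

/-- `ρ = 1 + ∂₃φ`. -/
def rho (d : ℝ) (η : R2 → ℝ) (x : R3) : ℝ := 1 + pd 2 (phi d η) x

/-- The Jacobi matrix `J = I + e₃ ⊗ ∇φ` of the flattening map. -/
def jacobi (d : ℝ) (η : R2 → ℝ) (x : R3) : Matrix (Fin 3) (Fin 3) ℝ :=
  1 + Matrix.vecMulVec (Pi.single 2 1) (fun j => pd j (phi d η) x)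

/-- The normalized Jacobi matrix `M = J / ρ`. -/
def normJacobi (d : ℝ) (η : R2 → ℝ) (x : R3) : Matrix (Fin 3) (Fin 3) ℝ :=
  (rho d η x)⁻¹ • jacobi d η x

/-- `(u · ∇) v`. -/
def advect (u v : R3 → R3) (x : R3) : R3 := fun i => ∑ j, u x j * pd j (fun y => v y i) x

/-- `∇ · v`. -/
def div {n : ℕ} (v : (Fin n → ℝ) → (Fin n → ℝ)) (x : Fin n → ℝ) : ℝ :=
  ∑ j, pd j (fun y => v y j) x

/-- `∇ f`. -/
def grad {n : ℕ} (f : (Fin n → ℝ) → ℝ) (x : Fin n → ℝ) : Fin n → ℝ := fun j => pd j f x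

/-- `∇ × v`. -/
def curl (v : R3 → R3) (x : R3) : R3 :=
  ![pd 1 (fun y => v y 2) x - pd 2 (fun y => v y 1) x,
    pd 2 (fun y => v y 0) x - pd 0 (fun y => v y 2) x,
    pd 0 (fun y => v y 1) x - pd 1 (fun y => v y 0) x]

/-- The flattened steady Euler equations in `Ω` with the kinematic boundary condition on `∂Ω`, for
a surface that stays above the bottom. The dynamic boundary condition is not part of it. -/
structure SolvesEuler (d : ℝ) (u : R3 → R3) (p : R3 → ℝ) (η : R2 → ℝ) : Prop where
  above_bottom : ∀ x', -d < η x'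
  momentum : ∀ x ∈ domain d,
    (normJacobi d η x)ᵀ *ᵥ advect u (fun y => normJacobi d η y *ᵥ u y) x + grad p x = 0
  incompressible : ∀ x ∈ domain d, div u x = 0
  kinematic : ∀ x : R3, x 2 = 0 ∨ x 2 = -d → u x 2 = 0

/-- The dynamic boundary condition of capillary-gravity waves on `S = {x₃ = 0}`:
`℘ - g η + σ ∇ · (∇η / √(1 + |∇η|²)) = 0`. -/
def CapillaryGravity (g σ : ℝ) (p : R3 → ℝ) (η : R2 → ℝ) : Prop :=
  ∀ x' : R2, p ![x' 0, x' 1, 0] - g * η x' +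
    σ * div (fun y => (Real.sqrt (1 + ∑ j, grad η y j ^ 2))⁻¹ • grad η y) x' = 0

/-- The triple `((U(x₃), 0, 0), 0, 0)`. -/
def IsShearFlow (d : ℝ) (U : ℝ → ℝ) (u : R3 → R3) (p : R3 → ℝ) (η : R2 → ℝ) : Prop :=
  (∀ x ∈ closedDomain d, u x = ![U (x 2), 0, 0]) ∧ (∀ x ∈ closedDomain d, p x = 0) ∧
    ∀ x', η x' = 0

/-! ### The linearized problem and its wave vectors -/

/-- The linearization of the flattened Euler equations and the kinematic boundary condition at the
shear flow `((U(x₃), 0, 0), 0, 0)`: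
`u₃ U' e₁ + U ∂₁u + U² ∂₁(∇ × (φ e₂)) + ∇℘ = 0` and `∇ · u = 0` in `Ω`, `u₃ = 0` on `∂Ω`. -/
structure SolvesLinearized (d : ℝ) (U : ℝ → ℝ) (u : R3 → R3) (p : R3 → ℝ) (η : R2 → ℝ) :
    Prop where
  momentum : ∀ x ∈ domain d, ∀ i : Fin 3,
    u x 2 * deriv U (x 2) * (Pi.single 0 1 : R3) i + U (x 2) * pd 0 (fun y => u y i) x +
      U (x 2) ^ 2 * pd 0 (fun y => curl (fun z => Pi.single 1 (phi d η z)) y i) x +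
      pd i p x = 0
  incompressible : ∀ x ∈ domain d, div u x = 0
  kinematic : ∀ x : R3, x 2 = 0 ∨ x 2 = -d → u x 2 = 0

/-- The Fourier coefficient at `k` of an `l₁ℤ × l₂ℤ`-periodic function of `x' = (x₁, x₂)`. -/
def horizCoeff (l₁ l₂ : ℝ) (f : R2 → ℝ) (k : ℝ × ℝ) : ℂ :=
  (1 / (l₁ * l₂) : ℝ) * ∫ x in (0 : ℝ)..l₁, ∫ y in (0 : ℝ)..l₂,
    (f ![x, y] : ℂ) * Complex.exp (-Complex.I * ((k.1 * x + k.2 * y : ℝ) : ℂ))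

/-- The dual lattice `Λ* = κ₁ℤ × κ₂ℤ`, `lᵢ κᵢ = 2π`. -/
def dualLattice (l₁ l₂ : ℝ) : Set (ℝ × ℝ) :=
  {k | ∃ m n : ℤ, k = (2 * Real.pi / l₁ * m, 2 * Real.pi / l₂ * n)}

/-- The nonzero wave vectors `k ∈ Λ*` that occur in the kernel of the linearized problem, when the
linearized dynamic boundary condition is `L w = 0`: those for which `η` or `℘` has a nontrivial
`k`-th Fourier coefficient for some `(u, ℘, η)` in the kernel. -/
def kernelModes {d l₁ l₂ : ℝ} {Y : Type*} [NormedAddCommGroup Y] [NormedSpace ℝ Y]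
    (U : ℝ → ℝ) (L : State d l₁ l₂ →L[ℝ] Y) : Set (ℝ × ℝ) :=
  {k | k ∈ dualLattice l₁ l₂ ∧ k ≠ 0 ∧ ∃ w : State d l₁ l₂,
    SolvesLinearized d U w.u w.p w.eta ∧ L w = 0 ∧
    (horizCoeff l₁ l₂ w.eta k ≠ 0 ∨
      ∃ z ∈ Icc (-d) 0, horizCoeff l₁ l₂ (fun x' => w.p ![x' 0, x' 1, z]) k ≠ 0)}

/-- `γ ε = γ 0 + ε w₁ + ε² w₂ + o(ε²)` as `ε → 0`. -/
def HasExpansion {X : Type*} [NormedAddCommGroup X] [NormedSpace ℝ X] (γ : ℝ → X) (w₁ w₂ : X) :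
    Prop :=
  (fun ε : ℝ => γ ε - (γ 0 + ε • w₁ + ε ^ 2 • w₂)) =o[𝓝 0] fun ε : ℝ => ε ^ 2

/-- `u₂ ≡ 0` and `∂₂(u₃, ℘, η) ≡ 0`. -/
def IsTwoDimensional (d : ℝ) (u : R3 → R3) (p : R3 → ℝ) (η : R2 → ℝ) : Prop :=
  (∀ x ∈ closedDomain d, u x 1 = 0) ∧
  (∀ x ∈ closedDomain d, pd 1 (fun y => u y 2) x = 0) ∧
  (∀ x ∈ closedDomain d, pd 1 p x = 0) ∧
  ∀ x', pd 1 η x' = 0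

end WaterWave

end

/-! ### The vertical equation for a Fourier mode of the pressure. -/

namespace WaterWave

/-! The expansion is Taylor's formula, and its first-order term w₁ solves the linearized problem
(`linearizedJet`). The linearized equations leave room for modes with k₂ ≠ 0. What excludes them is
a solvability condition at second order that involves w₁ only.

The condition comes from testing the momentum equation with the solenoidal field ζ = (0,
θ'(x₃)s(x₂), -θ(x₃)s'(x₂)). Since ζ has no first component and does not depend on x₁, every term of
the resulting identity (`SolvesEuler.integral_flux`) is a product with two factors that vanish on
the shear flow. Division by ε² and the limit ε → 0 leave a quadratic identity for w₁
(`integral_flux_linear`), and the second-order term never enters. With a = U u₂ and b = U(u₃ + U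
∂₁φ), and after a divergence is discarded, it reads ∫ U⁻²((a² - b²) s'θ' + ab (sθ'' - s''θ)) = 0
(`LinearizedJet.integral_quadratic`).

The linearized momentum equations give ∂₁a = -∂₂℘ and ∂₁b = -∂₃℘, and (+)-symmetry makes a and b
vanish at x₁ = 0, so both are determined by ℘. The Fourier mode c of ℘ at k satisfies U²(U⁻²c')' =
|k|²c with c'(-d) = 0 (`LinearizedJet.isMode`). Nonzero k with k₁ = 0 do not occur in ℘, and only
finitely many k do: by assumption on N in the general case, and by `exists_wavenumber_bound` for
capillary-gravity waves. Hence, if some mode has k₂ ≠ 0, there is a largest transverse wave number K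
> 0. The choice s = sin(2Kx₂) isolates it, because 2K arises from two transverse wave numbers of
size at most K only as K + K (`integral_top_modes`). An integration by parts in x₃
(`integral_mul_flux_eq_zero`) and the freedom in θ then give the pointwise identity U' · Σ (c'² +
(k₁² - K²)c²)/k₁² = 0, summed over the modes with |k₂| = K.

`deriv_eq_zero_of_modes` shows that this forces U' = 0. Where U' ≠ 0 the sum vanishes locally, so
its derivative does too, which by the mode equation means T = -(U'/U)G with T = Σ cc' and G = Σ
c'²/k₁². Both T and G are positive inside. The continuous function -(U'/U)G/T takes the value 0
where U' = 0 and the value 1 elsewhere, hence is constant, and if U' is not identically zero then T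
= -(U'/U)G everywhere. But near the bottom T vanishes to first order and G to second, a
contradiction. So ℘ has no mode with k₂ ≠ 0 (`prsMode_eq_zero`).

The elevation follows from the relation c'(0) = U(0)²k₁²η for k₁ ≠ 0, and from the dynamic boundary
condition for k₁ = 0. The momentum equations, integrated in x₁, carry the conclusion over to u₂ and
u₃ (`isTwoDimensional_of_modes`). -/

/-- A nonvanishing shear profile `U` with derivative `V`. -/
structure IsProfile (d : ℝ) (U V : ℝ → ℝ) : Prop where
  pos : 0 < d
  cont : ContinuousOn U (Icc (-d) 0)
  cont_deriv : ContinuousOn V (Icc (-d) 0)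
  hasDerivAt : ∀ z ∈ Ioo (-d) 0, HasDerivAt U (V z) z
  ne_zero : ∀ z ∈ Icc (-d) 0, U z ≠ 0

/-- The equation `U² (U⁻² c')' = κ c`, `c'(-d) = 0`, for a Fourier mode `c` of the pressure, with
`e = c'`. -/
structure IsMode (d : ℝ) (U V : ℝ → ℝ) (κ : ℝ) (c e : ℝ → ℝ) : Prop where
  cont : ContinuousOn c (Icc (-d) 0)
  cont_deriv : ContinuousOn e (Icc (-d) 0)
  hasDerivAt : ∀ z ∈ Ioo (-d) 0, HasDerivAt c (e z) z
  hasDerivAt_deriv : ∀ z ∈ Ioo (-d) 0, HasDerivAt e (2 * (V z / U z) * e z + κ * c z) z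
  bottom : e (-d) = 0

section Mode

variable {d κ : ℝ} {U V c e : ℝ → ℝ}

theorem monotoneOn_of_hasDerivAt_nonneg {a b : ℝ} {f f' : ℝ → ℝ} (hf : ContinuousOn f (Icc a b))
    (hf' : ∀ z ∈ Ioo a b, HasDerivAt f (f' z) z) (h : ∀ z ∈ Ioo a b, 0 ≤ f' z) :
    MonotoneOn f (Icc a b) := by
  apply monotoneOn_of_deriv_nonneg (convex_Icc a b) hf
  · rw [interior_Icc]
    exact fun z hz => (hf' z hz).differentiableAt.differentiableWithinAt
  · rw [interior_Icc]
    intro z hz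
    rw [(hf' z hz).deriv]
    exact h z hz

theorem strictMonoOn_of_hasDerivAt_pos {a b : ℝ} {f f' : ℝ → ℝ} (hf : ContinuousOn f (Icc a b))
    (hf' : ∀ z ∈ Ioo a b, HasDerivAt f (f' z) z) (h : ∀ z ∈ Ioo a b, 0 < f' z) :
    StrictMonoOn f (Icc a b) := by
  apply strictMonoOn_of_deriv_pos (convex_Icc a b) hf
  rw [interior_Icc]
  intro z hz
  rw [(hf' z hz).deriv]
  exact h z hz

/-- The weight U⁻² puts the equation into divergence form, (e/U²)' = κc/U², so the flux ce/U² has a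
weighted sum of squares as its derivative. All sign and growth estimates for modes come from
integrating this identity up from the bottom, where the flux is zero. -/
theorem IsMode.hasDerivAt_flux (hU : IsProfile d U V) (h : IsMode d U V κ c e) {z : ℝ}
    (hz : z ∈ Ioo (-d) 0) :
    HasDerivAt (fun z => c z * e z / U z ^ 2) ((e z ^ 2 + κ * c z ^ 2) / U z ^ 2) z := by
  have hne := hU.ne_zero z (Ioo_subset_Icc_self hz)
  refine (((h.hasDerivAt z hz).fun_mul (h.hasDerivAt_deriv z hz)).fun_div
    ((hU.hasDerivAt z hz).fun_pow 2) (pow_ne_zero 2 hne)).congr_deriv ?_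
  push_cast
  field_simp
  ring

theorem IsMode.continuousOn_flux (hU : IsProfile d U V) (h : IsMode d U V κ c e) :
    ContinuousOn (fun z => c z * e z / U z ^ 2) (Icc (-d) 0) :=
  (h.cont.mul h.cont_deriv).div (hU.cont.pow 2) fun z hz => pow_ne_zero 2 (hU.ne_zero z hz)

theorem IsMode.flux_bottom (h : IsMode d U V κ c e) : c (-d) * e (-d) / U (-d) ^ 2 = 0 := by
  simp [h.bottom]

theorem IsProfile.left_mem (hU : IsProfile d U V) : -d ∈ Icc (-d) 0 :=
  ⟨le_rfl, by linarith [hU.pos]⟩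

theorem IsProfile.right_mem (hU : IsProfile d U V) : (0 : ℝ) ∈ Icc (-d) 0 :=
  ⟨by linarith [hU.pos], le_rfl⟩

theorem IsMode.mul_nonneg (hU : IsProfile d U V) (hκ : 0 ≤ κ) (h : IsMode d U V κ c e) {z : ℝ}
    (hz : z ∈ Icc (-d) 0) : 0 ≤ c z * e z := by
  have := monotoneOn_of_hasDerivAt_nonneg (h.continuousOn_flux hU)
    (fun z hz => h.hasDerivAt_flux hU hz) (fun z _ => by positivity) hU.left_mem hz hz.1
  simp only [h.flux_bottom] at this
  have h2 : 0 < U z ^ 2 := by have := hU.ne_zero z hz; positivity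
  have := _root_.mul_nonneg this h2.le
  rwa [div_mul_cancel₀ _ h2.ne'] at this

theorem IsMode.monotoneOn_sq (hU : IsProfile d U V) (hκ : 0 ≤ κ) (h : IsMode d U V κ c e) :
    MonotoneOn (fun z => c z ^ 2) (Icc (-d) 0) := by
  refine monotoneOn_of_hasDerivAt_nonneg (h.cont.pow 2) (f' := fun z => 2 * (c z * e z)) ?_ ?_
  · intro z hz
    refine ((h.hasDerivAt z hz).fun_pow 2).congr_deriv ?_
    push_cast; ring
  · intro z hz
    have := h.mul_nonneg hU hκ (Ioo_subset_Icc_self hz)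
    positivity

/-- Since (c²)' = 2ce ≥ 0, the top value dominates all others. -/
theorem IsMode.eq_zero_of_top (hU : IsProfile d U V) (hκ : 0 ≤ κ) (h : IsMode d U V κ c e)
    (h0 : c 0 = 0) {z : ℝ} (hz : z ∈ Icc (-d) 0) : c z = 0 := by
  have := h.monotoneOn_sq hU hκ hz hU.right_mem hz.2
  simp only [h0] at this
  nlinarith

theorem IsProfile.exists_bound (hU : IsProfile d U V) :
    ∃ C, 0 ≤ C ∧ ∀ z ∈ Icc (-d) 0, |V z / U z| ≤ C := by
  obtain ⟨C, hC⟩ := isCompact_Icc.exists_bound_of_continuousOn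
    (hU.cont_deriv.div hU.cont hU.ne_zero)
  exact ⟨C, (norm_nonneg _).trans (hC 0 hU.right_mem), hC⟩

/-- Uniqueness for the initial value problem, as e also vanishes at the bottom: a Grönwall argument
for c² + e². -/
theorem IsMode.eq_zero_of_bottom (hU : IsProfile d U V) (hκ : 0 ≤ κ) (h : IsMode d U V κ c e)
    (h0 : c (-d) = 0) {z : ℝ} (hz : z ∈ Icc (-d) 0) : c z = 0 := by
  obtain ⟨C, hC0, hC⟩ := hU.exists_bound
  -- This rate absorbs 2(1+κ)ce ≤ (1+κ)(c² + e²) and 4(V/U)e² ≤ 4Ce², so that (c² + e²)exp(-Az) does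
  -- not increase.
  set A : ℝ := 1 + κ + 4 * C with hA
  have key := monotoneOn_of_hasDerivAt_nonneg (a := -d) (b := 0)
    (f := fun z => -((c z ^ 2 + e z ^ 2) * Real.exp (-(A * z))))
    (f' := fun z => -((2 * (c z * e z) + 2 * (e z * (2 * (V z / U z) * e z + κ * c z))) *
      Real.exp (-(A * z)) + (c z ^ 2 + e z ^ 2) * (Real.exp (-(A * z)) * (-A)))) ?_ ?_ ?_
  · have := key hU.left_mem hz hz.1
    simp only [h0, h.bottom] at this
    have hexp := Real.exp_pos (-(A * z))
    have h1 : c z ^ 2 + e z ^ 2 ≤ 0 := by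
      by_contra hcon
      push Not at hcon
      have := mul_pos hcon hexp
      norm_num at *
      linarith
    nlinarith [sq_nonneg (c z), sq_nonneg (e z)]
  · exact (((h.cont.pow 2).add (h.cont_deriv.pow 2)).mul (by fun_prop)).neg
  · intro z hz
    have h1 := (h.hasDerivAt z hz).fun_pow 2
    have h2 := (h.hasDerivAt_deriv z hz).fun_pow 2
    have h3 : HasDerivAt (fun z => Real.exp (-(A * z))) (Real.exp (-(A * z)) * (-A)) z := by
      refine ((hasDerivAt_id' z).const_mul A).fun_neg.exp.congr_deriv ?_
      simp
    refine ((h1.fun_add h2).fun_mul h3).fun_neg.congr_deriv ?_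
    push_cast; ring
  · intro z hz
    have hexp := Real.exp_pos (-(A * z))
    have hb := abs_le.1 (hC z (Ioo_subset_Icc_self hz))
    have : -((2 * (c z * e z) + 2 * (e z * (2 * (V z / U z) * e z + κ * c z))) *
      Real.exp (-(A * z)) + (c z ^ 2 + e z ^ 2) * (Real.exp (-(A * z)) * (-A))) =
      (A * (c z ^ 2 + e z ^ 2) - 2 * (1 + κ) * (c z * e z) - 4 * (V z / U z) * e z ^ 2) *
        Real.exp (-(A * z)) := by ring
    rw [this]
    apply _root_.mul_nonneg _ hexp.le
    have h1 : 0 ≤ (1 + κ) * (c z - e z) ^ 2 := by positivity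
    have h2 : 0 ≤ (C - V z / U z) * e z ^ 2 :=
      _root_.mul_nonneg (by linarith [hb.2]) (sq_nonneg _)
    have h3 : 0 ≤ C * c z ^ 2 := by positivity
    rw [hA]
    nlinarith

/-- c² does not decrease from its positive bottom value, so the flux is strictly increasing. -/
theorem IsMode.mul_pos (hU : IsProfile d U V) (hκ : 0 < κ) (h : IsMode d U V κ c e)
    (h0 : c (-d) ≠ 0) {z : ℝ} (hz : z ∈ Ioc (-d) 0) : 0 < c z * e z := by
  have hz' := Ioc_subset_Icc_self hz
  have := strictMonoOn_of_hasDerivAt_pos (h.continuousOn_flux hU)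
    (fun z hz => h.hasDerivAt_flux hU hz) (fun z hz => by
      have h1 := h.monotoneOn_sq hU hκ.le hU.left_mem (Ioo_subset_Icc_self hz) hz.1.le
      have h2 : 0 < c (-d) ^ 2 := by positivity
      have h3 : 0 < c z ^ 2 := h2.trans_le h1
      have := hU.ne_zero z (Ioo_subset_Icc_self hz)
      positivity) hU.left_mem hz' hz.1
  simp only [h.flux_bottom] at this
  have h2 : 0 < U z ^ 2 := by have := hU.ne_zero z hz'; positivity
  have := _root_.mul_pos this h2
  rwa [div_mul_cancel₀ _ h2.ne'] at this

end Mode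

/-- If the quadratic expression in finitely many modes vanishes wherever `U' ≠ 0`, then either all
of the modes vanish or `U' = 0`. -/
theorem deriv_eq_zero_of_modes {d : ℝ} {U V : ℝ → ℝ} (hU : IsProfile d U V) {ι : Type*}
    (s : Finset ι) (a : ι → ℝ) (ha : ∀ i ∈ s, 0 < a i) (K : ℝ) (c e : ι → ℝ → ℝ)
    (h : ∀ i ∈ s, IsMode d U V (a i ^ 2 + K ^ 2) (c i) (e i))
    (hF : ∀ z ∈ Ioo (-d) 0,
      V z * ∑ i ∈ s, (e i z ^ 2 + (a i ^ 2 - K ^ 2) * c i z ^ 2) / a i ^ 2 = 0)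
    (hne : ∃ i ∈ s, ∃ z ∈ Icc (-d) 0, c i z ≠ 0) : ∀ z ∈ Ioo (-d) 0, V z = 0 := by
  classical
  obtain ⟨i₀, hi₀, z₀, hz₀, hcz⟩ := hne
  have hκ : ∀ i ∈ s, 0 < a i ^ 2 + K ^ 2 := fun i hi => by have := ha i hi; positivity
  have hb : c i₀ (-d) ≠ 0 := fun hb =>
    hcz ((h i₀ hi₀).eq_zero_of_bottom hU (hκ i₀ hi₀).le hb hz₀)
  set T : ℝ → ℝ := fun z => ∑ i ∈ s, c i z * e i z with hT
  set G : ℝ → ℝ := fun z => ∑ i ∈ s, e i z ^ 2 / a i ^ 2 with hG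
  set q : ℝ → ℝ := fun z => V z / U z with hq
  have hqc : ContinuousOn q (Icc (-d) 0) := hU.cont_deriv.div hU.cont hU.ne_zero
  have hTc : ContinuousOn T (Icc (-d) 0) :=
    continuousOn_finsetSum _ fun i hi => (h i hi).cont.mul (h i hi).cont_deriv
  have hGc : ContinuousOn G (Icc (-d) 0) :=
    continuousOn_finsetSum _ fun i hi => ((h i hi).cont_deriv.pow 2).div_const _
  have hTpos : ∀ z ∈ Ioo (-d) 0, 0 < T z := by
    intro z hz
    apply Finset.sum_pos' (fun i hi => (h i hi).mul_nonneg hU (hκ i hi).le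
      (Ioo_subset_Icc_self hz))
    exact ⟨i₀, hi₀, (h i₀ hi₀).mul_pos hU (hκ i₀ hi₀) hb ⟨hz.1, hz.2.le⟩⟩
  have hGpos : ∀ z ∈ Ioo (-d) 0, 0 < G z := by
    intro z hz
    apply Finset.sum_pos' (fun i hi => by positivity)
    refine ⟨i₀, hi₀, ?_⟩
    have h1 := (h i₀ hi₀).mul_pos hU (hκ i₀ hi₀) hb ⟨hz.1, hz.2.le⟩
    have h2 : e i₀ z ≠ 0 := fun h2 => by simp [h2] at h1
    have h3 := ha i₀ hi₀
    positivity
  -- Near a point with V ≠ 0 the sum vanishes identically, so it can be differentiated. The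
  -- equations for e contribute a² + K² and the explicit factor contributes a² - K², so K drops out
  -- and the derivative is 4(T + qG).
  have hdich : ∀ z ∈ Ioo (-d) 0, V z ≠ 0 → T z = -(q z) * G z := by
    intro z hz hVz
    have hVc : ContinuousAt V z := hU.cont_deriv.continuousAt (Icc_mem_nhds hz.1 hz.2)
    have hev : (fun z => ∑ i ∈ s, (e i z ^ 2 + (a i ^ 2 - K ^ 2) * c i z ^ 2) / a i ^ 2)
        =ᶠ[𝓝 z] fun _ => 0 := by
      filter_upwards [hVc.eventually_ne hVz, Ioo_mem_nhds hz.1 hz.2] with y hy hyI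
      exact (mul_eq_zero.1 (hF y hyI)).resolve_left hy
    have hd : HasDerivAt
        (fun z => ∑ i ∈ s, (e i z ^ 2 + (a i ^ 2 - K ^ 2) * c i z ^ 2) / a i ^ 2)
        (∑ i ∈ s, 4 * (c i z * e i z + q z * (e i z ^ 2 / a i ^ 2))) z := by
      refine HasDerivAt.fun_sum fun i hi => ?_
      have hai := (ha i hi).ne'
      refine (((((h i hi).hasDerivAt_deriv z hz).fun_pow 2).fun_add
        ((((h i hi).hasDerivAt z hz).fun_pow 2).const_mul (a i ^ 2 - K ^ 2))).div_const
        (a i ^ 2)).congr_deriv ?_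
      push_cast
      simp only [hq]
      field_simp
      ring
    have h0 := (hd.congr_of_eventuallyEq hev.symm).unique (hasDerivAt_const z (0 : ℝ))
    rw [← Finset.mul_sum, Finset.sum_add_distrib, ← Finset.mul_sum] at h0
    change 4 * (T z + q z * G z) = 0 at h0
    linarith
  -- The set where V ≠ 0 need not be connected. The quotient r is continuous because T > 0, and
  -- takes only the values 0 and 1, so it is constant on the whole interval.
  set r : ℝ → ℝ := fun z => -(q z) * G z / T z with hr
  have hrc : ContinuousOn r (Ioo (-d) 0) :=
    ((hqc.neg.mul hGc).mono Ioo_subset_Icc_self).div (hTc.mono Ioo_subset_Icc_self)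
      fun z hz => (hTpos z hz).ne'
  have hr01 : ∀ z ∈ Ioo (-d) 0, r z = 0 ∨ r z = 1 := by
    intro z hz
    by_cases hVz : V z = 0
    · left; simp [hr, hq, hVz]
    · right
      simp only [hr]
      rw [← hdich z hz hVz, div_self (hTpos z hz).ne']
  have hrconst : ∀ z ∈ Ioo (-d) 0, ∀ y ∈ Ioo (-d) 0, r z = 0 → r y = 1 → False := by
    intro z hz y hy h1 h2
    have := isPreconnected_Ioo.intermediate_value hz hy hrc
    rw [h1, h2] at this
    obtain ⟨w, hw, hwr⟩ := this (show (1 / 2 : ℝ) ∈ Icc 0 1 by constructor <;> norm_num)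
    rcases hr01 w hw with h3 | h3 <;> rw [h3] at hwr <;> norm_num at hwr
  by_contra hcon
  push Not at hcon
  obtain ⟨y, hy, hVy⟩ := hcon
  have hall : ∀ z ∈ Ioo (-d) 0, T z = -(q z) * G z := by
    intro z hz
    by_cases hVz : V z = 0
    · exfalso
      refine hrconst z hz y hy (by simp [hr, hq, hVz]) ?_
      simp only [hr]
      rw [← hdich y hy hVy, div_self (hTpos y hy).ne']
    · exact hdich z hz hVz
  obtain ⟨C, hC0, hC⟩ := hU.exists_bound
  -- At the bottom D = 0 and D' = Σ(a² + K²)c² > 0, so D is positive just above it. On the other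
  -- hand T = -qG ≤ CG makes D nonpositive.
  set D : ℝ → ℝ := fun z => T z - C * G z with hD
  set D' : ℝ → ℝ := fun z => ∑ i ∈ s, ((e i z * e i z +
      c i z * (2 * q z * e i z + (a i ^ 2 + K ^ 2) * c i z)) -
      C * (2 * e i z * (2 * q z * e i z + (a i ^ 2 + K ^ 2) * c i z) / a i ^ 2)) with hD'
  have hDd : ∀ z ∈ Ioo (-d) 0, HasDerivAt D (D' z) z := by
    intro z hz
    have : D = fun z => ∑ i ∈ s, (c i z * e i z - C * (e i z ^ 2 / a i ^ 2)) := by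
      funext z
      simp only [hD, hT, hG, Finset.sum_sub_distrib, Finset.mul_sum]
    rw [this]
    refine HasDerivAt.fun_sum fun i hi => ?_
    have h1 := ((h i hi).hasDerivAt z hz).fun_mul ((h i hi).hasDerivAt_deriv z hz)
    have h2 := ((((h i hi).hasDerivAt_deriv z hz).fun_pow 2).div_const (a i ^ 2)).const_mul C
    refine (h1.fun_sub h2).congr_deriv ?_
    push_cast
    simp only [hq]
    ring
  have hDc : ContinuousOn D (Icc (-d) 0) := hTc.sub (hGc.const_smul C)
  have hD'c : ContinuousOn D' (Icc (-d) 0) := by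
    refine continuousOn_finsetSum _ fun i hi => ?_
    have h1 := (h i hi).cont
    have h2 := (h i hi).cont_deriv
    fun_prop
  have hD'0 : 0 < D' (-d) := by
    have : D' (-d) = ∑ i ∈ s, (a i ^ 2 + K ^ 2) * c i (-d) ^ 2 := by
      refine Finset.sum_congr rfl fun i hi => ?_
      rw [(h i hi).bottom]; ring
    rw [this]
    refine Finset.sum_pos' (fun i hi => by positivity) ⟨i₀, hi₀, ?_⟩
    have := hκ i₀ hi₀
    positivity
  have hev : ∀ᶠ z in 𝓝[Icc (-d) 0] (-d), 0 < D' z :=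
    (hD'c (-d) hU.left_mem).eventually (lt_mem_nhds hD'0)
  obtain ⟨δ, hδ, hball⟩ := Metric.mem_nhdsWithin_iff.1 hev
  set z₁ : ℝ := -d + min (δ / 2) (d / 2) with hz₁
  have hd := hU.pos
  have hm : 0 < min (δ / 2) (d / 2) := by positivity
  have hm1 : min (δ / 2) (d / 2) ≤ δ / 2 := min_le_left _ _
  have hm2 : min (δ / 2) (d / 2) ≤ d / 2 := min_le_right _ _
  have hz₁I : z₁ ∈ Ioo (-d) 0 := ⟨by linarith, by linarith⟩
  have hsub : Icc (-d) z₁ ⊆ Icc (-d) 0 := Icc_subset_Icc_right hz₁I.2.le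
  have hmono := strictMonoOn_of_hasDerivAt_pos (hDc.mono hsub)
    (fun z hz => hDd z ⟨hz.1, hz.2.trans hz₁I.2⟩) (fun z hz => by
      apply hball
      refine ⟨?_, hsub (Ioo_subset_Icc_self hz)⟩
      rw [Metric.mem_ball, Real.dist_eq, abs_lt]
      constructor <;> linarith [hz.1, hz.2])
  have h1 := hmono (left_mem_Icc.2 hz₁I.1.le) (right_mem_Icc.2 hz₁I.1.le) hz₁I.1
  have h2 : D (-d) = 0 := by
    have h3 : T (-d) = 0 := Finset.sum_eq_zero fun i hi => by rw [(h i hi).bottom, mul_zero]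
    have h4 : G (-d) = 0 := Finset.sum_eq_zero fun i hi => by rw [(h i hi).bottom]; simp
    simp [hD, h3, h4]
  rw [h2] at h1
  have h3 : D z₁ = (-(q z₁) - C) * G z₁ := by simp only [hD]; rw [hall z₁ hz₁I]; ring
  have h4 := abs_le.1 (hC z₁ (Ioo_subset_Icc_self hz₁I))
  have h5 : (-(q z₁) - C) ≤ 0 := by simp only [hq]; linarith [h4.1]
  nlinarith [hGpos z₁ hz₁I]

set_option maxHeartbeats 1000000 in
/-- A mode that satisfies the linearized dynamic condition of capillary-gravity waves at the top
has a bounded wave number. -/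
theorem exists_wavenumber_bound {d : ℝ} {U V : ℝ → ℝ} (hU : IsProfile d U V) {g σ : ℝ}
    (hg : 0 < g) (hσ : 0 < σ) : ∃ R : ℝ, ∀ (k₁ κ η : ℝ) (c e : ℝ → ℝ), 0 ≤ κ → k₁ ^ 2 ≤ κ ^ 2 →
      IsMode d U V (κ ^ 2) c e → c 0 = (g + σ * κ ^ 2) * η → e 0 = U 0 ^ 2 * k₁ ^ 2 * η →
      (∃ z ∈ Icc (-d) 0, c z ≠ 0) → κ ≤ R := by
  have hd := hU.pos
  obtain ⟨M, hM⟩ := isCompact_Icc.exists_bound_of_continuousOn hU.cont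
  have hM0 : 0 ≤ M := (norm_nonneg _).trans (hM 0 hU.right_mem)
  have hUM : ∀ z ∈ Icc (-d) 0, U z ^ 2 ≤ (M + 1) ^ 2 := fun z hz => by
    rw [← sq_abs]
    have := hM z hz
    rw [Real.norm_eq_abs] at this
    gcongr
    linarith
  -- A lower bound for 1/U²; M + 1 in place of M makes it positive without further argument.
  set A : ℝ := ((M + 1) ^ 2)⁻¹ with hA
  have hApos : 0 < A := by positivity
  have hAU : ∀ z ∈ Icc (-d) 0, A ≤ 1 / U z ^ 2 := fun z hz => by
    have h1 := hU.ne_zero z hz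
    rw [hA, one_div]
    exact inv_anti₀ (by positivity) (hUM z hz)
  obtain ⟨a, ha, haU⟩ : ∃ a > 0, ∀ z ∈ Icc (-d) 0, a ≤ U z ^ 2 := by
    obtain ⟨z₀, hz₀, hmin⟩ := isCompact_Icc.exists_isMinOn (nonempty_Icc.2 (by linarith : -d ≤ 0))
      (hU.cont.pow 2)
    have := hU.ne_zero z₀ hz₀
    exact ⟨U z₀ ^ 2, by positivity, fun z hz => hmin hz⟩
  set C₂ : ℝ := a * A * d ^ 2 with hC₂
  have hC₂pos : 0 < C₂ := by positivity
  set C₁ : ℝ := A * σ * C₂ with hC₁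
  have hC₁pos : 0 < C₁ := by positivity
  -- The estimates end in C₁κ³ ≤ 1 + C₂κ². For κ > 1 the right side is below (1 + C₂)κ², so κ cannot
  -- exceed (1 + C₂)/C₁. The cubic growth is due to surface tension.
  refine ⟨max 1 ((1 + C₂) / C₁), fun k₁ κ η c e hκ hk h hc he ⟨z₀, hz₀, hcz⟩ => ?_⟩
  by_contra hcon
  push Not at hcon
  obtain ⟨hκ1, hκ2⟩ := max_lt_iff.1 hcon
  have hκpos : 0 < κ := by linarith
  have hc0 : c 0 ≠ 0 := fun h0 => hcz (h.eq_zero_of_top hU (by positivity) h0 hz₀)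
  have hη : η ≠ 0 := fun h0 => hc0 (by rw [hc, h0, mul_zero])
  have hsqd : ∀ z ∈ Ioo (-d) 0, HasDerivAt (fun z => c z ^ 2) (2 * (c z * e z)) z := by
    intro z hz
    refine ((h.hasDerivAt z hz).fun_pow 2).congr_deriv ?_
    push_cast; ring
  -- By e² + κ²c² ≥ 2κce the flux grows at least as fast as Aκc².
  have h1 : A * κ * (c 0 ^ 2 - c (-d) ^ 2) ≤ c 0 * e 0 / U 0 ^ 2 := by
    have := monotoneOn_of_hasDerivAt_nonneg
      (f := fun z => c z * e z / U z ^ 2 - A * κ * c z ^ 2)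
      (f' := fun z => (e z ^ 2 + κ ^ 2 * c z ^ 2) / U z ^ 2 - A * κ * (2 * (c z * e z)))
      ((h.continuousOn_flux hU).sub (continuousOn_const.mul (h.cont.pow 2)))
      (fun z hz => (h.hasDerivAt_flux hU hz).sub ((hsqd z hz).const_mul _))
      (fun z hz => by
        have h1 := hAU z (Ioo_subset_Icc_self hz)
        have h2 : 0 ≤ e z ^ 2 + κ ^ 2 * c z ^ 2 := by positivity
        have h3 := mul_le_mul_of_nonneg_right h1 h2
        rw [one_div_mul_eq_div] at h3
        have h4 := mul_nonneg hApos.le (sq_nonneg (e z - κ * c z))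
        nlinarith) hU.left_mem hU.right_mem hU.left_mem.2
    simp only [h.flux_bottom] at this
    linarith
  -- Here c² is bounded below by its bottom value, which makes the flux grow at least linearly.
  have h2 : ∀ z ∈ Icc (-d) 0, A * κ ^ 2 * c (-d) ^ 2 * (z + d) ≤ c z * e z / U z ^ 2 := by
    intro z hz
    have := monotoneOn_of_hasDerivAt_nonneg
      (f := fun z => c z * e z / U z ^ 2 - A * κ ^ 2 * c (-d) ^ 2 * (z + d))
      (f' := fun z => (e z ^ 2 + κ ^ 2 * c z ^ 2) / U z ^ 2 - A * κ ^ 2 * c (-d) ^ 2 * 1)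
      ((h.continuousOn_flux hU).sub (by fun_prop))
      (fun z hz => (h.hasDerivAt_flux hU hz).sub (((hasDerivAt_id z).add_const d).const_mul _))
      (fun z hz => by
        have hz' := Ioo_subset_Icc_self hz
        have h1 := hAU z hz'
        have h2 : 0 ≤ e z ^ 2 + κ ^ 2 * c z ^ 2 := by positivity
        have h3 := mul_le_mul_of_nonneg_right h1 h2
        rw [one_div_mul_eq_div] at h3
        have h4 : c (-d) ^ 2 ≤ c z ^ 2 := h.monotoneOn_sq hU (by positivity) hU.left_mem hz' hz'.1
        have h5 := mul_le_mul_of_nonneg_left h4 (by positivity : 0 ≤ A * κ ^ 2)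
        nlinarith [mul_nonneg hApos.le (sq_nonneg (e z))]) hU.left_mem hz hz.1
    simp only [h.flux_bottom] at this
    linarith
  -- The linear bound on the flux, integrated once more through (c²)' = 2ce, shows that c(-d)² is
  -- only a fraction of c(0)². The bound `h1` can then be stated in terms of c(0)² alone.
  have h3 : (1 + C₂ * κ ^ 2) * c (-d) ^ 2 ≤ c 0 ^ 2 := by
    have := monotoneOn_of_hasDerivAt_nonneg
      (f := fun z => c z ^ 2 - a * A * κ ^ 2 * c (-d) ^ 2 * (z + d) ^ 2)
      (f' := fun z => 2 * (c z * e z) - a * A * κ ^ 2 * c (-d) ^ 2 * (2 * (z + d)))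
      ((h.cont.pow 2).sub (by fun_prop))
      (fun z hz => by
        refine (hsqd z hz).sub (HasDerivAt.const_mul _ ?_)
        refine (((hasDerivAt_id' z).add_const d).fun_pow 2).congr_deriv ?_
        push_cast; ring)
      (fun z hz => by
        have hz' := Ioo_subset_Icc_self hz
        have h1 := h2 z hz'
        have hne := hU.ne_zero z hz'
        rw [le_div_iff₀ (by positivity)] at h1
        have hzd : 0 ≤ z + d := by linarith [hz.1]
        have h5 := mul_le_mul_of_nonneg_left (haU z hz')
          (by positivity : 0 ≤ A * κ ^ 2 * c (-d) ^ 2 * (z + d))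
        nlinarith) hU.left_mem hU.right_mem hU.left_mem.2
    simp only at this
    rw [hC₂]
    nlinarith
  have hU0 := hU.ne_zero 0 hU.right_mem
  have h4 : c 0 * e 0 / U 0 ^ 2 = k₁ ^ 2 * (g + σ * κ ^ 2) * η ^ 2 := by
    rw [hc, he]; field_simp
  set G : ℝ := g + σ * κ ^ 2 with hG
  have hGpos : 0 < G := by positivity
  have hGσ : σ * κ ^ 2 ≤ G := by rw [hG]; linarith
  rw [h4] at h1
  have hη2 : 0 < η ^ 2 := by positivity
  have hc2 : c 0 ^ 2 = G ^ 2 * η ^ 2 := by rw [hc]; ring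
  have hP : 0 < 1 + C₂ * κ ^ 2 := by positivity
  -- The boundary data evaluate the flux at the top as k₁²Gη² ≤ κ²Gη², while c(0)² = G²η² carries
  -- one more factor G ≥ σκ².
  have h5 : A * κ * (C₂ * κ ^ 2) * (G ^ 2 * η ^ 2) ≤
      (1 + C₂ * κ ^ 2) * (κ ^ 2 * G * η ^ 2) := by
    have e1 := mul_le_mul_of_nonneg_left h1 hP.le
    have e2 := mul_le_mul_of_nonneg_left h3 (by positivity : 0 ≤ A * κ)
    have e3 := mul_le_mul_of_nonneg_left hk (by positivity : 0 ≤ (1 + C₂ * κ ^ 2) * (G * η ^ 2))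
    rw [hc2] at e1 e2
    clear_value G C₁ C₂ A
    linear_combination e1 + e2 + e3
  have h6 : A * κ * C₂ * G ≤ 1 + C₂ * κ ^ 2 := by
    have hpos : 0 < κ ^ 2 * G * η ^ 2 := by positivity
    refine le_of_mul_le_mul_right ?_ hpos
    clear_value G C₁ C₂ A
    linear_combination h5
  have h7 : C₁ * κ * κ ^ 2 ≤ 1 + C₂ * κ ^ 2 := by
    have := mul_le_mul_of_nonneg_left hGσ (by positivity : 0 ≤ A * κ * C₂)
    rw [hC₁]
    linear_combination this + h6
  rw [div_lt_iff₀ hC₁pos] at hκ2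
  have h8 : (1 : ℝ) < κ ^ 2 := by nlinarith
  have h9 := mul_lt_mul_of_pos_right hκ2 (by positivity : 0 < κ ^ 2)
  linarith

end WaterWave

/-! ### Periodic functions with continuous partial derivatives, and the divergence theorem over a
period. -/

namespace WaterWave

/-- One period of the closed fluid domain. -/
def periodBox (d l₁ l₂ : ℝ) : Set R3 := Icc ![0, 0, -d] ![l₁, l₂, 0]

/-- `f` is periodic and continuous, has the partial derivatives `g₀, g₁, g₂` in the
fluid domain, and these are continuous up to the boundary. -/
structure HasPartials (d l₁ l₂ : ℝ) (f g₀ g₁ g₂ : R3 → ℝ) : Prop where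
  cont : Continuous f
  cont₀ : Continuous g₀
  cont₁ : Continuous g₁
  cont₂ : Continuous g₂
  periodic : IsPeriodic l₁ l₂ f
  hasFDerivAt : ∀ x ∈ domain d, HasFDerivAt f
    (g₀ x • (ContinuousLinearMap.proj 0 : R3 →L[ℝ] ℝ) +
      g₁ x • (ContinuousLinearMap.proj 1 : R3 →L[ℝ] ℝ) +
      g₂ x • (ContinuousLinearMap.proj 2 : R3 →L[ℝ] ℝ)) x

theorem isOpen_domain (d : ℝ) : IsOpen (domain d) := isOpen_Ioo.preimage (continuous_apply 2)

namespace HasPartials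

variable {d l₁ l₂ : ℝ} {f g₀ g₁ g₂ f' g₀' g₁' g₂' : R3 → ℝ}

theorem add (h : HasPartials d l₁ l₂ f g₀ g₁ g₂) (h' : HasPartials d l₁ l₂ f' g₀' g₁' g₂') :
    HasPartials d l₁ l₂ (fun x => f x + f' x) (fun x => g₀ x + g₀' x) (fun x => g₁ x + g₁' x)
      (fun x => g₂ x + g₂' x) where
  cont := h.cont.add h'.cont
  cont₀ := h.cont₀.add h'.cont₀
  cont₁ := h.cont₁.add h'.cont₁
  cont₂ := h.cont₂.add h'.cont₂
  periodic := ⟨fun x => by simp only [h.periodic.1 x, h'.periodic.1 x],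
    fun x => by simp only [h.periodic.2 x, h'.periodic.2 x]⟩
  hasFDerivAt := fun x hx => ((h.hasFDerivAt x hx).fun_add (h'.hasFDerivAt x hx)).congr_fderiv (by
    module)

theorem mul (h : HasPartials d l₁ l₂ f g₀ g₁ g₂) (h' : HasPartials d l₁ l₂ f' g₀' g₁' g₂') :
    HasPartials d l₁ l₂ (fun x => f x * f' x) (fun x => g₀ x * f' x + f x * g₀' x)
      (fun x => g₁ x * f' x + f x * g₁' x) (fun x => g₂ x * f' x + f x * g₂' x) where
  cont := h.cont.mul h'.cont
  cont₀ := (h.cont₀.mul h'.cont).add (h.cont.mul h'.cont₀)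
  cont₁ := (h.cont₁.mul h'.cont).add (h.cont.mul h'.cont₁)
  cont₂ := (h.cont₂.mul h'.cont).add (h.cont.mul h'.cont₂)
  periodic := ⟨fun x => by simp only [h.periodic.1 x, h'.periodic.1 x],
    fun x => by simp only [h.periodic.2 x, h'.periodic.2 x]⟩
  hasFDerivAt := fun x hx => ((h.hasFDerivAt x hx).fun_mul (h'.hasFDerivAt x hx)).congr_fderiv (by
    module)

theorem inv (h : HasPartials d l₁ l₂ f g₀ g₁ g₂) (hne : ∀ x, f x ≠ 0) :
    HasPartials d l₁ l₂ (fun x => (f x)⁻¹) (fun x => -g₀ x / f x ^ 2) (fun x => -g₁ x / f x ^ 2)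
      (fun x => -g₂ x / f x ^ 2) where
  cont := h.cont.inv₀ hne
  cont₀ := h.cont₀.neg.div (h.cont.pow 2) fun x => pow_ne_zero 2 (hne x)
  cont₁ := h.cont₁.neg.div (h.cont.pow 2) fun x => pow_ne_zero 2 (hne x)
  cont₂ := h.cont₂.neg.div (h.cont.pow 2) fun x => pow_ne_zero 2 (hne x)
  periodic := ⟨fun x => by simp only [h.periodic.1 x], fun x => by simp only [h.periodic.2 x]⟩
  hasFDerivAt := fun x hx => by
    refine ((hasDerivAt_inv (hne x)).comp_hasFDerivAt x (h.hasFDerivAt x hx)).congr_fderiv ?_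
    ext v
    simp
    ring

theorem of_vertical {u v : ℝ → ℝ} (hu : Continuous u) (hv : Continuous v)
    (h : ∀ z ∈ Ioo (-d) 0, HasDerivAt u (v z) z) :
    HasPartials d l₁ l₂ (fun x => u (x 2)) (fun _ => 0) (fun _ => 0) (fun x => v (x 2)) where
  cont := hu.comp (continuous_apply 2)
  cont₀ := continuous_const
  cont₁ := continuous_const
  cont₂ := hv.comp (continuous_apply 2)
  periodic := ⟨fun x => by simp, fun x => by simp⟩
  hasFDerivAt := fun x hx => by
    refine ((h (x 2) hx).comp_hasFDerivAt x
      (ContinuousLinearMap.proj (R := ℝ) (φ := fun _ : Fin 3 => ℝ) 2).hasFDerivAt).congr_fderiv ?_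
    simp

theorem of_transverse {u v : ℝ → ℝ} (hv : Continuous v) (h : ∀ y, HasDerivAt u (v y) y)
    (hper : ∀ y, u (y + l₂) = u y) :
    HasPartials d l₁ l₂ (fun x => u (x 1)) (fun _ => 0) (fun x => v (x 1)) (fun _ => 0) where
  cont := (continuous_iff_continuousAt.2 fun y => (h y).continuousAt).comp (continuous_apply 1)
  cont₀ := continuous_const
  cont₁ := hv.comp (continuous_apply 1)
  cont₂ := continuous_const
  periodic := ⟨fun x => by simp, fun x => by simp [hper]⟩
  hasFDerivAt := fun x hx => by
    refine ((h (x 1)).comp_hasFDerivAt x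
      (ContinuousLinearMap.proj (R := ℝ) (φ := fun _ : Fin 3 => ℝ) 1).hasFDerivAt).congr_fderiv ?_
    simp

theorem hasDerivAt_line (h : HasPartials d l₁ l₂ f g₀ g₁ g₂) {x : R3} (hx : x ∈ domain d)
    (j : Fin 3) : HasDerivAt (fun t : ℝ => f (x + t • Pi.single j 1)) (![g₀ x, g₁ x, g₂ x] j) 0 := by
  have := (h.hasFDerivAt x hx).hasLineDerivAt (Pi.single j 1)
  refine HasDerivAt.congr_deriv this ?_
  fin_cases j <;> simp

theorem pd_eq (h : HasPartials d l₁ l₂ f g₀ g₁ g₂) {x : R3} (hx : x ∈ domain d) (j : Fin 3) :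
    pd j f x = ![g₀ x, g₁ x, g₂ x] j :=
  (h.hasDerivAt_line hx j).deriv

theorem pd_eq_of_eqOn (h : HasPartials d l₁ l₂ f g₀ g₁ g₂) {x : R3} (hx : x ∈ domain d)
    (hf : EqOn f' f (domain d)) (j : Fin 3) : pd j f' x = ![g₀ x, g₁ x, g₂ x] j := by
  rw [← h.pd_eq hx j]
  have hev : f' =ᶠ[𝓝 x] f := hf.eventuallyEq_of_mem ((isOpen_domain d).mem_nhds hx)
  exact hev.lineDeriv_eq

theorem congr_fun (h : HasPartials d l₁ l₂ f g₀ g₁ g₂) (hf : ∀ x, f' x = f x)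
    (h0 : ∀ x, g₀' x = g₀ x) (h1 : ∀ x, g₁' x = g₁ x) (h2 : ∀ x, g₂' x = g₂ x) :
    HasPartials d l₁ l₂ f' g₀' g₁' g₂' := by
  obtain rfl : f' = f := funext hf
  obtain rfl : g₀' = g₀ := funext h0
  obtain rfl : g₁' = g₁ := funext h1
  obtain rfl : g₂' = g₂ := funext h2
  exact h

end HasPartials

section Integrals

variable {d l₁ l₂ : ℝ}

theorem periodBox_le (hd : 0 < d) (hl₁ : 0 < l₁) (hl₂ : 0 < l₂) :
    (![0, 0, -d] : R3) ≤ ![l₁, l₂, 0] := by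
  intro i
  fin_cases i <;> simp [hd.le, hl₁.le, hl₂.le]

theorem isCompact_periodBox : IsCompact (periodBox d l₁ l₂) := isCompact_Icc

theorem integrableOn_periodBox {f : R3 → ℝ} (hf : Continuous f) :
    MeasureTheory.IntegrableOn f (periodBox d l₁ l₂) :=
  hf.continuousOn.integrableOn_compact isCompact_periodBox

theorem periodBox_eq_pi :
    periodBox d l₁ l₂ = Set.pi univ fun i => Icc ((![0, 0, -d] : R3) i) ((![l₁, l₂, 0] : R3) i) := by
  rw [Set.pi_univ_Icc]; rfl

/-- The integral of a product function over a period. -/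
theorem integral_periodBox_mul (hd : 0 < d) (hl₁ : 0 < l₁) (hl₂ : 0 < l₂) (f₀ f₁ f₂ : ℝ → ℝ) :
    ∫ x in periodBox d l₁ l₂, f₀ (x 0) * f₁ (x 1) * f₂ (x 2) =
      (∫ t in (0 : ℝ)..l₁, f₀ t) * (∫ t in (0 : ℝ)..l₂, f₁ t) * ∫ t in (-d)..0, f₂ t := by
  rw [periodBox_eq_pi, MeasureTheory.volume_pi, MeasureTheory.Measure.restrict_pi_pi]
  have := MeasureTheory.integral_fintype_prod_eq_prod (𝕜 := ℝ)
    (fun i : Fin 3 => (![f₀, f₁, f₂] i : ℝ → ℝ))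
    (μ := fun i => MeasureTheory.volume.restrict (Icc ((![0, 0, -d] : R3) i) ((![l₁, l₂, 0] : R3) i)))
  simp only [Fin.prod_univ_three] at this
  simp only [Matrix.cons_val_zero, Matrix.cons_val_one, Matrix.cons_val_two,
    Matrix.tail_cons, Matrix.head_cons] at this
  rw [this, intervalIntegral.integral_of_le hl₁.le, intervalIntegral.integral_of_le hl₂.le,
    intervalIntegral.integral_of_le (by linarith), MeasureTheory.integral_Icc_eq_integral_Ioc,
    MeasureTheory.integral_Icc_eq_integral_Ioc, MeasureTheory.integral_Icc_eq_integral_Ioc]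

variable {f g₀ g₁ g₂ : R3 → ℝ}

/-- The divergence theorem for a field with the single component f in direction j: the two faces
normal to j cancel and the others carry no flux. Differentiability is needed only in the open box.
-/
theorem HasPartials.integral_eq_faces (hd : 0 < d) (hl₁ : 0 < l₁) (hl₂ : 0 < l₂)
    (h : HasPartials d l₁ l₂ f g₀ g₁ g₂) (j : Fin 3)
    (hface : ∀ y : Fin 2 → ℝ,
      f (j.insertNth ((![l₁, l₂, 0] : R3) j) y) = f (j.insertNth ((![0, 0, -d] : R3) j) y)) :
    ∫ x in periodBox d l₁ l₂, ![g₀ x, g₁ x, g₂ x] j = 0 := by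
  have key := MeasureTheory.integral_divergence_of_hasFDerivAt_off_countable'
    _ _ (periodBox_le hd hl₁ hl₂) (fun i => if i = j then f else fun _ => 0)
    (fun i x => if i = j then (g₀ x • (ContinuousLinearMap.proj 0 : R3 →L[ℝ] ℝ) +
      g₁ x • (ContinuousLinearMap.proj 1 : R3 →L[ℝ] ℝ) +
      g₂ x • (ContinuousLinearMap.proj 2 : R3 →L[ℝ] ℝ)) else 0) ∅ countable_empty
    (fun i => by
      split_ifs
      · exact h.cont.continuousOn
      · exact continuousOn_const)
    (fun x hx i => by
      split_ifs
      · exact h.hasFDerivAt x (by simpa [domain] using hx.1 2 (mem_univ _))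
      · exact hasFDerivAt_const _ _)
    (by
      refine Continuous.integrableOn_Icc ?_
      have := h.cont₀
      have := h.cont₁
      have := h.cont₂
      refine continuous_finsetSum _ fun i _ => ?_
      split_ifs <;> simp <;> fun_prop)
  have hl : (∫ x in periodBox d l₁ l₂, ![g₀ x, g₁ x, g₂ x] j) = ∫ x in periodBox d l₁ l₂,
      ∑ i : Fin 3, (if i = j then (g₀ x • (ContinuousLinearMap.proj 0 : R3 →L[ℝ] ℝ) +
      g₁ x • (ContinuousLinearMap.proj 1 : R3 →L[ℝ] ℝ) +
      g₂ x • (ContinuousLinearMap.proj 2 : R3 →L[ℝ] ℝ)) else 0) (Pi.single i 1) := by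
    congr 1
    funext x
    rw [Finset.sum_eq_single j]
    · fin_cases j <;> simp
    · intro i _ hi; simp [hi]
    · simp
  rw [hl]
  refine key.trans (Finset.sum_eq_zero fun i _ => ?_)
  by_cases hi : i = j
  · subst hi
    simp only [if_true]
    simp_rw [hface]
    exact sub_self _
  · simp [hi]

theorem HasPartials.integral₀ (hd : 0 < d) (hl₁ : 0 < l₁) (hl₂ : 0 < l₂)
    (h : HasPartials d l₁ l₂ f g₀ g₁ g₂) : ∫ x in periodBox d l₁ l₂, g₀ x = 0 := by
  refine h.integral_eq_faces hd hl₁ hl₂ 0 fun y => ?_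
  conv_rhs => rw [← h.periodic.1]
  congr 1
  ext i
  refine Fin.cases ?_ (fun k => ?_) i <;> simp

theorem HasPartials.integral₁ (hd : 0 < d) (hl₁ : 0 < l₁) (hl₂ : 0 < l₂)
    (h : HasPartials d l₁ l₂ f g₀ g₁ g₂) : ∫ x in periodBox d l₁ l₂, g₁ x = 0 := by
  refine h.integral_eq_faces hd hl₁ hl₂ 1 fun y => ?_
  conv_rhs => rw [← h.periodic.2]
  congr 1
  ext i
  refine Fin.succAboveCases 1 ?_ (fun k => ?_) i <;> simp

/-- There is no periodicity in the vertical direction, so vanishing on the surface and on the bottom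
takes its place. -/
theorem HasPartials.integral₂ (hd : 0 < d) (hl₁ : 0 < l₁) (hl₂ : 0 < l₂)
    (h : HasPartials d l₁ l₂ f g₀ g₁ g₂) (h0 : ∀ x : R3, x 2 = 0 ∨ x 2 = -d → f x = 0) :
    ∫ x in periodBox d l₁ l₂, g₂ x = 0 := by
  refine h.integral_eq_faces hd hl₁ hl₂ 2 fun y => ?_
  rw [h0 _ (Or.inl (by simp)), h0 _ (Or.inr (by simp))]

end Integrals

end WaterWave

/-! ### Values and derivatives of a state as continuous linear functionals. -/

namespace WaterWave

section Jets

variable {n : ℕ} {F : Type*} [NormedAddCommGroup F] [NormedSpace ℝ F] {S : Set (Fin n → ℝ)}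

noncomputable section

/-- Evaluation of a `C²` function at a point. -/
def C2.eval₀ (x : S) : C2 S F →L[ℝ] F :=
  (BoundedContinuousFunction.evalCLM ℝ x).comp
    ((ContinuousLinearMap.fst ℝ _ _).comp (c2Submodule S F).subtypeL)

/-- Evaluation of a first partial derivative of a `C²` function at a point. -/
def C2.eval₁ (j : Fin n) (x : S) : C2 S F →L[ℝ] F :=
  (ContinuousLinearMap.apply ℝ F (Pi.single j 1 : Fin n → ℝ)).comp
    ((BoundedContinuousFunction.evalCLM ℝ x).comp
      ((ContinuousLinearMap.fst ℝ _ _).comp ((ContinuousLinearMap.snd ℝ _ _).comp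
        (c2Submodule S F).subtypeL)))

/-- Evaluation of a second partial derivative of a `C²` function at a point. -/
def C2.eval₂ (j k : Fin n) (x : S) : C2 S F →L[ℝ] F :=
  (ContinuousLinearMap.apply ℝ F (Pi.single j 1 : Fin n → ℝ)).comp
    ((ContinuousLinearMap.apply ℝ ((Fin n → ℝ) →L[ℝ] F) (Pi.single k 1 : Fin n → ℝ)).comp
      ((BoundedContinuousFunction.evalCLM ℝ x).comp
        ((ContinuousLinearMap.snd ℝ _ _).comp ((ContinuousLinearMap.snd ℝ _ _).comp
          (c2Submodule S F).subtypeL))))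

end

theorem C2.eval₁_apply (j : Fin n) (x : S) (f : C2 S F) :
    C2.eval₁ j x f = f.1.2.1 x (Pi.single j 1) := rfl

theorem zeroExt_apply (x : S) (f : S → F) : zeroExt S f x = f x :=
  Subtype.val_injective.extend_apply f 0 x

theorem C2.fn_apply (x : S) (f : C2 S F) : C2.fn f x = C2.eval₀ x f := zeroExt_apply x _

theorem norm_single_one_le (j : Fin n) : ‖(Pi.single j 1 : Fin n → ℝ)‖ ≤ 1 := by
  rw [pi_norm_le_iff_of_nonneg zero_le_one]
  intro i
  by_cases h : i = j
  · subst h; simp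
  · simp [h]

theorem C2.norm_eval₀_le (x : S) (f : C2 S F) : ‖C2.eval₀ x f‖ ≤ ‖f‖ :=
  (f.1.1.norm_coe_le_norm x).trans (norm_fst_le f.1)

theorem C2.norm_eval₁_le (j : Fin n) (x : S) (f : C2 S F) : ‖C2.eval₁ j x f‖ ≤ ‖f‖ := by
  rw [C2.eval₁_apply]
  calc _ ≤ ‖f.1.2.1 x‖ * ‖(Pi.single j 1 : Fin n → ℝ)‖ := ContinuousLinearMap.le_opNorm _ _
    _ ≤ ‖f.1.2.1 x‖ * 1 := by gcongr; exact norm_single_one_le j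
    _ ≤ ‖f.1.2.1‖ := by rw [mul_one]; exact f.1.2.1.norm_coe_le_norm x
    _ ≤ ‖f.1.2‖ := norm_fst_le _
    _ ≤ ‖f‖ := norm_snd_le f.1

theorem C2.continuous_eval₀ (f : C2 S F) : Continuous fun x : S => C2.eval₀ x f :=
  f.1.1.continuous

theorem C2.continuous_eval₁ (j : Fin n) (f : C2 S F) : Continuous fun x : S => C2.eval₁ j x f :=
  f.1.2.1.continuous.clm_apply continuous_const

theorem C2.continuous_eval₂ (j k : Fin n) (f : C2 S F) :
    Continuous fun x : S => C2.eval₂ j k x f :=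
  (f.1.2.2.continuous.clm_apply continuous_const).clm_apply continuous_const

theorem C2.hasFDerivAt_fn (f : C2 S F) (x : S) (hx : S ∈ 𝓝 (x : Fin n → ℝ)) :
    HasFDerivAt (C2.fn f) (f.1.2.1 x) x :=
  (f.2 x).1.hasFDerivAt hx

theorem C2.hasFDerivAt_deriv (f : C2 S F) (x : S) (hx : S ∈ 𝓝 (x : Fin n → ℝ)) :
    HasFDerivAt (zeroExt S f.1.2.1) (f.1.2.2 x) x :=
  (f.2 x).2.hasFDerivAt hx

end Jets

section StateJets

variable {d l₁ l₂ : ℝ}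

theorem exists_clamp_mem (hd : 0 < d) (x : R3) :
    Function.update x 2 (max (-d) (min (x 2) 0)) ∈ closedDomain d := by
  simp [closedDomain, hd.le]

noncomputable section

/-- The point of the closed fluid domain closest to `x`. -/
def clamp (hd : 0 < d) (x : R3) : closedDomain d :=
  ⟨Function.update x 2 (max (-d) (min (x 2) 0)), exists_clamp_mem hd x⟩

/-- The horizontal position below `x`. -/
def horiz (x : R3) : (univ : Set R2) := ⟨![x 0, x 1], mem_univ _⟩

/-- The velocity component `uᵢ` at `x`. -/
def vel (hd : 0 < d) (i : Fin 3) (x : R3) : State d l₁ l₂ →L[ℝ] ℝ :=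
  (ContinuousLinearMap.proj i).comp ((C2.eval₀ (clamp hd x)).comp
    ((VelocitySpace d l₁ l₂).subtypeL.comp (ContinuousLinearMap.fst ℝ _ _)))

/-- The derivative `∂ⱼuᵢ` at `x`. -/
def dvel (hd : 0 < d) (i j : Fin 3) (x : R3) : State d l₁ l₂ →L[ℝ] ℝ :=
  (ContinuousLinearMap.proj i).comp ((C2.eval₁ j (clamp hd x)).comp
    ((VelocitySpace d l₁ l₂).subtypeL.comp (ContinuousLinearMap.fst ℝ _ _)))

/-- The pressure at `x`. -/
def prs (hd : 0 < d) (x : R3) : State d l₁ l₂ →L[ℝ] ℝ :=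
  (C2.eval₀ (clamp hd x)).comp ((ScalarSpace (closedDomain d) l₁ l₂).subtypeL.comp
    ((ContinuousLinearMap.fst ℝ _ _).comp (ContinuousLinearMap.snd ℝ _ _)))

/-- The derivative `∂ⱼ℘` at `x`. -/
def dprs (hd : 0 < d) (j : Fin 3) (x : R3) : State d l₁ l₂ →L[ℝ] ℝ :=
  (C2.eval₁ j (clamp hd x)).comp ((ScalarSpace (closedDomain d) l₁ l₂).subtypeL.comp
    ((ContinuousLinearMap.fst ℝ _ _).comp (ContinuousLinearMap.snd ℝ _ _)))

/-- The surface elevation above `x`. -/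
def elv (x : R3) : State d l₁ l₂ →L[ℝ] ℝ :=
  (C2.eval₀ (horiz x)).comp ((ScalarSpace (univ : Set R2) l₁ l₂).subtypeL.comp
    ((ContinuousLinearMap.snd ℝ _ _).comp (ContinuousLinearMap.snd ℝ _ _)))

/-- The derivative `∂ⱼη` above `x`. -/
def delv (j : Fin 2) (x : R3) : State d l₁ l₂ →L[ℝ] ℝ :=
  (C2.eval₁ j (horiz x)).comp ((ScalarSpace (univ : Set R2) l₁ l₂).subtypeL.comp
    ((ContinuousLinearMap.snd ℝ _ _).comp (ContinuousLinearMap.snd ℝ _ _)))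

/-- The second derivative `∂ₖ∂ⱼη` above `x`. -/
def ddelv (j k : Fin 2) (x : R3) : State d l₁ l₂ →L[ℝ] ℝ :=
  (C2.eval₂ j k (horiz x)).comp ((ScalarSpace (univ : Set R2) l₁ l₂).subtypeL.comp
    ((ContinuousLinearMap.snd ℝ _ _).comp (ContinuousLinearMap.snd ℝ _ _)))

end

theorem vel_def (hd : 0 < d) (i : Fin 3) (x : R3) (w : State d l₁ l₂) :
    vel hd i x w = C2.eval₀ (clamp hd x) w.1.1 i := rfl

theorem dvel_def (hd : 0 < d) (i j : Fin 3) (x : R3) (w : State d l₁ l₂) :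
    dvel hd i j x w = C2.eval₁ j (clamp hd x) w.1.1 i := rfl

theorem prs_def (hd : 0 < d) (x : R3) (w : State d l₁ l₂) :
    prs hd x w = C2.eval₀ (clamp hd x) w.2.1.1 := rfl

theorem dprs_def (hd : 0 < d) (j : Fin 3) (x : R3) (w : State d l₁ l₂) :
    dprs hd j x w = C2.eval₁ j (clamp hd x) w.2.1.1 := rfl

theorem elv_def (x : R3) (w : State d l₁ l₂) : elv x w = C2.eval₀ (horiz x) w.2.2.1 := rfl

theorem delv_def (j : Fin 2) (x : R3) (w : State d l₁ l₂) :
    delv j x w = C2.eval₁ j (horiz x) w.2.2.1 := rfl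

theorem ddelv_def (j k : Fin 2) (x : R3) (w : State d l₁ l₂) :
    ddelv j k x w = C2.eval₂ j k (horiz x) w.2.2.1 := rfl

theorem domain_subset_closedDomain : domain d ⊆ closedDomain d := fun _ hx => Ioo_subset_Icc_self hx

theorem clamp_of_mem (hd : 0 < d) {x : R3} (hx : x ∈ closedDomain d) : (clamp hd x : R3) = x := by
  have h1 : min (x 2) 0 = x 2 := min_eq_left hx.2
  have h2 : max (-d) (x 2) = x 2 := max_eq_right hx.1
  simp [clamp, h1, h2]

theorem continuous_clamp (hd : 0 < d) : Continuous (clamp hd) := by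
  refine Continuous.subtype_mk ?_ _
  exact continuous_id.update 2 (by fun_prop)

theorem continuous_horiz : Continuous horiz := by
  refine Continuous.subtype_mk ?_ _
  fun_prop

theorem u_apply_eq (hd : 0 < d) (w : State d l₁ l₂) {x : R3} (hx : x ∈ closedDomain d)
    (i : Fin 3) : w.u x i = vel hd i x w := by
  rw [vel_def, ← C2.fn_apply, clamp_of_mem hd hx]; rfl

theorem p_apply_eq (hd : 0 < d) (w : State d l₁ l₂) {x : R3} (hx : x ∈ closedDomain d) :
    w.p x = prs hd x w := by
  rw [prs_def, ← C2.fn_apply, clamp_of_mem hd hx]; rfl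

theorem eta_apply_eq (w : State d l₁ l₂) (x : R3) : w.eta ![x 0, x 1] = elv x w := by
  rw [elv_def, ← C2.fn_apply]; rfl

theorem clamp_add_zero (hd : 0 < d) (x : R3) (t : ℝ) :
    (clamp hd (x + Pi.single 0 t) : R3) = (clamp hd x : R3) + Pi.single 0 t := by
  ext i; fin_cases i <;> simp [clamp]

theorem clamp_add_one (hd : 0 < d) (x : R3) (t : ℝ) :
    (clamp hd (x + Pi.single 1 t) : R3) = (clamp hd x : R3) + Pi.single 1 t := by
  ext i; fin_cases i <;> simp [clamp]

theorem clamp_reflect (hd : 0 < d) (x : R3) (j : Fin 3) (hj : j ≠ 2) :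
    (clamp hd (reflect j x) : R3) = reflect j (clamp hd x : R3) := by
  ext i; fin_cases i <;> fin_cases j <;> simp [clamp, reflect] at hj ⊢

theorem horiz_add_zero (x : R3) (t : ℝ) :
    (horiz (x + Pi.single 0 t) : R2) = (horiz x : R2) + Pi.single 0 t := by
  ext i; fin_cases i <;> simp [horiz]

theorem horiz_add_one (x : R3) (t : ℝ) :
    (horiz (x + Pi.single 1 t) : R2) = (horiz x : R2) + Pi.single 1 t := by
  ext i; fin_cases i <;> simp [horiz]

theorem vel_periodic (hd : 0 < d) (i : Fin 3) (w : State d l₁ l₂) :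
    IsPeriodic l₁ l₂ fun x => vel hd i x w := by
  obtain ⟨h1, h2⟩ := w.1.2.1
  constructor
  · intro x
    simp only [vel_def, ← C2.fn_apply, clamp_add_zero]; rw [h1]
  · intro x
    simp only [vel_def, ← C2.fn_apply, clamp_add_one]; rw [h2]

theorem prs_periodic (hd : 0 < d) (w : State d l₁ l₂) :
    IsPeriodic l₁ l₂ fun x => prs hd x w := by
  obtain ⟨h1, h2⟩ := w.2.1.2.1
  constructor
  · intro x
    simp only [prs_def, ← C2.fn_apply, clamp_add_zero]; rw [h1]
  · intro x
    simp only [prs_def, ← C2.fn_apply, clamp_add_one]; rw [h2]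

theorem elv_periodic (w : State d l₁ l₂) : IsPeriodic l₁ l₂ fun x : R3 => elv x w := by
  obtain ⟨h1, h2⟩ := w.2.2.2.1
  constructor
  · intro x
    simp only [elv_def, ← C2.fn_apply, horiz_add_zero]; rw [h1]
  · intro x
    simp only [elv_def, ← C2.fn_apply, horiz_add_one]; rw [h2]

theorem vel_one_reflect (hd : 0 < d) (x : R3) (w : State d l₁ l₂) :
    vel hd 1 (reflect 0 x) w = -vel hd 1 x w := by
  simp only [vel_def, ← C2.fn_apply, clamp_reflect hd x 0 (by decide)]
  rw [w.1.2.2.1]; simp [reflect]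

theorem vel_two_reflect (hd : 0 < d) (x : R3) (w : State d l₁ l₂) :
    vel hd 2 (reflect 0 x) w = -vel hd 2 x w := by
  simp only [vel_def, ← C2.fn_apply, clamp_reflect hd x 0 (by decide)]
  rw [w.1.2.2.1]; simp [reflect]

theorem prs_reflect (hd : 0 < d) (x : R3) (w : State d l₁ l₂) :
    prs hd (reflect 0 x) w = prs hd x w ∧ prs hd (reflect 1 x) w = prs hd x w := by
  simp only [prs_def, ← C2.fn_apply, clamp_reflect hd x 0 (by decide),
    clamp_reflect hd x 1 (by decide)]
  exact ⟨w.2.1.2.2.1 _, w.2.1.2.2.2 _⟩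

theorem elv_reflect (x : R3) (w : State d l₁ l₂) :
    elv (reflect 0 x) w = elv x w ∧ elv (reflect 1 x) w = elv x w := by
  simp only [elv_def, ← C2.fn_apply]
  constructor
  · rw [← w.2.2.2.2.1]
    congr 1
    ext i; fin_cases i <;> simp [horiz, reflect]
  · rw [← w.2.2.2.2.2]
    congr 1
    ext i; fin_cases i <;> simp [horiz, reflect]

theorem closedDomain_mem_nhds {x : R3} (hx : x ∈ domain d) : closedDomain d ∈ 𝓝 x :=
  mem_of_superset ((isOpen_domain d).mem_nhds hx) domain_subset_closedDomain

theorem clm_eq_sum_proj (L : R3 →L[ℝ] ℝ) :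
    L = L (Pi.single 0 1) • (ContinuousLinearMap.proj 0 : R3 →L[ℝ] ℝ) +
      L (Pi.single 1 1) • (ContinuousLinearMap.proj 1 : R3 →L[ℝ] ℝ) +
      L (Pi.single 2 1) • (ContinuousLinearMap.proj 2 : R3 →L[ℝ] ℝ) := by
  ext v
  conv_lhs => rw [← Finset.univ_sum_single v, map_sum, Fin.sum_univ_three]
  have h : ∀ i : Fin 3, (Pi.single i (v i) : R3) = v i • Pi.single i 1 := fun i => by
    rw [← Pi.single_smul]; simp
  simp only [h, map_smul]
  simp [mul_comm]

/-- Composition with `clamp` makes u and its first derivatives continuous on all of ℝ³.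
Differentiability is claimed only in the open domain, where `clamp` is the identity nearby. This
division of labour is the reason for the form of `HasPartials`. -/
theorem hasPartials_vel (hd : 0 < d) (i : Fin 3) (w : State d l₁ l₂) :
    HasPartials d l₁ l₂ (fun x => vel hd i x w) (fun x => dvel hd i 0 x w)
      (fun x => dvel hd i 1 x w) (fun x => dvel hd i 2 x w) where
  cont := (continuous_apply i).comp ((C2.continuous_eval₀ w.1.1).comp (continuous_clamp hd))
  cont₀ := (continuous_apply i).comp ((C2.continuous_eval₁ 0 w.1.1).comp (continuous_clamp hd))
  cont₁ := (continuous_apply i).comp ((C2.continuous_eval₁ 1 w.1.1).comp (continuous_clamp hd))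
  cont₂ := (continuous_apply i).comp ((C2.continuous_eval₁ 2 w.1.1).comp (continuous_clamp hd))
  periodic := vel_periodic hd i w
  hasFDerivAt := fun x hx => by
    have hx' := domain_subset_closedDomain hx
    have h := C2.hasFDerivAt_fn w.1.1 ⟨x, hx'⟩ (closedDomain_mem_nhds hx)
    have h2 := (ContinuousLinearMap.proj (R := ℝ) (φ := fun _ : Fin 3 => ℝ) i).hasFDerivAt.comp x h
    have hev : (fun x => vel hd i x w) =ᶠ[𝓝 x] fun y => C2.fn w.1.1 y i := by
      filter_upwards [closedDomain_mem_nhds hx] with y hy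
      exact (u_apply_eq hd w hy i).symm
    refine (h2.congr_of_eventuallyEq hev).congr_fderiv ?_
    have hc : clamp hd x = ⟨x, hx'⟩ := Subtype.ext (clamp_of_mem hd hx')
    rw [clm_eq_sum_proj (ContinuousLinearMap.comp _ _)]
    simp only [dvel_def, hc, C2.eval₁_apply]
    rfl

theorem hasPartials_prs (hd : 0 < d) (w : State d l₁ l₂) :
    HasPartials d l₁ l₂ (fun x => prs hd x w) (fun x => dprs hd 0 x w)
      (fun x => dprs hd 1 x w) (fun x => dprs hd 2 x w) where
  cont := (C2.continuous_eval₀ w.2.1.1).comp (continuous_clamp hd)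
  cont₀ := (C2.continuous_eval₁ 0 w.2.1.1).comp (continuous_clamp hd)
  cont₁ := (C2.continuous_eval₁ 1 w.2.1.1).comp (continuous_clamp hd)
  cont₂ := (C2.continuous_eval₁ 2 w.2.1.1).comp (continuous_clamp hd)
  periodic := prs_periodic hd w
  hasFDerivAt := fun x hx => by
    have hx' := domain_subset_closedDomain hx
    have h := C2.hasFDerivAt_fn w.2.1.1 ⟨x, hx'⟩ (closedDomain_mem_nhds hx)
    have hev : (fun x => prs hd x w) =ᶠ[𝓝 x] C2.fn w.2.1.1 := by
      filter_upwards [closedDomain_mem_nhds hx] with y hy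
      exact (p_apply_eq hd w hy).symm
    refine (h.congr_of_eventuallyEq hev).congr_fderiv ?_
    have hc : clamp hd x = ⟨x, hx'⟩ := Subtype.ext (clamp_of_mem hd hx')
    conv_lhs => rw [clm_eq_sum_proj (w.2.1.1.1.2.1 ⟨x, hx'⟩)]
    simp only [dprs_def, hc, C2.eval₁_apply]

/-- The projection `x ↦ x'`. -/
noncomputable def horizL : R3 →L[ℝ] R2 :=
  ContinuousLinearMap.pi ![ContinuousLinearMap.proj 0, ContinuousLinearMap.proj 1]

theorem horizL_apply (x : R3) : horizL x = (horiz x : R2) := by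
  ext i; fin_cases i <;> simp [horizL, horiz]

theorem hasPartials_horiz {f : R2 → ℝ} {f' : R2 → R2 →L[ℝ] ℝ} {g₀ g₁ : R3 → ℝ}
    (hf : ∀ y, HasFDerivAt f (f' y) y)
    (h0 : ∀ x : R3, g₀ x = f' (horiz x) (Pi.single 0 1))
    (h1 : ∀ x : R3, g₁ x = f' (horiz x) (Pi.single 1 1)) (hc0 : Continuous g₀) (hc1 : Continuous g₁)
    (hper : IsPeriodic l₁ l₂ fun x : R3 => f (horiz x)) :
    HasPartials d l₁ l₂ (fun x => f (horiz x)) g₀ g₁ (fun _ => 0) where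
  cont := (continuous_iff_continuousAt.2 fun y => (hf y).continuousAt).comp
    (continuous_subtype_val.comp continuous_horiz)
  cont₀ := hc0
  cont₁ := hc1
  cont₂ := continuous_const
  periodic := hper
  hasFDerivAt := fun x hx => by
    have h : HasFDerivAt (fun x : R3 => f (horizL x)) ((f' (horizL x)).comp horizL) x :=
      (hf (horizL x)).comp x horizL.hasFDerivAt
    simp only [horizL_apply] at h
    refine h.congr_fderiv ?_
    conv_lhs => rw [clm_eq_sum_proj (ContinuousLinearMap.comp _ _)]
    have e0 : horizL (Pi.single 0 1) = Pi.single 0 1 := by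
      ext i; fin_cases i <;> simp [horizL]
    have e1 : horizL (Pi.single 1 1) = Pi.single 1 1 := by
      ext i; fin_cases i <;> simp [horizL]
    have e2 : horizL (Pi.single 2 1) = 0 := by
      ext i; fin_cases i <;> simp [horizL]
    simp only [ContinuousLinearMap.comp_apply, e0, e1, e2, h0, h1, map_zero]

theorem hasPartials_elv (w : State d l₁ l₂) :
    HasPartials d l₁ l₂ (fun x => elv x w) (fun x => delv 0 x w) (fun x => delv 1 x w)
      (fun _ => 0) := by
  have := hasPartials_horiz (d := d) (l₁ := l₁) (l₂ := l₂) (f := C2.fn w.2.2.1)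
    (f' := fun y => w.2.2.1.1.2.1 ⟨y, mem_univ y⟩)
    (g₀ := fun x => delv 0 x w) (g₁ := fun x => delv 1 x w)
    (fun y => C2.hasFDerivAt_fn w.2.2.1 ⟨y, mem_univ y⟩ univ_mem) (fun x => rfl) (fun x => rfl)
    ((C2.continuous_eval₁ 0 w.2.2.1).comp continuous_horiz)
    ((C2.continuous_eval₁ 1 w.2.2.1).comp continuous_horiz)
    (by simpa only [C2.fn_apply] using! elv_periodic w)
  simpa only [C2.fn_apply] using! this

/-- A translated periodic function is the same function, so uniqueness of the derivative equates its
derivatives at the two points. -/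
theorem delv_periodic (j : Fin 2) (w : State d l₁ l₂) :
    IsPeriodic l₁ l₂ fun x : R3 => delv j x w := by
  have key : ∀ (t : R2), (∀ y, C2.fn w.2.2.1 (y + t) = C2.fn w.2.2.1 y) → ∀ y : R2,
      w.2.2.1.1.2.1 ⟨y + t, mem_univ _⟩ = w.2.2.1.1.2.1 ⟨y, mem_univ _⟩ := by
    intro t ht y
    have h1 := C2.hasFDerivAt_fn w.2.2.1 ⟨y + t, mem_univ _⟩ univ_mem
    have h2 := C2.hasFDerivAt_fn w.2.2.1 ⟨y, mem_univ _⟩ univ_mem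
    have h3 := (hasFDerivAt_comp_add_right (f := C2.fn w.2.2.1) (x := y) t).2 h1
    simp only [ht] at h3
    exact h3.unique h2
  obtain ⟨h1, h2⟩ := w.2.2.2.1
  constructor
  · intro x
    simp only [delv_def, C2.eval₁_apply]
    rw [show horiz (x + Pi.single 0 l₁) = ⟨(horiz x : R2) + Pi.single 0 l₁, mem_univ _⟩ from
      Subtype.ext (horiz_add_zero x l₁), key _ h1]
  · intro x
    simp only [delv_def, C2.eval₁_apply]
    rw [show horiz (x + Pi.single 1 l₂) = ⟨(horiz x : R2) + Pi.single 1 l₂, mem_univ _⟩ from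
      Subtype.ext (horiz_add_one x l₂), key _ h2]

theorem hasPartials_delv (j : Fin 2) (w : State d l₁ l₂) :
    HasPartials d l₁ l₂ (fun x => delv j x w) (fun x => ddelv j 0 x w) (fun x => ddelv j 1 x w)
      (fun _ => 0) := by
  have hz : ∀ y : R2, zeroExt univ (w.2.2.1.1.2.1) y (Pi.single j 1) =
      C2.eval₁ j ⟨y, mem_univ y⟩ w.2.2.1 := fun y => by
    rw [C2.eval₁_apply, ← zeroExt_apply (S := univ) ⟨y, mem_univ y⟩ w.2.2.1.1.2.1]
  have := hasPartials_horiz (d := d) (l₁ := l₁) (l₂ := l₂)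
    (f := fun y => zeroExt univ (w.2.2.1.1.2.1) y (Pi.single j 1))
    (f' := fun y => (ContinuousLinearMap.apply ℝ ℝ (Pi.single j 1 : R2)).comp
      (w.2.2.1.1.2.2 ⟨y, mem_univ y⟩))
    (g₀ := fun x => ddelv j 0 x w) (g₁ := fun x => ddelv j 1 x w)
    (fun y => ((ContinuousLinearMap.apply ℝ ℝ (Pi.single j 1 : R2)).hasFDerivAt.comp y
      (C2.hasFDerivAt_deriv w.2.2.1 ⟨y, mem_univ y⟩ univ_mem)))
    (fun x => rfl) (fun x => rfl)
    ((C2.continuous_eval₂ j 0 w.2.2.1).comp continuous_horiz)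
    ((C2.continuous_eval₂ j 1 w.2.2.1).comp continuous_horiz)
    (by simpa only [hz] using! delv_periodic j w)
  simpa only [hz] using! this

section Bounds

variable (w : State d l₁ l₂)

theorem abs_vel_le (hd : 0 < d) (i : Fin 3) (x : R3) : |vel hd i x w| ≤ ‖w‖ :=
  (norm_le_pi_norm (C2.eval₀ (clamp hd x) w.1.1) i).trans
    ((C2.norm_eval₀_le _ _).trans (norm_fst_le w))

theorem abs_prs_le (hd : 0 < d) (x : R3) : |prs hd x w| ≤ ‖w‖ :=
  (C2.norm_eval₀_le _ _).trans ((norm_fst_le w.2).trans (norm_snd_le w))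

theorem abs_elv_le (x : R3) : |elv x w| ≤ ‖w‖ :=
  (C2.norm_eval₀_le _ _).trans ((norm_snd_le w.2).trans (norm_snd_le w))

theorem abs_delv_le (j : Fin 2) (x : R3) : |delv j x w| ≤ ‖w‖ :=
  (C2.norm_eval₁_le _ _ _).trans ((norm_snd_le w.2).trans (norm_snd_le w))

end Bounds

end StateJets

end WaterWave

/-! ### The flattened Euler equations in components and the momentum flux identity. -/

namespace WaterWave

variable {d l₁ l₂ : ℝ}

theorem closedDomain_subset_closure (hd : 0 < d) : closedDomain d ⊆ closure (domain d) := by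
  have h := (isOpenMap_eval (X := fun _ : Fin 3 => ℝ) 2).preimage_closure_eq_closure_preimage
    (continuous_apply 2) (Ioo (-d) 0)
  rw [closure_Ioo (by linarith : -d ≠ 0)] at h
  exact h.subset

/-- The differential equations are assumed only in the open domain; this carries their consequences
to the surface and the bottom. -/
theorem eq_on_closedDomain (hd : 0 < d) {f g : R3 → ℝ} (hf : Continuous f) (hg : Continuous g)
    (h : ∀ x ∈ domain d, f x = g x) : ∀ x ∈ closedDomain d, f x = g x := fun _ hx =>
  (show EqOn f g (domain d) from h).closure hf hg (closedDomain_subset_closure hd hx)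

theorem periodBox_subset : periodBox d l₁ l₂ ⊆ closedDomain d := fun _ hx =>
  ⟨by simpa using hx.1 2, by simpa using hx.2 2⟩

/-- A function that is a divergence in the fluid domain, with vanishing vertical flux at the
boundary, has zero integral over a period. -/
theorem integral_eq_zero_of_eq_divergence (hd : 0 < d) (hl₁ : 0 < l₁) (hl₂ : 0 < l₂)
    {F₀ F₁ F₂ a₀ a₁ a₂ b₀ b₁ b₂ c₀ c₁ c₂ G : R3 → ℝ} (h₀ : HasPartials d l₁ l₂ F₀ a₀ a₁ a₂)
    (h₁ : HasPartials d l₁ l₂ F₁ b₀ b₁ b₂) (h₂ : HasPartials d l₁ l₂ F₂ c₀ c₁ c₂)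
    (hb : ∀ x : R3, x 2 = 0 ∨ x 2 = -d → F₂ x = 0) (hG : Continuous G)
    (h : ∀ x ∈ domain d, G x = a₀ x + b₁ x + c₂ x) : ∫ x in periodBox d l₁ l₂, G x = 0 := by
  have i0 := integrableOn_periodBox (d := d) (l₁ := l₁) (l₂ := l₂) h₀.cont₀
  have i1 := integrableOn_periodBox (d := d) (l₁ := l₁) (l₂ := l₂) h₁.cont₁
  have i2 := integrableOn_periodBox (d := d) (l₁ := l₁) (l₂ := l₂) h₂.cont₂
  have hsum := MeasureTheory.integral_add (i0.add i1) i2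
  rw [MeasureTheory.integral_add' i0 i1, h₀.integral₀ hd hl₁ hl₂, h₁.integral₁ hd hl₁ hl₂,
    h₂.integral₂ hd hl₁ hl₂ hb, add_zero, add_zero] at hsum
  rw [← hsum]
  exact MeasureTheory.setIntegral_congr_fun measurableSet_Icc fun x hx =>
    eq_on_closedDomain hd hG ((h₀.cont₀.add h₁.cont₁).add h₂.cont₂) h x (periodBox_subset hx)

noncomputable section

/-- The derivative `∂ᵢφ` at `x`. -/
def dphi (d : ℝ) {l₁ l₂ : ℝ} (i : Fin 3) (x : R3) : State d l₁ l₂ →L[ℝ] ℝ :=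
  ![(1 + x 2 / d) • delv 0 x, (1 + x 2 / d) • delv 1 x, (1 / d) • elv x] i

/-- The derivative `∂ⱼ∂ᵢφ` at `x`. -/
def ddphi (d : ℝ) {l₁ l₂ : ℝ} (i j : Fin 3) (x : R3) : State d l₁ l₂ →L[ℝ] ℝ :=
  ![![(1 + x 2 / d) • ddelv 0 0 x, (1 + x 2 / d) • ddelv 0 1 x, (1 / d) • delv 0 x],
    ![(1 + x 2 / d) • ddelv 1 0 x, (1 + x 2 / d) • ddelv 1 1 x, (1 / d) • delv 1 x],
    ![(1 / d) • delv 0 x, (1 / d) • delv 1 x, 0]] i j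

/-- The component `ρ (M u)ᵢ`. -/
def velNum (hd : 0 < d) (i : Fin 3) (x : R3) (w : State d l₁ l₂) : ℝ :=
  vel hd i x w + (![0, 0, 1] : R3) i * ∑ k, vel hd k x w * dphi d k x w

/-- The partial derivatives of `velNum`. -/
def dvelNum (hd : 0 < d) (i j : Fin 3) (x : R3) (w : State d l₁ l₂) : ℝ :=
  dvel hd i j x w + (![0, 0, 1] : R3) i *
    ∑ k, (dvel hd k j x w * dphi d k x w + vel hd k x w * ddphi d k j x w)

/-- The component `(M u)ᵢ` of the physical velocity. -/
def physVel (hd : 0 < d) (i : Fin 3) (x : R3) (w : State d l₁ l₂) : ℝ :=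
  velNum hd i x w * (1 + dphi d 2 x w)⁻¹

/-- The partial derivatives of `physVel`. -/
def dphysVel (hd : 0 < d) (i j : Fin 3) (x : R3) (w : State d l₁ l₂) : ℝ :=
  dvelNum hd i j x w * (1 + dphi d 2 x w)⁻¹ +
    velNum hd i x w * (-ddphi d 2 j x w / (1 + dphi d 2 x w) ^ 2)

end

theorem hasPartials_const (c : ℝ) :
    HasPartials d l₁ l₂ (fun _ => c) (fun _ => 0) (fun _ => 0) (fun _ => 0) where
  cont := continuous_const
  cont₀ := continuous_const
  cont₁ := continuous_const
  cont₂ := continuous_const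
  periodic := ⟨fun _ => rfl, fun _ => rfl⟩
  hasFDerivAt := fun x _ => (hasFDerivAt_const c x).congr_fderiv (by simp)

theorem HasPartials.const_mul {f g₀ g₁ g₂ : R3 → ℝ} (c : ℝ) (h : HasPartials d l₁ l₂ f g₀ g₁ g₂) :
    HasPartials d l₁ l₂ (fun x => c * f x) (fun x => c * g₀ x) (fun x => c * g₁ x)
      (fun x => c * g₂ x) :=
  ((hasPartials_const c).mul h).congr_fun (fun _ => rfl) (fun _ => by ring) (fun _ => by ring)
    (fun _ => by ring)

theorem hasPartials_slope : HasPartials d l₁ l₂ (fun x => 1 + x 2 / d) (fun _ => 0) (fun _ => 0)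
    (fun _ => 1 / d) :=
  HasPartials.of_vertical (u := fun z => 1 + z / d) (v := fun _ => 1 / d) (by fun_prop)
    continuous_const fun z _ => ((hasDerivAt_id' z).div_const d).const_add 1

theorem hasPartials_phi (w : State d l₁ l₂) :
    HasPartials d l₁ l₂ (fun x => (1 + x 2 / d) * elv x w) (fun x => dphi d 0 x w)
      (fun x => dphi d 1 x w) (fun x => dphi d 2 x w) :=
  (hasPartials_slope.mul (hasPartials_elv w)).congr_fun (fun _ => rfl) (fun _ => by simp [dphi])
    (fun _ => by simp [dphi]) (fun _ => by simp [dphi])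

theorem hasPartials_dphi (i : Fin 3) (w : State d l₁ l₂) :
    HasPartials d l₁ l₂ (fun x => dphi d i x w) (fun x => ddphi d i 0 x w)
      (fun x => ddphi d i 1 x w) (fun x => ddphi d i 2 x w) := by
  fin_cases i
  · exact (hasPartials_slope.mul (hasPartials_delv 0 w)).congr_fun (fun _ => rfl)
      (fun _ => by simp [ddphi]) (fun _ => by simp [ddphi]) (fun _ => by simp [ddphi])
  · exact (hasPartials_slope.mul (hasPartials_delv 1 w)).congr_fun (fun _ => rfl)
      (fun _ => by simp [ddphi]) (fun _ => by simp [ddphi]) (fun _ => by simp [ddphi])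
  · exact ((hasPartials_elv w).const_mul (1 / d)).congr_fun (fun _ => rfl)
      (fun _ => by simp [ddphi]) (fun _ => by simp [ddphi]) (fun _ => by simp [ddphi])

theorem hasPartials_velNum (hd : 0 < d) (i : Fin 3) (w : State d l₁ l₂) :
    HasPartials d l₁ l₂ (fun x => velNum hd i x w) (fun x => dvelNum hd i 0 x w)
      (fun x => dvelNum hd i 1 x w) (fun x => dvelNum hd i 2 x w) := by
  have h : ∀ k, _ := fun k => (hasPartials_vel hd k w).mul (hasPartials_dphi k w)
  refine ((hasPartials_vel hd i w).add ((((h 0).add (h 1)).add (h 2)).const_mul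
    ((![0, 0, 1] : R3) i))).congr_fun ?_ ?_ ?_ ?_ <;> intro x <;>
    simp only [velNum, dvelNum, Fin.sum_univ_three]

theorem hasPartials_physVel (hd : 0 < d) (i : Fin 3) (w : State d l₁ l₂)
    (hρ : ∀ x : R3, 1 + dphi d 2 x w ≠ 0) :
    HasPartials d l₁ l₂ (fun x => physVel hd i x w) (fun x => dphysVel hd i 0 x w)
      (fun x => dphysVel hd i 1 x w) (fun x => dphysVel hd i 2 x w) := by
  refine ((hasPartials_velNum hd i w).mul
    (((hasPartials_const 1).add (hasPartials_dphi 2 w)).inv hρ)).congr_fun ?_ ?_ ?_ ?_ <;> intro x <;>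
    simp only [physVel, dphysVel, zero_add]

theorem phi_eta (w : State d l₁ l₂) : phi d w.eta = fun x => (1 + x 2 / d) * elv x w := by
  funext x
  rw [phi, eta_apply_eq]

theorem pd_phi (w : State d l₁ l₂) {x : R3} (hx : x ∈ domain d) (j : Fin 3) :
    pd j (phi d w.eta) x = dphi d j x w := by
  rw [phi_eta, (hasPartials_phi w).pd_eq hx]
  fin_cases j <;> rfl

section Euler

variable (hd : 0 < d) {w : State d l₁ l₂}
include hd

theorem pd_u {x : R3} (hx : x ∈ domain d) (i j : Fin 3) :
    pd j (fun y => w.u y i) x = dvel hd i j x w := by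
  rw [(hasPartials_vel hd i w).pd_eq_of_eqOn hx
    fun y hy => u_apply_eq hd w (domain_subset_closedDomain hy) i]
  fin_cases j <;> rfl

theorem pd_p {x : R3} (hx : x ∈ domain d) (j : Fin 3) : pd j w.p x = dprs hd j x w := by
  rw [(hasPartials_prs hd w).pd_eq_of_eqOn hx
    fun y hy => p_apply_eq hd w (domain_subset_closedDomain hy)]
  fin_cases j <;> rfl

theorem SolvesEuler.rho_pos (h : SolvesEuler d w.u w.p w.eta) (x : R3) : 0 < 1 + dphi d 2 x w := by
  have h1 := h.above_bottom ![x 0, x 1]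
  rw [eta_apply_eq] at h1
  simp only [dphi, Matrix.cons_val]
  change 0 < 1 + (1 / d) * elv x w
  have : 1 + (1 / d) * elv x w = (d + elv x w) / d := by
    have := hd.ne'
    field_simp
  rw [this]
  apply div_pos _ hd
  linarith

theorem normJacobi_mulVec {x : R3} (hx : x ∈ domain d) (i : Fin 3) :
    (normJacobi d w.eta x *ᵥ w.u x) i = physVel hd i x w := by
  have hx' := domain_subset_closedDomain hx
  fin_cases i <;>
  simp [normJacobi, jacobi, rho, physVel, velNum, pd_phi w hx, u_apply_eq hd w hx', Matrix.mulVec,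
    dotProduct, Matrix.vecMulVec_apply, Fin.sum_univ_three] <;> ring

omit hd in
theorem normJacobi_transpose_mulVec {x : R3} (hx : x ∈ domain d) (a : R3) (i : Fin 3) :
    ((normJacobi d w.eta x)ᵀ *ᵥ a) i = (1 + dphi d 2 x w)⁻¹ * (a i + dphi d i x w * a 2) := by
  fin_cases i <;>
  simp [normJacobi, jacobi, rho, pd_phi w hx, Matrix.mulVec,
    dotProduct, Matrix.vecMulVec_apply, Fin.sum_univ_three] <;> ring

/-- The components of the flattened Euler equations. -/
theorem SolvesEuler.components (h : SolvesEuler d w.u w.p w.eta) {x : R3} (hx : x ∈ domain d)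
    (i : Fin 3) : (∑ j, vel hd j x w * dphysVel hd i j x w) +
      dphi d i x w * (∑ j, vel hd j x w * dphysVel hd 2 j x w) +
      (1 + dphi d 2 x w) * dprs hd i x w = 0 := by
  have hρ := h.rho_pos hd
  have hx' := domain_subset_closedDomain hx
  have h1 := congrFun (h.momentum x hx) i
  have h2 : ∀ i, advect w.u (fun y => normJacobi d w.eta y *ᵥ w.u y) x i =
      ∑ j, vel hd j x w * dphysVel hd i j x w := by
    intro i
    refine Finset.sum_congr rfl fun j _ => ?_
    rw [u_apply_eq hd w hx', (hasPartials_physVel hd i w fun x => (hρ x).ne').pd_eq_of_eqOn hx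
      fun y hy => normJacobi_mulVec hd hy i]
    congr 1
    fin_cases j <;> rfl
  rw [Pi.add_apply, normJacobi_transpose_mulVec hx, h2, h2, grad, pd_p hd hx, Pi.zero_apply] at h1
  have h3 := (hρ x).ne'
  field_simp at h1
  linarith

/-- In the vertical component the factor ρ = 1 + ∂₃φ > 0 is common to all terms and can be
cancelled. The result serves to eliminate vertical advection from the transverse component. -/
theorem SolvesEuler.component_two (h : SolvesEuler d w.u w.p w.eta) {x : R3} (hx : x ∈ domain d) :
    ∑ j, vel hd j x w * dphysVel hd 2 j x w = -dprs hd 2 x w := by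
  have h1 := h.components hd hx 2
  have h2 : (1 + dphi d 2 x w) * ((∑ j, vel hd j x w * dphysVel hd 2 j x w) + dprs hd 2 x w) = 0 := by
    linarith
  have := (mul_eq_zero.1 h2).resolve_left (h.rho_pos hd x).ne'
  linarith

theorem SolvesEuler.div_eq (h : SolvesEuler d w.u w.p w.eta) {x : R3} (hx : x ∈ domain d) :
    ∑ i, dvel hd i i x w = 0 := by
  rw [← h.incompressible x hx]
  exact Finset.sum_congr rfl fun i _ => (pd_u hd hx i i).symm

theorem vel_two_boundary (h : ∀ x : R3, x 2 = 0 ∨ x 2 = -d → w.u x 2 = 0) {x : R3}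
    (hx : x 2 = 0 ∨ x 2 = -d) : vel hd 2 x w = 0 := by
  rw [← u_apply_eq hd w _ 2, h x hx]
  rcases hx with hx | hx <;> simp [closedDomain, hx, hd.le]

end Euler

/-- A vertical cutoff with two derivatives, supported in the interior of `[-d, 0]`, and a
transverse `l₂`-periodic function. They define the solenoidal test field
`(0, θ'(x₃) s(x₂), -θ(x₃) s'(x₂))`. -/
structure TestPair (d l₂ : ℝ) (θ θ' θ'' s s' s'' : ℝ → ℝ) : Prop where
  hasDerivAt_θ : ∀ z, HasDerivAt θ (θ' z) z
  hasDerivAt_θ' : ∀ z, HasDerivAt θ' (θ'' z) z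
  cont_θ'' : Continuous θ''
  θ_zero : θ 0 = 0 ∧ θ (-d) = 0
  θ'_zero : θ' 0 = 0 ∧ θ' (-d) = 0
  hasDerivAt_s : ∀ y, HasDerivAt s (s' y) y
  hasDerivAt_s' : ∀ y, HasDerivAt s' (s'' y) y
  cont_s'' : Continuous s''
  periodic_s : ∀ y, s (y + l₂) = s y
  periodic_s' : ∀ y, s' (y + l₂) = s' y

namespace TestPair

variable {θ θ' θ'' s s' s'' : ℝ → ℝ} (T : TestPair d l₂ θ θ' θ'' s s' s'')
include T

theorem cont_θ : Continuous θ := continuous_iff_continuousAt.2 fun z => (T.hasDerivAt_θ z).continuousAt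

theorem cont_θ' : Continuous θ' :=
  continuous_iff_continuousAt.2 fun z => (T.hasDerivAt_θ' z).continuousAt

theorem cont_s : Continuous s := continuous_iff_continuousAt.2 fun z => (T.hasDerivAt_s z).continuousAt

theorem cont_s' : Continuous s' :=
  continuous_iff_continuousAt.2 fun z => (T.hasDerivAt_s' z).continuousAt

theorem hasPartials_one : HasPartials d l₁ l₂ (fun x => θ' (x 2) * s (x 1)) (fun _ => 0)
    (fun x => θ' (x 2) * s' (x 1)) (fun x => θ'' (x 2) * s (x 1)) :=
  ((HasPartials.of_vertical T.cont_θ' T.cont_θ'' fun z _ => T.hasDerivAt_θ' z).mul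
    (HasPartials.of_transverse T.cont_s' T.hasDerivAt_s T.periodic_s)).congr_fun (fun _ => rfl)
    (fun _ => by ring) (fun _ => by ring) (fun _ => by ring)

theorem hasPartials_two : HasPartials d l₁ l₂ (fun x => -(θ (x 2) * s' (x 1))) (fun _ => 0)
    (fun x => -(θ (x 2) * s'' (x 1))) (fun x => -(θ' (x 2) * s' (x 1))) :=
  (((HasPartials.of_vertical T.cont_θ T.cont_θ' fun z _ => T.hasDerivAt_θ z).mul
    (HasPartials.of_transverse T.cont_s'' T.hasDerivAt_s' T.periodic_s')).const_mul (-1)).congr_fun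
    (fun _ => by ring) (fun _ => by ring) (fun _ => by ring) (fun _ => by ring)

end TestPair

set_option maxHeartbeats 1000000 in
/-- The momentum flux of a solution of the Euler equations against a solenoidal test field that is
independent of `x₁`. -/
theorem SolvesEuler.integral_flux (hd : 0 < d) (hl₁ : 0 < l₁) (hl₂ : 0 < l₂) {w : State d l₁ l₂}
    (h : SolvesEuler d w.u w.p w.eta) {θ θ' θ'' s s' s'' : ℝ → ℝ}
    (T : TestPair d l₂ θ θ' θ'' s s' s'') :
    ∫ x in periodBox d l₁ l₂,
      (physVel hd 1 x w * (vel hd 1 x w * (θ' (x 2) * s' (x 1)) +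
          vel hd 2 x w * (θ'' (x 2) * s (x 1))) -
        physVel hd 2 x w * (vel hd 1 x w * (θ (x 2) * s'' (x 1)) +
          vel hd 2 x w * (θ' (x 2) * s' (x 1))) +
        prs hd x w * (θ' (x 2) * s' (x 1) * dphi d 2 x w - θ'' (x 2) * s (x 1) * dphi d 1 x w))
      = 0 := by
  have hρ := fun x => (h.rho_pos hd x).ne'
  have z1 := T.hasPartials_one (l₁ := l₁)
  have z2 := T.hasPartials_two (l₁ := l₁)
  have u := fun j => hasPartials_vel hd j w
  have m := fun j => hasPartials_physVel hd j w hρ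
  have p := hasPartials_prs hd w
  have φ := fun j => hasPartials_dphi j w
  -- The advective fluxes are uⱼ ζ·(Mu). After elimination of vertical advection the transverse
  -- pressure force is ∂₂φ ∂₃℘ - (1 + ∂₃φ) ∂₂℘ = ∂₃(℘ ∂₂φ) - ∂₂((1 + ∂₃φ)℘), again a divergence. The
  -- part of the pressure term linear in the perturbation disappears because ζ is solenoidal.
  have F0 := ((z1.mul (u 0)).mul (m 1)).add ((z2.mul (u 0)).mul (m 2))
  have F1 := ((((z1.mul (u 1)).mul (m 1)).add ((z2.mul (u 1)).mul (m 2))).add (z1.mul p)).add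
    ((z1.mul (φ 2)).mul p)
  have F2 := ((((z1.mul (u 2)).mul (m 1)).add ((z2.mul (u 2)).mul (m 2))).add (z2.mul p)).add
    (((z1.mul (φ 1)).mul p).const_mul (-1))
  refine integral_eq_zero_of_eq_divergence hd hl₁ hl₂ F0 F1 F2 (fun x hx => ?_) ?_ fun x hx => ?_
  · have hu := vel_two_boundary hd h.kinematic hx
    rcases hx with hx | hx
    · simp [hu, hx, T.θ_zero.1, T.θ'_zero.1]
    · simp [hu, hx, T.θ_zero.2, T.θ'_zero.2]
  · have a1 := (m 1).cont
    have a2 := (m 2).cont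
    have a3 := (u 1).cont
    have a4 := (u 2).cont
    have a5 := (φ 2).cont
    have a6 := (φ 1).cont
    have a7 := p.cont
    have := T.cont_θ
    have := T.cont_θ'
    have := T.cont_θ''
    have := T.cont_s
    have := T.cont_s'
    have := T.cont_s''
    fun_prop
  · have e1 := h.components hd hx 1
    have e2 := h.component_two hd hx
    have e3 := h.div_eq hd hx
    -- The mixed derivatives of φ cancel between the two pressure fluxes.
    have e4 : ddphi d 2 1 x w = ddphi d 1 2 x w := rfl
    rw [e2] at e1
    simp only [Fin.sum_univ_three] at e1 e2 e3
    rw [e4]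
    linear_combination (-(θ' (x 2) * s (x 1))) * e1 + (θ (x 2) * s' (x 1)) * e2 +
      (-(θ' (x 2) * s (x 1)) * physVel hd 1 x w + (θ (x 2) * s' (x 1)) * physVel hd 2 x w) * e3

end WaterWave

/-! ### Linearization at the shear flow and the second-order limit of the flux identity. -/

namespace WaterWave

variable {d l₁ l₂ : ℝ}

/-- A profile that is extended continuously, without zeros, to the whole line. -/
structure IsExtProfile (d : ℝ) (U V : ℝ → ℝ) : Prop extends IsProfile d U V where
  cont_ext : Continuous U
  cont_deriv_ext : Continuous V
  ne_zero_ext : ∀ z, U z ≠ 0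

/-- The jet of the shear flow with profile `U`. -/
structure IsShearJet (hd : 0 < d) (U V : ℝ → ℝ) (w : State d l₁ l₂) : Prop where
  vel : ∀ x ∈ closedDomain d, ∀ i, vel hd i x w = (![U (x 2), 0, 0] : R3) i
  dvel : ∀ x ∈ closedDomain d, ∀ i j, dvel hd i j x w = (![![0, 0, V (x 2)], 0, 0] i : R3) j
  prs : ∀ x ∈ closedDomain d, prs hd x w = 0
  dprs : ∀ x ∈ closedDomain d, ∀ i, dprs hd i x w = 0
  dphi : ∀ x i, dphi d i x w = 0
  ddphi : ∀ x i j, ddphi d i j x w = 0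

/-- The linearized equations for the jet of `w`. -/
structure LinearizedJet (hd : 0 < d) (U V : ℝ → ℝ) (w : State d l₁ l₂) : Prop where
  momentum₀ : ∀ x ∈ closedDomain d, vel hd 2 x w * V (x 2) + U (x 2) * dvel hd 0 0 x w -
    U (x 2) ^ 2 * ddphi d 2 0 x w + dprs hd 0 x w = 0
  momentum₁ : ∀ x ∈ closedDomain d, U (x 2) * dvel hd 1 0 x w + dprs hd 1 x w = 0
  momentum₂ : ∀ x ∈ closedDomain d, U (x 2) * dvel hd 2 0 x w + U (x 2) ^ 2 * ddphi d 0 0 x w +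
    dprs hd 2 x w = 0
  div_eq : ∀ x ∈ closedDomain d, ∑ i, dvel hd i i x w = 0
  boundary : ∀ x : R3, x 2 = 0 ∨ x 2 = -d → vel hd 2 x w = 0

/-- Partial derivatives are determined by the function in the interior, and by continuity up to the
boundary. -/
theorem HasPartials.unique (hd : 0 < d) {f f' g₀ g₁ g₂ g₀' g₁' g₂' : R3 → ℝ}
    (h : HasPartials d l₁ l₂ f g₀ g₁ g₂) (h' : HasPartials d l₁ l₂ f' g₀' g₁' g₂')
    (hf : ∀ x ∈ domain d, f x = f' x) :
    ∀ x ∈ closedDomain d, g₀ x = g₀' x ∧ g₁ x = g₁' x ∧ g₂ x = g₂' x := by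
  have key : ∀ x ∈ domain d, ∀ j, ![g₀ x, g₁ x, g₂ x] j = ![g₀' x, g₁' x, g₂' x] j :=
    fun x hx j => by rw [← h.pd_eq hx j, ← h'.pd_eq_of_eqOn hx hf j]
  exact fun x hx => ⟨eq_on_closedDomain hd h.cont₀ h'.cont₀ (fun x hx => key x hx 0) x hx,
    eq_on_closedDomain hd h.cont₁ h'.cont₁ (fun x hx => key x hx 1) x hx,
    eq_on_closedDomain hd h.cont₂ h'.cont₂ (fun x hx => key x hx 2) x hx⟩

section Shear

variable {U V : ℝ → ℝ} (hU : IsExtProfile d U V) {w : State d l₁ l₂}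
include hU

theorem isShearJet (h : IsShearFlow d U w.u w.p w.eta) : IsShearJet hU.pos U V w := by
  have hd := hU.pos
  obtain ⟨hu, hp, hη⟩ := h
  have hv : ∀ x ∈ closedDomain d, ∀ i, vel hd i x w = (![U (x 2), 0, 0] : R3) i :=
    fun x hx i => by rw [← u_apply_eq hd w hx, hu x hx]
  have hp' : ∀ x ∈ closedDomain d, prs hd x w = 0 := fun x hx => by
    rw [← p_apply_eq hd w hx, hp x hx]
  have he : ∀ x : R3, elv x w = 0 := fun x => by rw [← eta_apply_eq, hη]
  have hde : ∀ (x : R3), x ∈ closedDomain d → delv 0 x w = 0 ∧ delv 1 x w = 0 := fun x hx => by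
    have := (hasPartials_elv w).unique hd (hasPartials_const 0) (fun x _ => he x) x hx
    exact ⟨this.1, this.2.1⟩
  -- Derivatives of η depend on x' only, so a point outside the closed domain may be replaced by the
  -- surface point with the same x'.
  have hx0 : ∀ x : R3, ∃ y ∈ closedDomain d, horiz x = horiz y := fun x =>
    ⟨![x 0, x 1, 0], ⟨by simpa using hd.le, by simp⟩, Subtype.ext (by simp [horiz])⟩
  have hde' : ∀ (x : R3) (j : Fin 2), delv j x w = 0 := fun x j => by
    obtain ⟨y, hy, hxy⟩ := hx0 x
    have : delv j x w = delv j y w := by rw [delv_def, hxy, ← delv_def]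
    rw [this]
    fin_cases j
    exacts [(hde y hy).1, (hde y hy).2]
  have hdde' : ∀ (x : R3) (i j : Fin 2), ddelv i j x w = 0 := fun x i j => by
    obtain ⟨y, hy, hxy⟩ := hx0 x
    have h2 : ddelv i j x w = ddelv i j y w := by rw [ddelv_def, hxy, ← ddelv_def]
    have := (hasPartials_delv i w).unique hd (hasPartials_const 0) (fun x _ => hde' x i) y hy
    rw [h2]
    fin_cases j
    exacts [this.1, this.2.1]
  refine ⟨hv, fun x hx i j => ?_, hp', fun x hx i => ?_, fun x i => ?_, fun x i j => ?_⟩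
  · have h0 := (hasPartials_vel hd 0 w).unique hd (HasPartials.of_vertical hU.cont_ext
      hU.cont_deriv_ext hU.hasDerivAt) (fun x hx => hv x (domain_subset_closedDomain hx) 0) x hx
    have h1 := (hasPartials_vel hd 1 w).unique hd (hasPartials_const 0)
      (fun x hx => hv x (domain_subset_closedDomain hx) 1) x hx
    have h2 := (hasPartials_vel hd 2 w).unique hd (hasPartials_const 0)
      (fun x hx => hv x (domain_subset_closedDomain hx) 2) x hx
    fin_cases i <;> fin_cases j
    exacts [h0.1, h0.2.1, h0.2.2, h1.1, h1.2.1, h1.2.2, h2.1, h2.2.1, h2.2.2]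
  · have h0 := (hasPartials_prs hd w).unique hd (hasPartials_const 0)
      (fun x hx => hp' x (domain_subset_closedDomain hx)) x hx
    fin_cases i
    exacts [h0.1, h0.2.1, h0.2.2]
  · fin_cases i <;> simp [WaterWave.dphi, he, hde']
  · fin_cases i <;> fin_cases j <;> simp [WaterWave.ddphi, hde', hdde']

end Shear

theorem hasDerivAt_apply {γ : ℝ → State d l₁ l₂} {w₁ : State d l₁ l₂} (hγ : HasDerivAt γ w₁ 0)
    (L : State d l₁ l₂ →L[ℝ] ℝ) : HasDerivAt (fun ε => L (γ ε)) (L w₁) 0 :=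
  L.hasFDerivAt.comp_hasDerivAt 0 hγ

theorem hasDerivAt_dphysVel (hd : 0 < d) {U V : ℝ → ℝ} {γ : ℝ → State d l₁ l₂}
    {w₁ : State d l₁ l₂} (hγ : HasDerivAt γ w₁ 0) (h0 : IsShearJet hd U V (γ 0)) (i j : Fin 3)
    (x : R3) : HasDerivAt (fun ε => dphysVel hd i j x (γ ε))
      (dvel hd i j x w₁ + (![0, 0, 1] : R3) i *
        ∑ k, (dvel hd k j x (γ 0) * dphi d k x w₁ + vel hd k x (γ 0) * ddphi d k j x w₁) -
        dvel hd i j x (γ 0) * dphi d 2 x w₁ - vel hd i x (γ 0) * ddphi d 2 j x w₁) 0 := by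
  have D := fun L => hasDerivAt_apply hγ L
  have hN : HasDerivAt (fun ε => velNum hd i x (γ ε)) (vel hd i x w₁ + (![0, 0, 1] : R3) i *
      ∑ k, (vel hd k x w₁ * dphi d k x (γ 0) + vel hd k x (γ 0) * dphi d k x w₁)) 0 :=
    (D _).fun_add ((HasDerivAt.fun_sum fun k _ => (D _).fun_mul (D _)).const_mul _)
  have hN' : HasDerivAt (fun ε => dvelNum hd i j x (γ ε)) (dvel hd i j x w₁ + (![0, 0, 1] : R3) i *
      ∑ k, ((dvel hd k j x w₁ * dphi d k x (γ 0) + dvel hd k j x (γ 0) * dphi d k x w₁) +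
        (vel hd k x w₁ * ddphi d k j x (γ 0) + vel hd k x (γ 0) * ddphi d k j x w₁))) 0 :=
    (D _).fun_add ((HasDerivAt.fun_sum fun k _ =>
      ((D _).fun_mul (D _)).fun_add ((D _).fun_mul (D _))).const_mul _)
  have hR : HasDerivAt (fun ε => 1 + dphi d 2 x (γ ε)) (dphi d 2 x w₁) 0 := (D _).const_add 1
  have hR0 : 1 + dphi d 2 x (γ 0) ≠ 0 := by simp [h0.dphi]
  have := (hN'.fun_mul (hR.fun_inv hR0)).fun_add
    (hN.fun_mul ((D (ddphi d 2 j x)).fun_neg.fun_div (hR.fun_pow 2) (pow_ne_zero 2 hR0)))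
  refine HasDerivAt.congr_deriv this ?_
  simp only [velNum, dvelNum, h0.dphi, h0.ddphi]
  simp
  ring

/-- The first-order term of a curve of solutions satisfies the linearized equations. -/
theorem linearizedJet {U V : ℝ → ℝ} (hU : IsExtProfile d U V) {γ : ℝ → State d l₁ l₂}
    {w₁ : State d l₁ l₂} (hγ : HasDerivAt γ w₁ 0) (h0 : IsShearJet hU.pos U V (γ 0))
    (hE : ∀ᶠ ε in 𝓝 (0 : ℝ), SolvesEuler d (γ ε).u (γ ε).p (γ ε).eta) :
    LinearizedJet hU.pos U V w₁ := by
  have hd := hU.pos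
  have D := fun L => hasDerivAt_apply hγ L
  have hcU := hU.cont_ext
  have hcV := hU.cont_deriv_ext
  -- On the shear flow ∂φ, ∇℘ and (u·∇)(Mu) all vanish. In the derivative of the component equation,
  -- the factors ∂ᵢφ and ρ in front of the advection and the pressure gradient therefore contribute
  -- nothing of first order.
  have key : ∀ x ∈ domain d, ∀ i : Fin 3,
      vel hd 2 x w₁ * (![V (x 2), 0, 0] : R3) i + U (x 2) *
        (dvel hd i 0 x w₁ + (![0, 0, 1] : R3) i * (U (x 2) * ddphi d 0 0 x w₁) -
          (![U (x 2), 0, 0] : R3) i * ddphi d 2 0 x w₁) + dprs hd i x w₁ = 0 := by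
    intro x hx i
    have hx' := domain_subset_closedDomain hx
    have hS : ∀ i, HasDerivAt (fun ε => ∑ j, vel hd j x (γ ε) * dphysVel hd i j x (γ ε)) _ 0 :=
      fun i => HasDerivAt.fun_sum fun j _ => (D _).fun_mul (hasDerivAt_dphysVel hd hγ h0 i j x)
    have h1 := ((hS i).fun_add ((D (dphi d i x)).fun_mul (hS 2))).fun_add
      (((D (dphi d 2 x)).const_add 1).fun_mul (D (dprs hd i x)))
    have h2 := h1.congr_of_eventuallyEq (f₁ := fun _ => (0 : ℝ))
      (by filter_upwards [hE] with ε hε using (hε.components hd hx i).symm)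
    have h3 := h2.unique (hasDerivAt_const 0 0)
    simp only [dphysVel, dvelNum, velNum, h0.dphi, h0.ddphi, h0.vel x hx', h0.dvel x hx',
      h0.dprs x hx', Fin.sum_univ_three] at h3
    fin_cases i <;> simp at h3 ⊢ <;> linarith
  have c := fun i => hasPartials_vel hU.pos i w₁
  have cp := hasPartials_prs hU.pos w₁
  have cφ := fun i => hasPartials_dphi i w₁
  have cu2 := (c 2).cont
  have cu00 := (c 0).cont₀
  have cu10 := (c 1).cont₀
  have cu20 := (c 2).cont₀
  have cu11 := (c 1).cont₁
  have cu22 := (c 2).cont₂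
  have cp0 := cp.cont₀
  have cp1 := cp.cont₁
  have cp2 := cp.cont₂
  have c20 := (cφ 2).cont₀
  have c00 := (cφ 0).cont₀
  refine ⟨?_, ?_, ?_, ?_, ?_⟩
  · refine eq_on_closedDomain hd (by fun_prop) continuous_const fun x hx => ?_
    have := key x hx 0
    simp at this
    linarith
  · refine eq_on_closedDomain hd (by fun_prop) continuous_const fun x hx => ?_
    have := key x hx 1
    simp at this
    linarith
  · refine eq_on_closedDomain hd (by fun_prop) continuous_const fun x hx => ?_
    have := key x hx 2
    simp at this
    linarith
  · simp only [Fin.sum_univ_three]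
    refine eq_on_closedDomain hd (by fun_prop) continuous_const fun x hx => ?_
    have h1 : HasDerivAt (fun ε => ∑ i, dvel hd i i x (γ ε)) _ 0 :=
      HasDerivAt.fun_sum fun i _ => D (dvel hd i i x)
    have h2 := h1.congr_of_eventuallyEq (f₁ := fun _ => (0 : ℝ))
      (by filter_upwards [hE] with ε hε using (hε.div_eq hd hx).symm)
    have h3 := h2.unique (hasDerivAt_const 0 0)
    rwa [Fin.sum_univ_three] at h3
  · intro x hx
    have h2 := (D (vel hd 2 x)).congr_of_eventuallyEq (f₁ := fun _ => (0 : ℝ))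
      (by filter_upwards [hE] with ε hε using (vel_two_boundary hd hε.kinematic hx).symm)
    exact h2.unique (hasDerivAt_const 0 0)

theorem LinearizedJet.solvesLinearized {U V : ℝ → ℝ} (hU : IsExtProfile d U V)
    {w : State d l₁ l₂} (h : LinearizedJet hU.pos U V w) :
    SolvesLinearized d U w.u w.p w.eta := by
  have hd := hU.pos
  have hcurl : ∀ y ∈ domain d, curl (fun z => Pi.single 1 (phi d w.eta z)) y =
      ![-dphi d 2 y w, 0, dphi d 0 y w] := by
    intro y hy
    have e0 : ∀ (j : Fin 3), pd j (fun _ : R3 => (0 : ℝ)) y = 0 := fun j => by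
      simp [pd, lineDeriv]
    simp only [curl, Pi.single_eq_same, Pi.single_eq_of_ne (show (0 : Fin 3) ≠ 1 by decide),
      Pi.single_eq_of_ne (show (2 : Fin 3) ≠ 1 by decide), e0, zero_sub, sub_zero]
    rw [show (fun y => phi d w.eta y) = phi d w.eta from rfl, pd_phi w hy, pd_phi w hy]
  have hpc : ∀ x ∈ domain d, ∀ i,
      pd 0 (fun y => curl (fun z => Pi.single 1 (phi d w.eta z)) y i) x =
        (![-ddphi d 2 0 x w, 0, ddphi d 0 0 x w] : R3) i := by
    intro x hx i
    fin_cases i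
    · exact (((hasPartials_dphi 2 w).const_mul (-1)).pd_eq_of_eqOn hx (fun y hy => by
        simp [hcurl y hy]) 0).trans (by simp)
    · exact (hasPartials_const (l₁ := l₁) (l₂ := l₂) 0).pd_eq_of_eqOn hx (fun y hy => by
        simp [hcurl y hy]) 0
    · exact (hasPartials_dphi 0 w).pd_eq_of_eqOn hx (fun y hy => by
        simp [hcurl y hy]) 0
  refine ⟨fun x hx i => ?_, fun x hx => ?_, fun x hx => ?_⟩
  · have hx' := domain_subset_closedDomain hx
    rw [hpc x hx, pd_u hd hx, pd_p hd hx, u_apply_eq hd w hx', (hU.hasDerivAt _ hx).deriv]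
    fin_cases i
    · simpa [sub_eq_add_neg] using h.momentum₀ x hx'
    · simpa using h.momentum₁ x hx'
    · simpa using h.momentum₂ x hx'
  · rw [← h.div_eq x (domain_subset_closedDomain hx)]
    exact Finset.sum_congr rfl fun i _ => pd_u hd hx i i
  · rw [u_apply_eq hd w, h.boundary x hx]
    rcases hx with hx | hx <;> simp [closedDomain, hx, hd.le]

/-- Dominated pointwise convergence `F ε → G` on a period as `ε → 0`. -/
structure DominatedLim (d l₁ l₂ : ℝ) (F : ℝ → R3 → ℝ) (G : R3 → ℝ) : Prop where
  cont : ∀ᶠ ε in 𝓝[≠] 0, Continuous (F ε)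
  bound : ∃ C, ∀ᶠ ε in 𝓝[≠] 0, ∀ x ∈ periodBox d l₁ l₂, |F ε x| ≤ C
  lim : ∀ x ∈ periodBox d l₁ l₂, Tendsto (fun ε => F ε x) (𝓝[≠] 0) (𝓝 (G x))

namespace DominatedLim

variable {F F' : ℝ → R3 → ℝ} {G G' : R3 → ℝ}

theorem add (h : DominatedLim d l₁ l₂ F G) (h' : DominatedLim d l₁ l₂ F' G') :
    DominatedLim d l₁ l₂ (fun ε x => F ε x + F' ε x) fun x => G x + G' x where
  cont := by filter_upwards [h.cont, h'.cont] with ε h1 h2 using h1.add h2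
  bound := by
    obtain ⟨C, hC⟩ := h.bound
    obtain ⟨C', hC'⟩ := h'.bound
    refine ⟨C + C', ?_⟩
    filter_upwards [hC, hC'] with ε h1 h2 x hx
    exact (abs_add_le _ _).trans (add_le_add (h1 x hx) (h2 x hx))
  lim := fun x hx => (h.lim x hx).add (h'.lim x hx)

theorem mul (h : DominatedLim d l₁ l₂ F G) (h' : DominatedLim d l₁ l₂ F' G') :
    DominatedLim d l₁ l₂ (fun ε x => F ε x * F' ε x) fun x => G x * G' x where
  cont := by filter_upwards [h.cont, h'.cont] with ε h1 h2 using h1.mul h2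
  bound := by
    obtain ⟨C, hC⟩ := h.bound
    obtain ⟨C', hC'⟩ := h'.bound
    refine ⟨C * C', ?_⟩
    filter_upwards [hC, hC'] with ε h1 h2 x hx
    rw [abs_mul]
    exact mul_le_mul (h1 x hx) (h2 x hx) (abs_nonneg _) ((abs_nonneg _).trans (h1 x hx))
  lim := fun x hx => (h.lim x hx).mul (h'.lim x hx)

theorem of_continuous (hG : Continuous G) : DominatedLim d l₁ l₂ (fun _ => G) G where
  cont := Eventually.of_forall fun _ => hG
  bound := by
    obtain ⟨C, hC⟩ := (isCompact_periodBox (d := d) (l₁ := l₁) (l₂ := l₂)).exists_bound_of_continuousOn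
      hG.continuousOn
    exact ⟨C, Eventually.of_forall fun _ => hC⟩
  lim := fun _ _ => tendsto_const_nhds

theorem sub (h : DominatedLim d l₁ l₂ F G) (h' : DominatedLim d l₁ l₂ F' G') :
    DominatedLim d l₁ l₂ (fun ε x => F ε x - F' ε x) fun x => G x - G' x := by
  simpa [sub_eq_add_neg] using
    h.add ((of_continuous (G := fun _ => -1) continuous_const).mul h')

/-- A bound on the functionals that is uniform in x and linear in the state dominates them along any
convergent family of states. -/
theorem of_state {L : R3 → State d l₁ l₂ →L[ℝ] ℝ} (hL : ∀ w, Continuous fun x => L x w) {C : ℝ}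
    (hC : ∀ x ∈ periodBox d l₁ l₂, ∀ w, |L x w| ≤ C * ‖w‖) {δ : ℝ → State d l₁ l₂}
    {w : State d l₁ l₂} (hδ : Tendsto δ (𝓝[≠] 0) (𝓝 w)) :
    DominatedLim d l₁ l₂ (fun ε x => L x (δ ε)) fun x => L x w where
  cont := Eventually.of_forall fun ε => hL _
  bound := by
    refine ⟨|C| * (‖w‖ + 1), ?_⟩
    filter_upwards [hδ.norm.eventually (gt_mem_nhds (lt_add_one ‖w‖))] with ε hε x hx
    exact (hC x hx _).trans (mul_le_mul (le_abs_self C) hε.le (norm_nonneg _) (abs_nonneg _))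
  lim := fun x _ => ((L x).continuous.tendsto w).comp hδ

theorem inv {c : ℝ} (hc : 0 < c) (h : DominatedLim d l₁ l₂ F G)
    (hF : ∀ᶠ ε in 𝓝[≠] 0, (∀ x, F ε x ≠ 0) ∧ ∀ x ∈ periodBox d l₁ l₂, c ≤ F ε x)
    (hG : ∀ x ∈ periodBox d l₁ l₂, G x ≠ 0) :
    DominatedLim d l₁ l₂ (fun ε x => (F ε x)⁻¹) fun x => (G x)⁻¹ where
  cont := by filter_upwards [h.cont, hF] with ε h1 h2 using h1.inv₀ h2.1
  bound := by
    refine ⟨c⁻¹, ?_⟩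
    filter_upwards [hF] with ε h2 x hx
    have := h2.2 x hx
    rw [abs_of_pos (inv_pos.2 (hc.trans_le this))]
    exact inv_anti₀ hc this
  lim := fun x hx => (h.lim x hx).inv₀ (hG x hx)

theorem integral (h : DominatedLim d l₁ l₂ F G) :
    Tendsto (fun ε => ∫ x in periodBox d l₁ l₂, F ε x) (𝓝[≠] 0)
      (𝓝 (∫ x in periodBox d l₁ l₂, G x)) := by
  obtain ⟨C, hC⟩ := h.bound
  refine MeasureTheory.tendsto_integral_filter_of_dominated_convergence (fun _ => C) ?_ ?_ ?_ ?_
  · filter_upwards [h.cont] with ε hε using hε.aestronglyMeasurable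
  · filter_upwards [hC] with ε hε
    exact (MeasureTheory.ae_restrict_iff' measurableSet_Icc).2 (Eventually.of_forall hε)
  · exact integrableOn_periodBox continuous_const
  · exact (MeasureTheory.ae_restrict_iff' measurableSet_Icc).2 (Eventually.of_forall h.lim)

end DominatedLim

theorem abs_dphi_le (hd : 0 < d) (i : Fin 3) {x : R3} (hx : x ∈ closedDomain d)
    (w : State d l₁ l₂) : |dphi d i x w| ≤ (1 + 1 / d) * ‖w‖ := by
  have h1 : |1 + x 2 / d| ≤ 1 := by
    have h2 : -1 ≤ x 2 / d := by rw [le_div_iff₀ hd]; linarith [hx.1]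
    have h3 : x 2 / d ≤ 0 := div_nonpos_of_nonpos_of_nonneg hx.2 hd.le
    rw [abs_le]; constructor <;> linarith
  have hw := norm_nonneg w
  have h4 : 0 ≤ 1 / d := by positivity
  have hA : ∀ j, |(1 + x 2 / d) * delv j x w| ≤ (1 + 1 / d) * ‖w‖ := fun j => by
    rw [abs_mul]
    refine mul_le_mul (h1.trans (by linarith)) (abs_delv_le w j x) (abs_nonneg _) (by positivity)
  fin_cases i
  · exact hA 0
  · exact hA 1
  · change |1 / d * elv x w| ≤ _
    rw [abs_mul, abs_of_nonneg h4]
    exact mul_le_mul (by linarith) (abs_elv_le w x) (abs_nonneg _) (by positivity)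

set_option maxHeartbeats 1000000 in
/-- The second-order momentum flux of the first-order term vanishes. -/
theorem integral_flux_linear (hl₁ : 0 < l₁) (hl₂ : 0 < l₂) {U V : ℝ → ℝ}
    (hU : IsExtProfile d U V) {γ : ℝ → State d l₁ l₂} {w₁ : State d l₁ l₂}
    (hγ : HasDerivAt γ w₁ 0) (h0 : IsShearJet hU.pos U V (γ 0))
    (hE : ∀ᶠ ε in 𝓝 (0 : ℝ), SolvesEuler d (γ ε).u (γ ε).p (γ ε).eta)
    {θ θ' θ'' s s' s'' : ℝ → ℝ} (T : TestPair d l₂ θ θ' θ'' s s' s'') :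
    ∫ x in periodBox d l₁ l₂,
      (vel hU.pos 1 x w₁ * (vel hU.pos 1 x w₁ * (θ' (x 2) * s' (x 1)) +
          vel hU.pos 2 x w₁ * (θ'' (x 2) * s (x 1))) -
        (vel hU.pos 2 x w₁ + U (x 2) * dphi d 0 x w₁) *
          (vel hU.pos 1 x w₁ * (θ (x 2) * s'' (x 1)) + vel hU.pos 2 x w₁ * (θ' (x 2) * s' (x 1))) +
        prs hU.pos x w₁ *
          (θ' (x 2) * s' (x 1) * dphi d 2 x w₁ - θ'' (x 2) * s (x 1) * dphi d 1 x w₁)) = 0 := by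
  have hd := hU.pos
  -- Only convergence of the difference quotients to w₁ is used, so the limit needs no second
  -- derivative of the curve.
  set δ : ℝ → State d l₁ l₂ := fun ε => ε⁻¹ • (γ ε - γ 0) with hδdef
  have hδ : Tendsto δ (𝓝[≠] 0) (𝓝 w₁) := by
    have := hasDerivAt_iff_tendsto_slope.1 hγ
    refine this.congr fun ε => ?_
    simp [slope_def_module, hδdef]
  have hγc : Tendsto γ (𝓝[≠] 0) (𝓝 (γ 0)) := hγ.continuousAt.tendsto.mono_left nhdsWithin_le_nhds
  have hγδ : ∀ ε ≠ 0, γ ε = γ 0 + ε • δ ε := fun ε hε => by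
    simp [hδdef, smul_smul, mul_inv_cancel₀ hε]
  have Vl : ∀ i, ∀ {δ : ℝ → State d l₁ l₂} {w}, Tendsto δ (𝓝[≠] 0) (𝓝 w) →
      DominatedLim d l₁ l₂ (fun ε x => vel hd i x (δ ε)) fun x => vel hd i x w := fun i _ _ h =>
    DominatedLim.of_state (C := 1) (fun w => (hasPartials_vel hd i w).cont)
      (fun x _ w => by rw [one_mul]; exact abs_vel_le w hd i x) h
  have Pl : ∀ {δ : ℝ → State d l₁ l₂} {w}, Tendsto δ (𝓝[≠] 0) (𝓝 w) →
      DominatedLim d l₁ l₂ (fun ε x => prs hd x (δ ε)) fun x => prs hd x w := fun h =>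
    DominatedLim.of_state (C := 1) (fun w => (hasPartials_prs hd w).cont)
      (fun x _ w => by rw [one_mul]; exact abs_prs_le w hd x) h
  have Φl : ∀ i, ∀ {δ : ℝ → State d l₁ l₂} {w}, Tendsto δ (𝓝[≠] 0) (𝓝 w) →
      DominatedLim d l₁ l₂ (fun ε x => dphi d i x (δ ε)) fun x => dphi d i x w := fun i _ _ h =>
    DominatedLim.of_state (fun w => (hasPartials_dphi i w).cont)
      (fun x hx w => abs_dphi_le hd i (periodBox_subset hx) w) h
  have hE' : ∀ᶠ ε in 𝓝[≠] (0 : ℝ), SolvesEuler d (γ ε).u (γ ε).p (γ ε).eta :=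
    hE.filter_mono nhdsWithin_le_nhds
  -- A uniform lower bound on ρ keeps 1/ρ dominated.
  have hsmall : ∀ᶠ ε in 𝓝[≠] (0 : ℝ), ∀ x : R3, x ∈ periodBox d l₁ l₂ →
      1 / 2 ≤ 1 + dphi d 2 x (γ ε) := by
    have hlim : Tendsto (fun ε => (1 + 1 / d) * ‖γ ε - γ 0‖) (𝓝[≠] 0) (𝓝 0) := by
      have := ((hγc.sub_const (γ 0)).norm).const_mul (1 + 1 / d)
      simpa using this
    filter_upwards [hlim.eventually (gt_mem_nhds (show (0 : ℝ) < 1 / 2 by norm_num))] with ε hε x hx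
    have h1 := abs_dphi_le hd 2 (periodBox_subset hx) (γ ε - γ 0)
    rw [map_sub, h0.dphi, sub_zero] at h1
    have := (abs_le.1 (h1.trans hε.le)).1
    linarith
  have Rl : DominatedLim d l₁ l₂ (fun ε x => (1 + dphi d 2 x (γ ε))⁻¹)
      fun x => (1 + dphi d 2 x (γ 0))⁻¹ := by
    refine DominatedLim.inv (c := 1 / 2) (by norm_num)
      ((DominatedLim.of_continuous continuous_const).add (Φl 2 hγc)) ?_ ?_
    · filter_upwards [hE', hsmall] with ε h1 h2
      exact ⟨fun x => (h1.rho_pos hd x).ne', h2⟩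
    · intro x _
      simp [h0.dphi]
  have N1 := (Vl 1 hδ).mul Rl
  have N2 := ((Vl 2 hδ).add ((((Vl 0 hγc).mul (Φl 0 hδ)).add ((Vl 1 hγc).mul (Φl 1 hδ))).add
    ((Vl 2 hγc).mul (Φl 2 hδ)))).mul Rl
  have cθ := T.cont_θ
  have cθ' := T.cont_θ'
  have cθ'' := T.cont_θ''
  have cs := T.cont_s
  have cs' := T.cont_s'
  have cs'' := T.cont_s''
  have t1 := DominatedLim.of_continuous (d := d) (l₁ := l₁) (l₂ := l₂)
    (show Continuous fun x : R3 => θ' (x 2) * s' (x 1) by fun_prop)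
  have t2 := DominatedLim.of_continuous (d := d) (l₁ := l₁) (l₂ := l₂)
    (show Continuous fun x : R3 => θ'' (x 2) * s (x 1) by fun_prop)
  have t3 := DominatedLim.of_continuous (d := d) (l₁ := l₁) (l₂ := l₂)
    (show Continuous fun x : R3 => θ (x 2) * s'' (x 1) by fun_prop)
  have A1 := N1.mul (((Vl 1 hδ).mul t1).add ((Vl 2 hδ).mul t2))
  have A2 := N2.mul (((Vl 1 hδ).mul t3).add ((Vl 2 hδ).mul t1))
  have A3 := (Pl hδ).mul ((t1.mul (Φl 2 hδ)).sub (t2.mul (Φl 1 hδ)))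
  have A := ((A1.sub A2).add A3).integral
  have hlim := tendsto_nhds_unique (A.congr' (f₂ := fun _ => (0 : ℝ)) (by
    filter_upwards [hE', self_mem_nhdsWithin] with ε hε hε0
    have h1 := hε.integral_flux hd hl₁ hl₂ T
    -- Each of u₂, u₃, ℘, ∂φ vanishes on the shear flow and so equals ε times its value at δ ε.
    -- Every term of the flux identity contains exactly two such factors apart from 1/ρ or terms
    -- that are kept together in (Mu)₃, so ε² can be taken out.
    have h2 : ∫ x in periodBox d l₁ l₂, ε ^ 2 * (vel hd 1 x (δ ε) * (1 + dphi d 2 x (γ ε))⁻¹ *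
        (vel hd 1 x (δ ε) * (θ' (x 2) * s' (x 1)) + vel hd 2 x (δ ε) * (θ'' (x 2) * s (x 1))) -
        (vel hd 2 x (δ ε) + (vel hd 0 x (γ ε) * dphi d 0 x (δ ε) +
          vel hd 1 x (γ ε) * dphi d 1 x (δ ε) + vel hd 2 x (γ ε) * dphi d 2 x (δ ε))) *
          (1 + dphi d 2 x (γ ε))⁻¹ *
          (vel hd 1 x (δ ε) * (θ (x 2) * s'' (x 1)) + vel hd 2 x (δ ε) * (θ' (x 2) * s' (x 1))) +
        prs hd x (δ ε) * (θ' (x 2) * s' (x 1) * dphi d 2 x (δ ε) -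
          θ'' (x 2) * s (x 1) * dphi d 1 x (δ ε))) = 0 := by
        rw [← h1]
        refine MeasureTheory.setIntegral_congr_fun measurableSet_Icc fun x hx => ?_
        have hx' := periodBox_subset hx
        have hlin : ∀ L : State d l₁ l₂ →L[ℝ] ℝ, L (γ 0) = 0 → L (γ ε) = ε * L (δ ε) :=
          fun L hL => by rw [hγδ ε hε0, map_add, hL, map_smul, zero_add, smul_eq_mul]
        have v1 := hlin (vel hd 1 x) (by rw [h0.vel x hx']; rfl)
        have v2 := hlin (vel hd 2 x) (by rw [h0.vel x hx']; rfl)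
        have pp := hlin (prs hd x) (h0.prs x hx')
        have p0 := hlin (dphi d 0 x) (h0.dphi x 0)
        have p1 := hlin (dphi d 1 x) (h0.dphi x 1)
        have p2 := hlin (dphi d 2 x) (h0.dphi x 2)
        simp only [physVel, velNum, Fin.sum_univ_three, Matrix.cons_val]
        generalize (1 + dphi d 2 x (γ ε))⁻¹ = R
        rw [v1, v2, pp, p0, p1, p2]
        ring
    rw [MeasureTheory.integral_const_mul] at h2
    exact (mul_eq_zero.1 h2).resolve_left (pow_ne_zero 2 hε0))) tendsto_const_nhds
  rw [← hlim]
  refine MeasureTheory.setIntegral_congr_fun measurableSet_Icc fun x hx => ?_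
  have hx' := periodBox_subset hx
  simp only [h0.dphi, h0.vel x hx', Matrix.cons_val]
  ring

end WaterWave

/-! ### Horizontal moments and the reduction of the linearized equations to modes. -/

namespace WaterWave

variable {d l₁ l₂ : ℝ}

/-- The moment `∬ f(x₁, x₂, z) a(x₁) b(x₂)` over a horizontal period. -/
noncomputable def moment (l₁ l₂ : ℝ) (f : R3 → ℝ) (a b : ℝ → ℝ) (z : ℝ) : ℝ :=
  ∫ x in (0 : ℝ)..l₁, ∫ y in (0 : ℝ)..l₂, f ![x, y, z] * a x * b y

section Moment

variable {f g g₀ g₁ g₂ : R3 → ℝ} {a a' b b' : ℝ → ℝ}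

theorem continuous_moment_integrand (hf : Continuous f) (ha : Continuous a) (hb : Continuous b) :
    Continuous fun q : ℝ × ℝ × ℝ => f ![q.2.1, q.2.2, q.1] * a q.2.1 * b q.2.2 := by
  have : Continuous fun q : ℝ × ℝ × ℝ => (![q.2.1, q.2.2, q.1] : R3) := by fun_prop
  have := hf.comp this
  simp only [Function.comp_def] at this
  fun_prop

theorem continuous_moment_inner (hf : Continuous f) (ha : Continuous a) (hb : Continuous b)
    (l₂ : ℝ) :
    Continuous fun q : ℝ × ℝ => ∫ y in (0 : ℝ)..l₂, f ![q.2, y, q.1] * a q.2 * b y := by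
  apply intervalIntegral.continuous_parametric_intervalIntegral_of_continuous'
  exact (continuous_moment_integrand hf ha hb).comp
    (f := fun p : (ℝ × ℝ) × ℝ => (p.1.1, p.1.2, p.2)) (by fun_prop)

theorem continuous_moment (hf : Continuous f) (ha : Continuous a) (hb : Continuous b) :
    Continuous (moment l₁ l₂ f a b) := by
  apply intervalIntegral.continuous_parametric_intervalIntegral_of_continuous'
  exact continuous_moment_inner hf ha hb l₂

theorem moment_congr {z : ℝ} (h : ∀ x y, f ![x, y, z] = g ![x, y, z]) :
    moment l₁ l₂ f a b z = moment l₁ l₂ g a b z := by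
  simp only [moment, h]

theorem moment_add (hf : Continuous f) (hg : Continuous g) (ha : Continuous a) (hb : Continuous b)
    (z : ℝ) : moment l₁ l₂ (fun x => f x + g x) a b z =
      moment l₁ l₂ f a b z + moment l₁ l₂ g a b z := by
  have h1 := continuous_moment_inner hf ha hb l₂
  have h2 := continuous_moment_inner hg ha hb l₂
  have e1 := continuous_moment_integrand hf ha hb
  have e2 := continuous_moment_integrand hg ha hb
  rw [moment, moment, moment, ← intervalIntegral.integral_add]
  · refine intervalIntegral.integral_congr fun x _ => ?_
    rw [← intervalIntegral.integral_add]
    · refine intervalIntegral.integral_congr fun y _ => ?_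
      ring
    · exact (e1.comp (f := fun y => (z, x, y)) (by fun_prop)).intervalIntegrable _ _
    · exact (e2.comp (f := fun y => (z, x, y)) (by fun_prop)).intervalIntegrable _ _
  · exact (h1.comp (f := fun x => (z, x)) (by fun_prop)).intervalIntegrable _ _
  · exact (h2.comp (f := fun x => (z, x)) (by fun_prop)).intervalIntegrable _ _

theorem moment_vertical_mul (u : ℝ → ℝ) (z : ℝ) :
    moment l₁ l₂ (fun x => u (x 2) * f x) a b z = u z * moment l₁ l₂ f a b z := by
  simp only [moment, ← intervalIntegral.integral_const_mul, Matrix.cons_val, mul_assoc]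

theorem moment_left_mul (c : ℝ) (z : ℝ) :
    moment l₁ l₂ f (fun x => c * a x) b z = c * moment l₁ l₂ f a b z := by
  simp only [moment, ← intervalIntegral.integral_const_mul]
  refine intervalIntegral.integral_congr fun x _ => intervalIntegral.integral_congr fun y _ => ?_
  ring

theorem moment_right_mul (c : ℝ) (z : ℝ) :
    moment l₁ l₂ f a (fun x => c * b x) z = c * moment l₁ l₂ f a b z := by
  simp only [moment, ← intervalIntegral.integral_const_mul]
  refine intervalIntegral.integral_congr fun x _ => intervalIntegral.integral_congr fun y _ => ?_
  ring

theorem moment_eq_swap (hf : Continuous f) (ha : Continuous a) (hb : Continuous b) (z : ℝ) :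
    moment l₁ l₂ f a b z = ∫ y in (0 : ℝ)..l₂, ∫ x in (0 : ℝ)..l₁, f ![x, y, z] * a x * b y := by
  rw [moment, MeasureTheory.intervalIntegral_intervalIntegral_swap]
  refine ((Continuous.continuousOn ?_).integrableOn_compact
    (isCompact_uIcc.prod isCompact_uIcc)).mono_set (prod_mono uIoc_subset_uIcc uIoc_subset_uIcc)
  exact (continuous_moment_integrand hf ha hb).comp
      (f := fun p : ℝ × ℝ => (z, p.1, p.2)) (by fun_prop)

theorem HasPartials.hasDerivAt₀ (h : HasPartials d l₁ l₂ f g₀ g₁ g₂) {z : ℝ} (hz : z ∈ Ioo (-d) 0)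
    (x y : ℝ) : HasDerivAt (fun t => f ![t, y, z]) (g₀ ![x, y, z]) x := by
  have h1 := h.hasDerivAt_line (x := ![x, y, z]) (by simpa [domain] using hz) 0
  have h2 : HasDerivAt (fun t => f (![x, y, z] + (t - x) • Pi.single 0 1)) (g₀ ![x, y, z]) x := by
    have h3 := HasDerivAt.comp_sub_const x x (by simpa using h1)
    simpa using h3
  convert h2 using 3 with t
  ext i; fin_cases i <;> simp

theorem HasPartials.hasDerivAt₁ (h : HasPartials d l₁ l₂ f g₀ g₁ g₂) {z : ℝ} (hz : z ∈ Ioo (-d) 0)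
    (x y : ℝ) : HasDerivAt (fun t => f ![x, t, z]) (g₁ ![x, y, z]) y := by
  have h1 := h.hasDerivAt_line (x := ![x, y, z]) (by simpa [domain] using hz) 1
  have h2 : HasDerivAt (fun t => f (![x, y, z] + (t - y) • Pi.single 1 1)) (g₁ ![x, y, z]) y := by
    have h3 := HasDerivAt.comp_sub_const y y (by simpa using h1)
    simpa using h3
  convert h2 using 3 with t
  ext i; fin_cases i <;> simp

theorem HasPartials.hasDerivAt₂ (h : HasPartials d l₁ l₂ f g₀ g₁ g₂) {z : ℝ} (hz : z ∈ Ioo (-d) 0)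
    (x y : ℝ) : HasDerivAt (fun t => f ![x, y, t]) (g₂ ![x, y, z]) z := by
  have h1 := h.hasDerivAt_line (x := ![x, y, z]) (by simpa [domain] using hz) 2
  have h2 : HasDerivAt (fun t => f (![x, y, z] + (t - z) • Pi.single 2 1)) (g₂ ![x, y, z]) z := by
    have h3 := HasDerivAt.comp_sub_const z z (by simpa using h1)
    simpa using h3
  convert h2 using 3 with t
  ext i; fin_cases i <;> simp

theorem IsPeriodic.apply_zero (h : IsPeriodic l₁ l₂ f) (x y z : ℝ) :
    f ![x + l₁, y, z] = f ![x, y, z] := by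
  rw [← h.1 ![x, y, z]]
  congr 1
  ext i; fin_cases i <;> simp

theorem IsPeriodic.apply_one (h : IsPeriodic l₁ l₂ f) (x y z : ℝ) :
    f ![x, y + l₂, z] = f ![x, y, z] := by
  rw [← h.2 ![x, y, z]]
  congr 1
  ext i; fin_cases i <;> simp

theorem HasPartials.moment₀ (h : HasPartials d l₁ l₂ f g₀ g₁ g₂) {z : ℝ} (hz : z ∈ Ioo (-d) 0)
    (ha : ∀ x, HasDerivAt a (a' x) x) (ha' : Continuous a') (hb : Continuous b)
    (hper : a l₁ = a 0) : moment l₁ l₂ g₀ a b z = -moment l₁ l₂ f a' b z := by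
  have hac : Continuous a := continuous_iff_continuousAt.2 fun x => (ha x).continuousAt
  rw [moment_eq_swap h.cont₀ hac hb, moment_eq_swap h.cont ha' hb, ← intervalIntegral.integral_neg]
  refine intervalIntegral.integral_congr fun y _ => ?_
  simp only [intervalIntegral.integral_mul_const]
  rw [← neg_mul]
  congr 1
  have c0 : Continuous fun x => g₀ ![x, y, z] := h.cont₀.comp (by fun_prop)
  have cf : Continuous fun x => f ![x, y, z] := h.cont.comp (by fun_prop)
  have := intervalIntegral.integral_eq_sub_of_hasDerivAt (a := 0) (b := l₁)
    (fun x _ => (h.hasDerivAt₀ hz x y).fun_mul (ha x))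
    (((c0.mul hac).add (cf.mul ha')).intervalIntegrable _ _)
  rw [intervalIntegral.integral_add
    (Continuous.intervalIntegrable (u := fun x => g₀ ![x, y, z] * a x) (c0.mul hac) _ _)
    (Continuous.intervalIntegrable (u := fun x => f ![x, y, z] * a' x) (cf.mul ha') _ _)] at this
  have hp := h.periodic.apply_zero 0 y z
  rw [zero_add] at hp
  rw [hp, hper, sub_self] at this
  linarith

theorem HasPartials.moment₁ (h : HasPartials d l₁ l₂ f g₀ g₁ g₂) {z : ℝ} (hz : z ∈ Ioo (-d) 0)
    (hb : ∀ x, HasDerivAt b (b' x) x) (hb' : Continuous b')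
    (hper : b l₂ = b 0) : moment l₁ l₂ g₁ a b z = -moment l₁ l₂ f a b' z := by
  have hbc : Continuous b := continuous_iff_continuousAt.2 fun x => (hb x).continuousAt
  rw [moment, moment, ← intervalIntegral.integral_neg]
  refine intervalIntegral.integral_congr fun x _ => ?_
  have hcomm : ∀ r s t : ℝ, r * s * t = s * (r * t) := fun _ _ _ => by ring
  simp only [hcomm _ (a x), intervalIntegral.integral_const_mul]
  rw [← mul_neg]
  congr 1
  have c0 : Continuous fun y => g₁ ![x, y, z] := h.cont₁.comp (by fun_prop)
  have cf : Continuous fun y => f ![x, y, z] := h.cont.comp (by fun_prop)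
  have := intervalIntegral.integral_eq_sub_of_hasDerivAt (a := 0) (b := l₂)
    (fun y _ => (h.hasDerivAt₁ hz x y).fun_mul (hb y))
    (((c0.mul hbc).add (cf.mul hb')).intervalIntegrable _ _)
  rw [intervalIntegral.integral_add
    (Continuous.intervalIntegrable (u := fun y => g₁ ![x, y, z] * b y) (c0.mul hbc) _ _)
    (Continuous.intervalIntegrable (u := fun y => f ![x, y, z] * b' y) (cf.mul hb') _ _)] at this
  have hp := h.periodic.apply_one x 0 z
  rw [zero_add] at hp
  rw [hp, hper, sub_self] at this
  linarith

theorem HasPartials.moment₂ (hl₁ : 0 < l₁) (hl₂ : 0 < l₂) (h : HasPartials d l₁ l₂ f g₀ g₁ g₂)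
    {z : ℝ} (hz : z ∈ Ioo (-d) 0) (ha : Continuous a) (hb : Continuous b) :
    HasDerivAt (moment l₁ l₂ f a b) (moment l₁ l₂ g₂ a b z) z := by
  have cf := continuous_moment_integrand h.cont ha hb
  have cg := continuous_moment_integrand h.cont₂ ha hb
  have cf' := continuous_moment_inner h.cont ha hb l₂
  have cg' := continuous_moment_inner h.cont₂ ha hb l₂
  obtain ⟨C, hC⟩ := ((isCompact_Icc (a := -d) (b := 0)).prod ((isCompact_Icc (a := 0) (b := l₁)).prod
    (isCompact_Icc (a := 0) (b := l₂)))).exists_bound_of_continuousOn cg.continuousOn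
  have key : ∀ x ∈ Icc 0 l₁, ∀ t ∈ Ioo (-d) 0, HasDerivAt
      (fun t => ∫ y in (0 : ℝ)..l₂, f ![x, y, t] * a x * b y)
      (∫ y in (0 : ℝ)..l₂, g₂ ![x, y, t] * a x * b y) t := by
    intro x hx t ht
    refine (intervalIntegral.hasDerivAt_integral_of_dominated_loc_of_deriv_le (𝕜 := ℝ)
      (F := fun t y => f ![x, y, t] * a x * b y) (F' := fun t y => g₂ ![x, y, t] * a x * b y)
      (bound := fun _ => C) (Ioo_mem_nhds ht.1 ht.2) ?_ ?_ ?_ ?_ ?_ ?_).2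
    · exact Eventually.of_forall fun t => Continuous.aestronglyMeasurable
        (cf.comp (f := fun y => (t, x, y)) (by fun_prop))
    · exact (cf.comp (f := fun y => (t, x, y)) (by fun_prop)).intervalIntegrable _ _
    · exact Continuous.aestronglyMeasurable (cg.comp (f := fun y => (t, x, y)) (by fun_prop))
    · refine Eventually.of_forall fun y hy t ht => ?_
      rw [uIoc_of_le hl₂.le] at hy
      exact hC (t, x, y) ⟨Ioo_subset_Icc_self ht, hx, Ioc_subset_Icc_self hy⟩
    · exact continuous_const.intervalIntegrable _ _
    · exact Eventually.of_forall fun y _ t ht =>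
        ((h.hasDerivAt₂ ht x y).mul_const (a x)).mul_const (b y)
  refine (intervalIntegral.hasDerivAt_integral_of_dominated_loc_of_deriv_le (𝕜 := ℝ)
      (F := fun t x => ∫ y in (0 : ℝ)..l₂, f ![x, y, t] * a x * b y)
      (F' := fun t x => ∫ y in (0 : ℝ)..l₂, g₂ ![x, y, t] * a x * b y)
      (bound := fun _ => C * |l₂ - 0|) (Ioo_mem_nhds hz.1 hz.2) ?_ ?_ ?_ ?_ ?_ ?_).2
  · exact Eventually.of_forall fun t => Continuous.aestronglyMeasurable
        (cf'.comp (f := fun x => (t, x)) (by fun_prop))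
  · exact (cf'.comp (f := fun x => (z, x)) (by fun_prop)).intervalIntegrable _ _
  · exact Continuous.aestronglyMeasurable (cg'.comp (f := fun x => (z, x)) (by fun_prop))
  · refine Eventually.of_forall fun x hx t ht => ?_
    rw [uIoc_of_le hl₁.le] at hx
    refine intervalIntegral.norm_integral_le_of_norm_le_const fun y hy => ?_
    rw [uIoc_of_le hl₂.le] at hy
    exact hC (t, x, y) ⟨Ioo_subset_Icc_self ht, Ioc_subset_Icc_self hx, Ioc_subset_Icc_self hy⟩
  · exact continuous_const.intervalIntegrable _ _
  · refine Eventually.of_forall fun x hx t ht => ?_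
    rw [uIoc_of_le hl₁.le] at hx
    exact key x (Ioc_subset_Icc_self hx) t ht

end Moment

noncomputable section

/-- `cos (2π n x / l)`. -/
def cosMode (l : ℝ) (n : ℕ) (x : ℝ) : ℝ := Real.cos (2 * Real.pi / l * n * x)

/-- `sin (2π n x / l)`. -/
def sinMode (l : ℝ) (n : ℕ) (x : ℝ) : ℝ := Real.sin (2 * Real.pi / l * n * x)

end

section Trig

variable (l : ℝ) (n : ℕ)

theorem continuous_cosMode : Continuous (cosMode l n) := by unfold cosMode; fun_prop

theorem continuous_sinMode : Continuous (sinMode l n) := by unfold sinMode; fun_prop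

theorem hasDerivAt_cosMode (x : ℝ) :
    HasDerivAt (cosMode l n) (-(2 * Real.pi / l * n) * sinMode l n x) x := by
  refine (((hasDerivAt_id' x).const_mul (2 * Real.pi / l * n)).cos).congr_deriv ?_
  simp [sinMode]; ring

theorem hasDerivAt_sinMode (x : ℝ) :
    HasDerivAt (sinMode l n) (2 * Real.pi / l * n * cosMode l n x) x := by
  refine (((hasDerivAt_id' x).const_mul (2 * Real.pi / l * n)).sin).congr_deriv ?_
  simp [cosMode]; ring

variable {l} (hl : 0 < l)
include hl

theorem cosMode_add (x : ℝ) : cosMode l n (x + l) = cosMode l n x := by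
  have : 2 * Real.pi / l * n * (x + l) = 2 * Real.pi / l * n * x + n * (2 * Real.pi) := by
    field_simp
  rw [cosMode, this, Real.cos_add_nat_mul_two_pi, cosMode]

theorem sinMode_add (x : ℝ) : sinMode l n (x + l) = sinMode l n x := by
  have : 2 * Real.pi / l * n * (x + l) = 2 * Real.pi / l * n * x + n * (2 * Real.pi) := by
    field_simp
  rw [sinMode, this, Real.sin_add_nat_mul_two_pi, sinMode]

theorem cosMode_period : cosMode l n l = cosMode l n 0 := by
  simpa using cosMode_add n hl 0

theorem sinMode_period : sinMode l n l = sinMode l n 0 := by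
  simpa using sinMode_add n hl 0

end Trig

section Modes

noncomputable section

/-- The Fourier mode `(m, n)` of the pressure. -/
def prsMode (hd : 0 < d) (m n : ℕ) (w : State d l₁ l₂) : ℝ → ℝ :=
  moment l₁ l₂ (fun x => prs hd x w) (cosMode l₁ m) (cosMode l₂ n)

/-- The Fourier mode `(m, n)` of `∂₃℘`. -/
def dprsMode (hd : 0 < d) (m n : ℕ) (w : State d l₁ l₂) : ℝ → ℝ :=
  moment l₁ l₂ (fun x => dprs hd 2 x w) (cosMode l₁ m) (cosMode l₂ n)

/-- The Fourier mode `(m, n)` of the surface elevation. -/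
def elvMode (m n : ℕ) (w : State d l₁ l₂) : ℝ :=
  moment l₁ l₂ (fun x => elv x w) (cosMode l₁ m) (cosMode l₂ n) 0

end

theorem elvMode_eq (m n : ℕ) (w : State d l₁ l₂) (z : ℝ) :
    moment l₁ l₂ (fun x => elv x w) (cosMode l₁ m) (cosMode l₂ n) z = elvMode m n w := by
  have : ∀ x y, elv ![x, y, z] w = elv ![x, y, 0] w := fun x y => by
    rw [elv_def, elv_def]; simp [horiz]
  simp only [elvMode, moment, this]

variable (hl₁ : 0 < l₁) (hl₂ : 0 < l₂) {U V : ℝ → ℝ} (hU : IsExtProfile d U V) {w : State d l₁ l₂}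
  (h : LinearizedJet hU.pos U V w) (m n : ℕ)
include hl₁ hl₂ h

/-- The Fourier modes of the pressure of a solution of the linearized equations. -/
theorem LinearizedJet.isMode :
    IsMode d U V ((2 * Real.pi / l₁ * m) ^ 2 + (2 * Real.pi / l₂ * n) ^ 2)
      (prsMode hU.pos m n w) (dprsMode hU.pos m n w) ∧
    dprsMode hU.pos m n w 0 = U 0 ^ 2 * (2 * Real.pi / l₁ * m) ^ 2 * elvMode m n w ∧
    (m = 0 → ∀ z ∈ Icc (-d) 0, dprsMode hU.pos m n w z = 0 ∧
      2 * Real.pi / l₂ * n * prsMode hU.pos m n w z = 0) := by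
  have hd := hU.pos
  set k₁ : ℝ := 2 * Real.pi / l₁ * m with hk₁
  set k₂ : ℝ := 2 * Real.pi / l₂ * n with hk₂
  have cC := continuous_cosMode l₁ m
  have cS := continuous_sinMode l₁ m
  have cC' := continuous_cosMode l₂ n
  have cS' := continuous_sinMode l₂ n
  have dC := hasDerivAt_cosMode l₁ m
  have dS := hasDerivAt_sinMode l₁ m
  have dC' := hasDerivAt_cosMode l₂ n
  have dS' := hasDerivAt_sinMode l₂ n
  have u := fun i => hasPartials_vel hd i w
  have p := hasPartials_prs hd w
  have φ := fun i => hasPartials_dphi i w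
  have hUc := hU.cont_ext
  have hVc := hU.cont_deriv_ext
  have hUx : Continuous fun x : R3 => U (x 2) := by fun_prop
  have hVx : Continuous fun x : R3 => V (x 2) := by fun_prop
  have hmem : ∀ z ∈ Ioo (-d) 0, ∀ x y, (![x, y, z] : R3) ∈ closedDomain d := fun z hz x y =>
    ⟨by simpa using hz.1.le, by simpa using hz.2.le⟩
  have byC : ∀ {f g₀ g₁ g₂ : R3 → ℝ}, HasPartials d l₁ l₂ f g₀ g₁ g₂ → ∀ {b : ℝ → ℝ},
      Continuous b → ∀ z ∈ Ioo (-d) 0, moment l₁ l₂ g₀ (cosMode l₁ m) b z =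
        k₁ * moment l₁ l₂ f (sinMode l₁ m) b z := by
    intro f g₀ g₁ g₂ hf b hb z hz
    rw [hf.moment₀ hz dC (by fun_prop) hb (cosMode_period m hl₁), moment_left_mul]
    ring
  have byS : ∀ {f g₀ g₁ g₂ : R3 → ℝ}, HasPartials d l₁ l₂ f g₀ g₁ g₂ → ∀ {b : ℝ → ℝ},
      Continuous b → ∀ z ∈ Ioo (-d) 0, moment l₁ l₂ g₀ (sinMode l₁ m) b z =
        -(k₁ * moment l₁ l₂ f (cosMode l₁ m) b z) := by
    intro f g₀ g₁ g₂ hf b hb z hz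
    rw [hf.moment₀ hz dS (by fun_prop) hb (sinMode_period m hl₁), moment_left_mul]
  have byC' : ∀ {f g₀ g₁ g₂ : R3 → ℝ}, HasPartials d l₁ l₂ f g₀ g₁ g₂ → ∀ {a : ℝ → ℝ},
      ∀ z ∈ Ioo (-d) 0, moment l₁ l₂ g₁ a (cosMode l₂ n) z =
        k₂ * moment l₁ l₂ f a (sinMode l₂ n) z := by
    intro f g₀ g₁ g₂ hf a z hz
    rw [hf.moment₁ hz dC' (by fun_prop) (cosMode_period n hl₂), moment_right_mul]
    ring
  have byS' : ∀ {f g₀ g₁ g₂ : R3 → ℝ}, HasPartials d l₁ l₂ f g₀ g₁ g₂ → ∀ {a : ℝ → ℝ},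
      ∀ z ∈ Ioo (-d) 0, moment l₁ l₂ g₁ a (sinMode l₂ n) z =
        -(k₂ * moment l₁ l₂ f a (cosMode l₂ n) z) := by
    intro f g₀ g₁ g₂ hf a z hz
    rw [hf.moment₁ hz dS' (by fun_prop) (sinMode_period n hl₂), moment_right_mul]
  have hzero : ∀ (a b : ℝ → ℝ) z, moment l₁ l₂ (fun _ => (0 : ℝ)) a b z = 0 := fun a b z => by
    simp [moment]
  -- The weights follow the parities imposed by (+)-symmetry: u₃ is odd in x₁ and even in x₂, u₁ is
  -- even in both, and u₂ is odd in both.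
  set W := moment l₁ l₂ (fun x => vel hd 2 x w) (sinMode l₁ m) (cosMode l₂ n) with hW
  set A₀ := moment l₁ l₂ (fun x => vel hd 0 x w) (cosMode l₁ m) (cosMode l₂ n) with hA₀
  set A₁ := moment l₁ l₂ (fun x => vel hd 1 x w) (sinMode l₁ m) (sinMode l₂ n) with hA₁
  have hWc : Continuous W := continuous_moment (u 2).cont cS cC'
  have hWd : ∀ z ∈ Ioo (-d) 0, HasDerivAt W
      (moment l₁ l₂ (fun x => dvel hd 2 2 x w) (sinMode l₁ m) (cosMode l₂ n) z) z := fun z hz =>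
    (u 2).moment₂ hl₁ hl₂ hz cS cC'
  have M2 : ∀ z ∈ Ioo (-d) 0, U z * (k₁ * W z) + U z ^ 2 * (-(k₁ ^ 2 * ((1 + z / d) *
      elvMode m n w))) + dprsMode hd m n w z = 0 := by
    intro z hz
    have h1 := hzero (cosMode l₁ m) (cosMode l₂ n) z
    rw [← moment_congr (f := fun x => (U (x 2) * dvel hd 2 0 x w +
        U (x 2) ^ 2 * ddphi d 0 0 x w) + dprs hd 2 x w) (g := fun _ => 0)
      (fun x y => h.momentum₂ _ (hmem z hz x y)),
      moment_add ((hUx.fun_mul (u 2).cont₀).fun_add ((hUx.fun_pow 2).fun_mul (φ 0).cont₀)) p.cont₂ cC cC',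
      moment_add (hUx.fun_mul (u 2).cont₀) ((hUx.fun_pow 2).fun_mul (φ 0).cont₀) cC cC',
      moment_vertical_mul U, moment_vertical_mul (fun z => U z ^ 2), byC (u 2) cC' z hz,
      byC (φ 0) cC' z hz, byS (hasPartials_phi w) cC' z hz,
      moment_vertical_mul (fun z => 1 + z / d), elvMode_eq] at h1
    rw [← h1, dprsMode]
    ring
  have M0 : ∀ z ∈ Ioo (-d) 0, V z * W z - U z * (k₁ * A₀ z) + U z ^ 2 *
      (k₁ * (elvMode m n w / d)) - k₁ * prsMode hd m n w z = 0 := by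
    intro z hz
    have h1 := hzero (sinMode l₁ m) (cosMode l₂ n) z
    rw [← moment_congr (f := fun x => ((V (x 2) * vel hd 2 x w + U (x 2) * dvel hd 0 0 x w) +
        (-U (x 2) ^ 2) * ddphi d 2 0 x w) + dprs hd 0 x w) (g := fun _ => 0)
      (fun x y => by rw [← h.momentum₀ _ (hmem z hz x y)]; ring),
      moment_add (((hVx.fun_mul (u 2).cont).fun_add (hUx.fun_mul (u 0).cont₀)).fun_add
        ((hUx.fun_pow 2).fun_neg.fun_mul (φ 2).cont₀)) p.cont₀ cS cC',
      moment_add ((hVx.fun_mul (u 2).cont).fun_add (hUx.fun_mul (u 0).cont₀))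
        ((hUx.fun_pow 2).fun_neg.fun_mul (φ 2).cont₀) cS cC',
      moment_add (hVx.fun_mul (u 2).cont) (hUx.fun_mul (u 0).cont₀) cS cC',
      moment_vertical_mul V, moment_vertical_mul U, moment_vertical_mul (fun z => -U z ^ 2),
      byS (u 0) cC' z hz, byS (φ 2) cC' z hz, byS p cC' z hz] at h1
    have h2 : moment l₁ l₂ (fun x => dphi d 2 x w) (cosMode l₁ m) (cosMode l₂ n) z =
        1 / d * elvMode m n w := by
      rw [← elvMode_eq m n w z, ← moment_vertical_mul (fun _ => 1 / d)]
      rfl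
    rw [h2] at h1
    rw [← h1, prsMode]
    ring
  have M1 : ∀ z ∈ Ioo (-d) 0, U z * (k₁ * A₁ z) - k₂ * prsMode hd m n w z = 0 := by
    intro z hz
    have h1 := hzero (cosMode l₁ m) (sinMode l₂ n) z
    rw [← moment_congr (f := fun x => U (x 2) * dvel hd 1 0 x w + dprs hd 1 x w)
      (g := fun _ => 0) (fun x y => h.momentum₁ _ (hmem z hz x y)),
      moment_add (hUx.fun_mul (u 1).cont₀) p.cont₁ cC cS', moment_vertical_mul U,
      byC (u 1) cS' z hz, byS' p z hz] at h1
    rw [← h1, prsMode]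
    ring
  have MD : ∀ z ∈ Ioo (-d) 0, -(k₁ * A₀ z) + k₂ * A₁ z +
      moment l₁ l₂ (fun x => dvel hd 2 2 x w) (sinMode l₁ m) (cosMode l₂ n) z = 0 := by
    intro z hz
    have h1 := hzero (sinMode l₁ m) (cosMode l₂ n) z
    rw [← moment_congr (f := fun x => (dvel hd 0 0 x w + dvel hd 1 1 x w) + dvel hd 2 2 x w)
      (g := fun _ => 0) (fun x y => by rw [← Fin.sum_univ_three (f := fun i => dvel hd i i _ w)]; exact h.div_eq _ (hmem z hz x y)),
      moment_add ((u 0).cont₀.fun_add (u 1).cont₁) (u 2).cont₂ cS cC',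
      moment_add (u 0).cont₀ (u 1).cont₁ cS cC', byS (u 0) cC' z hz, byC' (u 1) z hz] at h1
    exact h1
  -- The third momentum equation expresses the mode of ∂₃℘ through W and (1 + z/d)η. Since W
  -- vanishes at both ends and 1 + z/d equals 0 at the bottom and 1 at the surface, it yields both
  -- boundary values of e.
  have hWb : ∀ z, z = 0 ∨ z = -d → W z = 0 := fun z hz => by
    rw [hW, moment_congr (g := fun _ => 0) (fun x y => h.boundary _ (by simpa using hz)),
      hzero]
  have hcl : Icc (-d) 0 ⊆ closure (Ioo (-d) 0) := by rw [closure_Ioo (by linarith)]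
  have hcc : Continuous (prsMode hd m n w) := continuous_moment p.cont cC cC'
  have hcd : Continuous (dprsMode hd m n w) := continuous_moment p.cont₂ cC cC'
  have hE : EqOn (dprsMode hd m n w) (fun z => -(U z * k₁ * W z) +
      U z ^ 2 * (1 + z / d) * k₁ ^ 2 * elvMode m n w) (Icc (-d) 0) := by
    refine EqOn.mono hcl (EqOn.closure (fun z hz => ?_) hcd (by fun_prop))
    linarith [M2 z hz]
  have hdn := hd.ne'
  refine ⟨⟨hcc.continuousOn, hcd.continuousOn, fun z hz => p.moment₂ hl₁ hl₂ hz cC cC',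
    fun z hz => ?_, ?_⟩, ?_, fun hm z hz => ?_⟩
  · have hUz := hU.ne_zero_ext z
    have hUd := hU.hasDerivAt z hz
    have h1 := ((hUd.mul_const k₁).fun_mul (hWd z hz)).fun_neg.fun_add
      ((((hUd.fun_pow 2).fun_mul (((hasDerivAt_id' z).div_const d).const_add 1)).mul_const
        (k₁ ^ 2)).mul_const (elvMode m n w))
    have h2 := h1.congr_of_eventuallyEq (f₁ := dprsMode hd m n w)
      (by filter_upwards [Icc_mem_nhds hz.1 hz.2] with t ht using hE ht)
    refine h2.congr_deriv ?_
    rw [hE (Ioo_subset_Icc_self hz)]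
    have e0 := M0 z hz
    have e1 := M1 z hz
    have e2 := MD z hz
    have e3 : V z / U z * U z = V z := div_mul_cancel₀ _ hUz
    -- Incompressibility replaces W', the first momentum equation removes the moment of u₁, and the
    -- second that of u₂. The W and η that remain recombine to e, and the coefficients of c add up
    -- to k₁² + k₂².
    linear_combination (-U z * k₁) * e2 + k₁ * e0 + k₂ * e1 +
      (2 * k₁ * W z - 2 * U z * (1 + z / d) * k₁ ^ 2 * elvMode m n w) * e3
  · rw [hE hU.left_mem]
    simp only [hWb _ (Or.inr rfl)]
    field_simp
    ring
  · rw [hE hU.right_mem]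
    simp only [hWb _ (Or.inl rfl)]
    ring
  · have hk0 : k₁ = 0 := by simp [hk₁, hm]
    refine ⟨by rw [hE hz, hk0]; ring, ?_⟩
    refine EqOn.mono hcl (EqOn.closure (f := fun z => k₂ * prsMode hd m n w z) (g := fun _ => 0)
      (fun z hz => ?_) (by fun_prop) continuous_const) hz
    have e1 := M1 z hz
    rw [hk0] at e1
    simp only
    linarith

end Modes

end WaterWave

/-! ### Orthogonality and completeness of the trigonometric modes. -/

namespace WaterWave

section Orthogonality

variable {l : ℝ} (hl : 0 < l)
include hl

theorem integral_cos_int (j : ℤ) : ∫ x in (0 : ℝ)..l, Real.cos (2 * Real.pi / l * j * x) =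
    if j = 0 then l else 0 := by
  split_ifs with h
  · simp [h]
  · have hc : 2 * Real.pi / l * j ≠ 0 := by
      have : (j : ℝ) ≠ 0 := by exact_mod_cast h
      have := Real.pi_pos
      positivity
    rw [intervalIntegral.integral_comp_mul_left (fun t => Real.cos t) hc, integral_cos]
    have : 2 * Real.pi / l * j * l = j * (2 * Real.pi) := by field_simp
    rw [this, mul_zero, Real.sin_zero, ← zero_add (j * (2 * Real.pi)),
      Real.sin_add_int_mul_two_pi, Real.sin_zero, sub_zero, smul_zero]

theorem integral_cos_mul_cos (m n : ℕ) : ∫ x in (0 : ℝ)..l, cosMode l m x * cosMode l n x =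
    if m = n then (if m = 0 then l else l / 2) else 0 := by
  have e : ∀ x, cosMode l m x * cosMode l n x = (1 / 2) * (Real.cos (2 * Real.pi / l *
      (m - n : ℤ) * x) + Real.cos (2 * Real.pi / l * (m + n : ℤ) * x)) := fun x => by
    have h := Real.two_mul_cos_mul_cos (2 * Real.pi / l * m * x) (2 * Real.pi / l * n * x)
    have e1 : 2 * Real.pi / l * (m - n : ℤ) * x =
      2 * Real.pi / l * m * x - 2 * Real.pi / l * n * x := by push_cast; ring
    have e2 : 2 * Real.pi / l * (m + n : ℤ) * x =
      2 * Real.pi / l * m * x + 2 * Real.pi / l * n * x := by push_cast; ring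
    rw [e1, e2, ← h, cosMode, cosMode]
    ring
  simp only [e]
  rw [intervalIntegral.integral_const_mul, intervalIntegral.integral_add
    (by apply Continuous.intervalIntegrable; fun_prop)
    (by apply Continuous.intervalIntegrable; fun_prop), integral_cos_int hl, integral_cos_int hl]
  split_ifs <;> first | omega | ring

theorem integral_sin_mul_sin {m n : ℕ} (hm : m ≠ 0) :
    ∫ x in (0 : ℝ)..l, sinMode l m x * sinMode l n x = if m = n then l / 2 else 0 := by
  have e : ∀ x, sinMode l m x * sinMode l n x = (1 / 2) * (Real.cos (2 * Real.pi / l *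
      (m - n : ℤ) * x) - Real.cos (2 * Real.pi / l * (m + n : ℤ) * x)) := fun x => by
    have h := Real.two_mul_sin_mul_sin (2 * Real.pi / l * m * x) (2 * Real.pi / l * n * x)
    have e1 : 2 * Real.pi / l * (m - n : ℤ) * x =
      2 * Real.pi / l * m * x - 2 * Real.pi / l * n * x := by push_cast; ring
    have e2 : 2 * Real.pi / l * (m + n : ℤ) * x =
      2 * Real.pi / l * m * x + 2 * Real.pi / l * n * x := by push_cast; ring
    rw [e1, e2, ← h, sinMode, sinMode]
    ring
  simp only [e]
  rw [intervalIntegral.integral_const_mul, intervalIntegral.integral_sub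
    (by apply Continuous.intervalIntegrable; fun_prop)
    (by apply Continuous.intervalIntegrable; fun_prop), integral_cos_int hl, integral_cos_int hl]
  split_ifs <;> first | omega | ring

omit hl in
/-- Products of two frequencies `m, n ≤ N` seen by the frequency `2 N`. -/
theorem cos_four (x : ℝ) (m n N : ℤ) (f : ℝ) (c₁ c₂ c₃ c₄ : ℝ)
    (h : 4 * f = c₁ * Real.cos (2 * Real.pi / l * m * x - 2 * Real.pi / l * n * x -
        2 * Real.pi / l * N * x) +
      c₂ * Real.cos (2 * Real.pi / l * m * x - 2 * Real.pi / l * n * x +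
        2 * Real.pi / l * N * x) +
      c₃ * Real.cos (2 * Real.pi / l * m * x + 2 * Real.pi / l * n * x -
        2 * Real.pi / l * N * x) +
      c₄ * Real.cos (2 * Real.pi / l * m * x + 2 * Real.pi / l * n * x +
        2 * Real.pi / l * N * x)) :
    f = c₁ / 4 * Real.cos (2 * Real.pi / l * (m - n - N : ℤ) * x) +
      c₂ / 4 * Real.cos (2 * Real.pi / l * (m - n + N : ℤ) * x) +
      c₃ / 4 * Real.cos (2 * Real.pi / l * (m + n - N : ℤ) * x) +
      c₄ / 4 * Real.cos (2 * Real.pi / l * (m + n + N : ℤ) * x) := by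
  have e1 : 2 * Real.pi / l * (m - n - N : ℤ) * x = 2 * Real.pi / l * m * x -
    2 * Real.pi / l * n * x - 2 * Real.pi / l * N * x := by push_cast; ring
  have e2 : 2 * Real.pi / l * (m - n + N : ℤ) * x = 2 * Real.pi / l * m * x -
    2 * Real.pi / l * n * x + 2 * Real.pi / l * N * x := by push_cast; ring
  have e3 : 2 * Real.pi / l * (m + n - N : ℤ) * x = 2 * Real.pi / l * m * x +
    2 * Real.pi / l * n * x - 2 * Real.pi / l * N * x := by push_cast; ring
  have e4 : 2 * Real.pi / l * (m + n + N : ℤ) * x = 2 * Real.pi / l * m * x +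
    2 * Real.pi / l * n * x + 2 * Real.pi / l * N * x := by push_cast; ring
  rw [e1, e2, e3, e4]
  linarith

theorem integral_cos_four (m n N : ℤ) (c₁ c₂ c₃ c₄ : ℝ) :
    ∫ x in (0 : ℝ)..l, (c₁ / 4 * Real.cos (2 * Real.pi / l * (m - n - N : ℤ) * x) +
      c₂ / 4 * Real.cos (2 * Real.pi / l * (m - n + N : ℤ) * x) +
      c₃ / 4 * Real.cos (2 * Real.pi / l * (m + n - N : ℤ) * x) +
      c₄ / 4 * Real.cos (2 * Real.pi / l * (m + n + N : ℤ) * x)) =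
    c₁ / 4 * (if m - n - N = 0 then l else 0) + c₂ / 4 * (if m - n + N = 0 then l else 0) +
      c₃ / 4 * (if m + n - N = 0 then l else 0) + c₄ / 4 * (if m + n + N = 0 then l else 0) := by
  have hi : ∀ (c : ℝ) (j : ℤ), IntervalIntegrable
      (fun x => c * Real.cos (2 * Real.pi / l * j * x)) MeasureTheory.volume 0 l := fun c j => by
    apply Continuous.intervalIntegrable; fun_prop
  rw [intervalIntegral.integral_add (((hi _ _).add (hi _ _)).add (hi _ _)) (hi _ _),
    intervalIntegral.integral_add ((hi _ _).add (hi _ _)) (hi _ _),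
    intervalIntegral.integral_add (hi _ _) (hi _ _)]
  simp only [intervalIntegral.integral_const_mul, integral_cos_int hl]

variable {m n N : ℕ} (hN : 1 ≤ N) (hm : m ≤ N) (hn : n ≤ N)
include hN hm hn

/-- The product splits into cosines of the frequencies m ± n ± 2N. For m, n ≤ N and N ≥ 1 only m + n
- 2N can be zero, and only if m = n = N. The negative sign here, against the positive one for three
cosines, is what later turns a² - b² into a sum of squares. -/
theorem integral_sin_sin_cos :
    ∫ x in (0 : ℝ)..l, sinMode l m x * sinMode l n x * cosMode l (2 * N) x =
      if m = N ∧ n = N then -(l / 4) else 0 := by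
  rw [intervalIntegral.integral_congr fun x _ => cos_four (l := l) x m n (2 * N : ℕ) _
    1 1 (-1) (-1) ?_, integral_cos_four hl]
  · push_cast
    split_ifs <;> first | omega | ring
  · simp only [sinMode, cosMode, Int.cast_natCast, Real.cos_add, Real.cos_sub, Real.sin_add,
      Real.sin_sub]
    ring

theorem integral_cos_cos_cos :
    ∫ x in (0 : ℝ)..l, cosMode l m x * cosMode l n x * cosMode l (2 * N) x =
      if m = N ∧ n = N then l / 4 else 0 := by
  rw [intervalIntegral.integral_congr fun x _ => cos_four (l := l) x m n (2 * N : ℕ) _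
    1 1 1 1 ?_, integral_cos_four hl]
  · push_cast
    split_ifs <;> first | omega | ring
  · simp only [cosMode, Int.cast_natCast, Real.cos_add, Real.cos_sub, Real.sin_add,
      Real.sin_sub]
    ring

theorem integral_sin_cos_sin :
    ∫ x in (0 : ℝ)..l, sinMode l m x * cosMode l n x * sinMode l (2 * N) x =
      if m = N ∧ n = N then l / 4 else 0 := by
  rw [intervalIntegral.integral_congr fun x _ => cos_four (l := l) x m n (2 * N : ℕ) _
    1 (-1) 1 (-1) ?_, integral_cos_four hl]
  · push_cast
    split_ifs <;> first | omega | ring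
  · simp only [sinMode, cosMode, Int.cast_natCast, Real.cos_add, Real.cos_sub, Real.sin_add,
      Real.sin_sub]
    ring

end Orthogonality

section Completeness

/-- Evenness disposes of the sine coefficients, so all Fourier coefficients vanish; their
summability is then trivial, and the Fourier series represents the continuous function pointwise. -/
theorem eq_zero_of_integral_cos {l : ℝ} (hl : 0 < l) {g : ℝ → ℝ} (hg : Continuous g)
    (hper : ∀ x, g (x + l) = g x) (heven : ∀ x, g (-x) = g x)
    (h : ∀ n, ∫ x in (0 : ℝ)..l, g x * cosMode l n x = 0) (x : ℝ) : g x = 0 := by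
  have : Fact (0 < l) := ⟨hl⟩
  have hp : Function.Periodic (fun x => (g x : ℂ)) l := fun x => by simp only [hper]
  let F : C(AddCircle l, ℂ) := ⟨hp.lift, (Complex.continuous_ofReal.comp hg).quotient_lift _⟩
  have hF : ∀ x : ℝ, F x = g x := fun x => hp.lift_coe x
  -- The substitution x ↦ l - x, with evenness and periodicity, changes the sign of the integral.
  have hS : ∀ j : ℤ, ∫ x in (0 : ℝ)..l, g x * Real.sin (2 * Real.pi / l * j * x) = 0 := by
    intro j
    have h1 := intervalIntegral.integral_comp_sub_left (a := 0) (b := l)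
      (fun x => g x * Real.sin (2 * Real.pi / l * j * x)) l
    have h2 : ∀ x, g (l - x) * Real.sin (2 * Real.pi / l * j * (l - x)) =
        -(g x * Real.sin (2 * Real.pi / l * j * x)) := fun x => by
      have e1 : g (l - x) = g x := by rw [← heven x, ← hper (-x)]; ring_nf
      have e2 : 2 * Real.pi / l * j * (l - x) =
        -(2 * Real.pi / l * j * x) + j * (2 * Real.pi) := by field_simp; ring
      rw [e1, e2, Real.sin_add_int_mul_two_pi, Real.sin_neg]
      ring
    simp only [h2, intervalIntegral.integral_neg, sub_self, sub_zero] at h1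
    linarith
  have hC : ∀ j : ℤ, ∫ x in (0 : ℝ)..l, g x * Real.cos (2 * Real.pi / l * j * x) = 0 := by
    intro j
    refine Eq.trans ?_ (h j.natAbs)
    refine intervalIntegral.integral_congr fun x _ => ?_
    simp only [cosMode]
    congr 1
    rcases Int.natAbs_eq j with hj | hj
    · conv_lhs => rw [hj]
      simp
    · conv_lhs => rw [hj]
      rw [← Real.cos_neg]
      simp
  have hcoef : fourierCoeff F = fun _ => 0 := by
    funext j
    rw [fourierCoeff_eq_intervalIntegral F j 0, zero_add]
    have e : ∀ x : ℝ, fourier (-j) (x : AddCircle l) • F x =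
        ((g x * Real.cos (2 * Real.pi / l * j * x) : ℝ) : ℂ) -
          ((g x * Real.sin (2 * Real.pi / l * j * x) : ℝ) : ℂ) * Complex.I := fun x => by
      have : 2 * (Real.pi : ℂ) * Complex.I * ((-j : ℤ) : ℂ) * (x : ℂ) / (l : ℂ) =
          ((-(2 * Real.pi / l * j * x) : ℝ) : ℂ) * Complex.I := by push_cast; ring
      rw [hF, fourier_coe_apply, this, Complex.exp_mul_I, ← Complex.ofReal_cos,
        ← Complex.ofReal_sin, Real.cos_neg, Real.sin_neg]
      push_cast
      rw [smul_eq_mul]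
      ring
    simp only [e]
    rw [intervalIntegral.integral_sub, intervalIntegral.integral_mul_const,
      intervalIntegral.integral_ofReal, intervalIntegral.integral_ofReal, hC, hS]
    · simp
    · apply Continuous.intervalIntegrable; fun_prop
    · apply Continuous.intervalIntegrable; fun_prop
  have hsum := has_pointwise_sum_fourier_series_of_summable (f := F)
    (by rw [hcoef]; exact summable_zero) (x : AddCircle l)
  rw [hcoef, hF] at hsum
  simp only [zero_smul] at hsum
  exact_mod_cast hsum.unique hasSum_zero

variable {l₁ l₂ : ℝ} (hl₁ : 0 < l₁) (hl₂ : 0 < l₂) {f : R3 → ℝ} (hf : Continuous f)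
  (hper : IsPeriodic l₁ l₂ f) (hsymm : IsSymmScalar f) {z : ℝ}
include hl₁ hl₂ hf hper hsymm

omit hl₁ hl₂ hf hper in
theorem symm_apply (x y : ℝ) : f ![-x, y, z] = f ![x, y, z] ∧ f ![x, -y, z] = f ![x, y, z] := by
  constructor
  · rw [← hsymm.1 ![x, y, z]]
    congr 1
    ext i; fin_cases i <;> simp [reflect]
  · rw [← hsymm.2 ![x, y, z]]
    congr 1
    ext i; fin_cases i <;> simp [reflect]

theorem integral_mul_cos_eq_zero_of_moment {n : ℕ}
    (h : ∀ m, moment l₁ l₂ f (cosMode l₁ m) (cosMode l₂ n) z = 0) (x : ℝ) :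
    ∫ y in (0 : ℝ)..l₂, f ![x, y, z] * cosMode l₂ n y = 0 := by
  have c := continuous_moment_inner (a := fun _ => 1) hf continuous_const (continuous_cosMode l₂ n) l₂
  simp only [mul_one] at c
  refine eq_zero_of_integral_cos hl₁ (g := fun x => ∫ y in (0 : ℝ)..l₂, f ![x, y, z] * cosMode l₂ n y)
    (c.comp (f := fun x => (z, x)) (by fun_prop)) (fun x => ?_) (fun x => ?_) (fun m => ?_) x
  · simp only [hper.apply_zero]
  · simp only [(symm_apply hsymm _ _).1]
  · refine Eq.trans ?_ (h m)
    rw [moment]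
    simp only [← intervalIntegral.integral_mul_const]
    refine intervalIntegral.integral_congr fun x _ => intervalIntegral.integral_congr fun y _ => ?_
    ring

/-- Completeness of the products of cosines. -/
theorem eq_zero_of_moment
    (h : ∀ m n, moment l₁ l₂ f (cosMode l₁ m) (cosMode l₂ n) z = 0) (x y : ℝ) :
    f ![x, y, z] = 0 := by
  refine eq_zero_of_integral_cos hl₂ (g := fun y => f ![x, y, z])
    (hf.comp (f := fun y => ![x, y, z]) (by fun_prop)) (fun y => hper.apply_one x y z)
    (fun y => (symm_apply hsymm _ _).2) (fun n => ?_) y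
  exact integral_mul_cos_eq_zero_of_moment hl₁ hl₂ hf hper hsymm (fun m => h m n) x

/-- After subtraction of its mean over x₂, the function of x₂ has no cosine coefficients left. -/
theorem eq_of_moment
    (h : ∀ m n, 1 ≤ n → moment l₁ l₂ f (cosMode l₁ m) (cosMode l₂ n) z = 0) (x y : ℝ) :
    f ![x, y, z] = f ![x, 0, z] := by
  have cf : Continuous fun y => f ![x, y, z] := hf.comp (f := fun y => ![x, y, z]) (by fun_prop)
  set A := (∫ y in (0 : ℝ)..l₂, f ![x, y, z]) / l₂ with hA
  have key : ∀ y, f ![x, y, z] - A = 0 := by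
    refine eq_zero_of_integral_cos hl₂ (cf.sub continuous_const) (fun y => ?_) (fun y => ?_)
      (fun n => ?_)
    · simp only [hper.apply_one]
    · simp only [(symm_apply hsymm _ _).2]
    · have c1 : Continuous fun y => f ![x, y, z] * cosMode l₂ n y :=
        cf.mul (continuous_cosMode l₂ n)
      have c2 : Continuous fun y => A * cosMode l₂ n y :=
        continuous_const.mul (continuous_cosMode l₂ n)
      simp only [sub_mul]
      rw [intervalIntegral.integral_sub (c1.intervalIntegrable _ _) (c2.intervalIntegrable _ _),
        intervalIntegral.integral_const_mul]
      have h0 := integral_cos_mul_cos hl₂ n 0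
      simp only [cosMode, CharP.cast_eq_zero, mul_zero, zero_mul, Real.cos_zero, mul_one] at h0
      rcases Nat.eq_zero_or_pos n with rfl | hn
      · simp [cosMode, hA, hl₂.ne']
      · rw [integral_mul_cos_eq_zero_of_moment hl₁ hl₂ hf hper hsymm (fun m => h m n hn) x]
        simp only [cosMode]
        rw [h0, if_neg (by omega)]
        ring
  rw [sub_eq_zero.1 (key y), sub_eq_zero.1 (key 0)]

end Completeness

section FiniteSum

variable {l₁ l₂ : ℝ}

/-- The squared norm `∬ cos² cos²`. -/
noncomputable def modeNorm (l₁ l₂ : ℝ) (q : ℕ × ℕ) : ℝ :=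
  (if q.1 = 0 then l₁ else l₁ / 2) * (if q.2 = 0 then l₂ else l₂ / 2)

theorem modeNorm_pos (hl₁ : 0 < l₁) (hl₂ : 0 < l₂) (q : ℕ × ℕ) : 0 < modeNorm l₁ l₂ q := by
  unfold modeNorm
  split_ifs <;> positivity

theorem moment_modes (hl₁ : 0 < l₁) (hl₂ : 0 < l₂) (q : ℕ × ℕ) (m n : ℕ) (z : ℝ) :
    moment l₁ l₂ (fun x => cosMode l₁ q.1 (x 0) * cosMode l₂ q.2 (x 1)) (cosMode l₁ m)
      (cosMode l₂ n) z = if q = (m, n) then modeNorm l₁ l₂ q else 0 := by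
  have e : ∀ x y, cosMode l₁ q.1 ((![x, y, z] : R3) 0) * cosMode l₂ q.2 ((![x, y, z] : R3) 1) *
      cosMode l₁ m x * cosMode l₂ n y = (cosMode l₁ q.1 x * cosMode l₁ m x) *
        (cosMode l₂ q.2 y * cosMode l₂ n y) := fun x y => by simp; ring
  simp only [moment, e, intervalIntegral.integral_const_mul, intervalIntegral.integral_mul_const,
    integral_cos_mul_cos hl₁, integral_cos_mul_cos hl₂, modeNorm, Prod.ext_iff]
  split_ifs <;> simp_all

theorem moment_zero (a b : ℝ → ℝ) (z : ℝ) : moment l₁ l₂ (fun _ => 0) a b z = 0 := by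
  simp [moment]

theorem moment_const_mul {f : R3 → ℝ} {a b : ℝ → ℝ} (c z : ℝ) :
    moment l₁ l₂ (fun x => c * f x) a b z = c * moment l₁ l₂ f a b z :=
  moment_vertical_mul (fun _ => c) z

theorem moment_sum {ι : Type*} (s : Finset ι) {f : ι → R3 → ℝ} {a b : ℝ → ℝ}
    (hf : ∀ i, Continuous (f i)) (ha : Continuous a) (hb : Continuous b) (z : ℝ) :
    moment l₁ l₂ (fun x => ∑ i ∈ s, f i x) a b z = ∑ i ∈ s, moment l₁ l₂ (f i) a b z := by
  classical
  induction s using Finset.induction_on with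
  | empty => simp [moment_zero]
  | insert i s hi ih =>
    simp only [Finset.sum_insert hi]
    rw [moment_add (hf i) (continuous_finsetSum s fun i _ => hf i) ha hb, ih]

/-- A function with finitely many Fourier modes is their sum. -/
theorem eq_sum_of_moment (hl₁ : 0 < l₁) (hl₂ : 0 < l₂) {f : R3 → ℝ} (hf : Continuous f)
    (hper : IsPeriodic l₁ l₂ f) (hsymm : IsSymmScalar f) {z : ℝ} (T : Finset (ℕ × ℕ))
    (h : ∀ q, q ∉ T → moment l₁ l₂ f (cosMode l₁ q.1) (cosMode l₂ q.2) z = 0) (x y : ℝ) :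
    f ![x, y, z] = ∑ q ∈ T, moment l₁ l₂ f (cosMode l₁ q.1) (cosMode l₂ q.2) z /
      modeNorm l₁ l₂ q * (cosMode l₁ q.1 x * cosMode l₂ q.2 y) := by
  set C : ℕ × ℕ → ℝ := fun q => -(moment l₁ l₂ f (cosMode l₁ q.1) (cosMode l₂ q.2) z /
    modeNorm l₁ l₂ q) with hC
  -- The difference of f and the claimed sum has no moments at all, so completeness applies to it.
  set G : R3 → ℝ := fun x => f x + ∑ q ∈ T, C q *
    (cosMode l₁ q.1 (x 0) * cosMode l₂ q.2 (x 1)) with hG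
  have cc : ∀ q : ℕ × ℕ, Continuous fun x : R3 => C q *
      (cosMode l₁ q.1 (x 0) * cosMode l₂ q.2 (x 1)) := fun q =>
    continuous_const.mul (((continuous_cosMode l₁ q.1).comp (continuous_apply 0)).mul
      ((continuous_cosMode l₂ q.2).comp (continuous_apply 1)))
  have cs : Continuous fun x : R3 => ∑ q ∈ T, C q *
    (cosMode l₁ q.1 (x 0) * cosMode l₂ q.2 (x 1)) := continuous_finsetSum T fun q _ => cc q
  have neg_arg : ∀ l (n : ℕ) x, cosMode l n (-x) = cosMode l n x := fun l n x => by
    rw [cosMode, mul_neg, Real.cos_neg, cosMode]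
  have key := eq_zero_of_moment (z := z) hl₁ hl₂ (f := G) (hf.add cs) ⟨fun x => ?_, fun x => ?_⟩
    ⟨fun x => ?_, fun x => ?_⟩ (fun m n => ?_) x y
  · simp only [hG, hC, neg_mul, Finset.sum_neg_distrib] at key
    simpa [add_neg_eq_zero] using key
  · simp only [hG, hper.1 x]
    simp [cosMode_add _ hl₁]
  · simp only [hG, hper.2 x]
    simp [cosMode_add _ hl₂]
  · simp only [hG, hsymm.1 x]
    simp [reflect, neg_arg]
  · simp only [hG, hsymm.2 x]
    simp [reflect, neg_arg]
  · rw [moment_add hf cs (continuous_cosMode l₁ m) (continuous_cosMode l₂ n),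
      moment_sum T cc (continuous_cosMode l₁ m) (continuous_cosMode l₂ n)]
    simp only [moment_const_mul, moment_modes hl₁ hl₂, mul_ite, mul_zero,
      Finset.sum_ite_eq', hC]
    split_ifs with hq
    · have := (modeNorm_pos hl₁ hl₂ (m, n)).ne'
      field_simp
      ring
    · rw [h (m, n) hq, add_zero]

end FiniteSum

end WaterWave

/-! ### The quadratic identity in terms of transverse and vertical momentum. -/

namespace WaterWave

variable {d l₁ l₂ : ℝ}

noncomputable section

/-- The transverse momentum `U u₂` of the linearized flow. -/
def transMom (hd : 0 < d) (U : ℝ → ℝ) (w : State d l₁ l₂) (x : R3) : ℝ := U (x 2) * vel hd 1 x w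

/-- The vertical momentum `U (u₃ + U ∂₁φ)` of the linearized flow. -/
def vertMom (hd : 0 < d) (U : ℝ → ℝ) (w : State d l₁ l₂) (x : R3) : ℝ :=
  U (x 2) * (vel hd 2 x w + U (x 2) * dphi d 0 x w)

end

section Quadratic

variable {U V : ℝ → ℝ} (hU : IsExtProfile d U V) {w : State d l₁ l₂}
include hU

theorem hasPartials_profile : HasPartials d l₁ l₂ (fun x => U (x 2)) (fun _ => 0) (fun _ => 0)
    (fun x => V (x 2)) :=
  HasPartials.of_vertical hU.cont_ext hU.cont_deriv_ext hU.hasDerivAt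

theorem hasPartials_transMom : HasPartials d l₁ l₂ (transMom hU.pos U w)
    (fun x => U (x 2) * dvel hU.pos 1 0 x w) (fun x => U (x 2) * dvel hU.pos 1 1 x w)
    (fun x => V (x 2) * vel hU.pos 1 x w + U (x 2) * dvel hU.pos 1 2 x w) :=
  ((hasPartials_profile hU).mul (hasPartials_vel hU.pos 1 w)).congr_fun (fun _ => rfl)
    (fun _ => by ring) (fun _ => by ring) (fun _ => by ring)

/-- Only the x₁-derivative is given explicitly, because the vertical momentum equation identifies it
with -∂₃℘; the other two are merely required to exist. -/
theorem exists_hasPartials_vertMom : ∃ b₁ b₂, HasPartials d l₁ l₂ (vertMom hU.pos U w)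
    (fun x => U (x 2) * dvel hU.pos 2 0 x w + U (x 2) ^ 2 * ddphi d 0 0 x w) b₁ b₂ :=
  ⟨_, _, ((hasPartials_profile hU).mul ((hasPartials_vel hU.pos 2 w).add
    ((hasPartials_profile hU).mul (hasPartials_dphi 0 w)))).congr_fun (fun _ => rfl)
    (fun _ => by ring) (fun _ => rfl) (fun _ => rfl)⟩

/-- The quadratic form in the momentum of the linearized flow that has to vanish if the flow is
the first-order term of a curve of solutions. -/
theorem LinearizedJet.integral_quadratic (hl₁ : 0 < l₁) (hl₂ : 0 < l₂)
    (h : LinearizedJet hU.pos U V w) {θ θ' θ'' θ''' s s' s'' : ℝ → ℝ}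
    (T : TestPair d l₂ θ θ' θ'' s s' s'') (T' : TestPair d l₂ θ' θ'' θ''' s s' s'')
    (hI : ∫ x in periodBox d l₁ l₂,
      (vel hU.pos 1 x w * (vel hU.pos 1 x w * (θ' (x 2) * s' (x 1)) +
          vel hU.pos 2 x w * (θ'' (x 2) * s (x 1))) -
        (vel hU.pos 2 x w + U (x 2) * dphi d 0 x w) *
          (vel hU.pos 1 x w * (θ (x 2) * s'' (x 1)) + vel hU.pos 2 x w * (θ' (x 2) * s' (x 1))) +
        prs hU.pos x w *
          (θ' (x 2) * s' (x 1) * dphi d 2 x w - θ'' (x 2) * s (x 1) * dphi d 1 x w)) = 0) :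
    ∫ x in periodBox d l₁ l₂, (U (x 2) ^ 2)⁻¹ *
      ((transMom hU.pos U w x ^ 2 - vertMom hU.pos U w x ^ 2) * (s' (x 1) * θ' (x 2)) +
        transMom hU.pos U w x * vertMom hU.pos U w x *
          (s (x 1) * θ'' (x 2) - s'' (x 1) * θ (x 2))) = 0 := by
  have hd := hU.pos
  obtain ⟨b₁, b₂, hb⟩ := exists_hasPartials_vertMom hU (w := w)
  have ha := hasPartials_transMom hU (w := w)
  have hp := hasPartials_prs hd w
  have hφ := hasPartials_phi w
  have h1 := T.hasPartials_one (l₁ := l₁)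
  -- The product θ''s occurs inside a flux and is differentiated once more, which is why a third
  -- derivative of θ is supplied.
  have h2 := T'.hasPartials_one (l₁ := l₁)
  have h3 : HasPartials d l₁ l₂ (fun x => θ' (x 2) * s' (x 1)) (fun _ => 0)
      (fun x => θ' (x 2) * s'' (x 1)) (fun x => θ'' (x 2) * s' (x 1)) :=
    ((HasPartials.of_vertical T.cont_θ' T.cont_θ'' fun z _ => T.hasDerivAt_θ' z).mul
      (HasPartials.of_transverse T.cont_s'' T.hasDerivAt_s' T.periodic_s')).congr_fun
      (fun _ => rfl) (fun _ => by ring) (fun _ => by ring) (fun _ => by ring)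
  have cU := hU.cont_ext
  have cφ := fun i => (hasPartials_dphi (d := d) i w).cont
  have cT := T.cont_θ
  have cT' := T.cont_θ'
  have cT'' := T.cont_θ''
  have cs := T.cont_s
  have cs' := T.cont_s'
  have cs'' := T.cont_s''
  have cv := fun i => (hasPartials_vel hd i w).cont
  have cp := hp.cont
  have ca := ha.cont
  have cb := hb.cont
  have cUi : Continuous fun x : R3 => (U (x 2) ^ 2)⁻¹ :=
    Continuous.inv₀ (by fun_prop) fun x => pow_ne_zero 2 (hU.ne_zero_ext _)
  -- The remainder after the substitution u₂ = a/U, u₃ = b/U - U ∂₁φ. By ∂₁a = -∂₂℘ and ∂₁b = -∂₃℘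
  -- it is the divergence of φ·(bθ's' - aθ''s, -℘θ''s, ℘θ's'), with no vertical flux at the boundary
  -- because θ' vanishes there.
  set R : R3 → ℝ := fun x => dphi d 0 x w * (vertMom hd U w x * (θ' (x 2) * s' (x 1)) -
    transMom hd U w x * (θ'' (x 2) * s (x 1))) +
    prs hd x w * (θ' (x 2) * s' (x 1) * dphi d 2 x w - θ'' (x 2) * s (x 1) * dphi d 1 x w)
    with hR
  have cφ0 := cφ 0
  have cφ1 := cφ 1
  have cφ2 := cφ 2
  have cv1 := cv 1
  have cv2 := cv 2
  have cR : Continuous R := by simp only [hR]; fun_prop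
  have hR0 : ∫ x in periodBox d l₁ l₂, R x = 0 := by
    refine integral_eq_zero_of_eq_divergence hd hl₁ hl₂
      (hφ.mul ((hb.mul h3).add ((ha.mul h2).const_mul (-1))))
      ((hφ.mul (hp.mul h2)).const_mul (-1)) (hφ.mul (hp.mul h3)) (fun x hx => ?_) cR
      (fun x hx => ?_)
    · have : θ' (x 2) = 0 := by rcases hx with hx | hx <;> rw [hx]; exacts [T.θ'_zero.1, T.θ'_zero.2]
      simp [this]
    · have hx' := domain_subset_closedDomain hx
      have e1 := h.momentum₁ x hx'
      have e2 := h.momentum₂ x hx'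
      simp only [hR]
      linear_combination ((1 + x 2 / d) * elv x w) * ((θ'' (x 2) * s (x 1)) * e1 -
        (θ' (x 2) * s' (x 1)) * e2)
  have key := MeasureTheory.integral_sub (integrableOn_periodBox (d := d) (l₁ := l₁) (l₂ := l₂)
    (f := fun x => vel hd 1 x w * (vel hd 1 x w * (θ' (x 2) * s' (x 1)) +
          vel hd 2 x w * (θ'' (x 2) * s (x 1))) -
        (vel hd 2 x w + U (x 2) * dphi d 0 x w) *
          (vel hd 1 x w * (θ (x 2) * s'' (x 1)) + vel hd 2 x w * (θ' (x 2) * s' (x 1))) +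
        prs hd x w *
          (θ' (x 2) * s' (x 1) * dphi d 2 x w - θ'' (x 2) * s (x 1) * dphi d 1 x w))
    (by fun_prop)) (integrableOn_periodBox (d := d) (l₁ := l₁) (l₂ := l₂) cR)
  rw [hI, hR0, sub_zero] at key
  refine Eq.trans (MeasureTheory.integral_congr_ae (Eventually.of_forall fun x => ?_)) key
  have hne := hU.ne_zero_ext (x 2)
  simp only [hR, transMom, vertMom]
  field_simp
  ring

end Quadratic

end WaterWave

/-! ### Integration by parts in the vertical variable, and the momenta as sums over pressure modes.
-/

namespace WaterWave

variable {d l₁ l₂ : ℝ}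

section OneDim

theorem eq_zero_of_integral_smooth_mul {a b : ℝ} {f : ℝ → ℝ} (hf : Continuous f)
    (h : ∀ θ : ℝ → ℝ, ContDiff ℝ (⊤ : ℕ∞) θ → tsupport θ ⊆ Ioo a b → ∫ z in a..b, θ z * f z = 0) :
    ∀ z ∈ Ioo a b, f z = 0 := by
  have key := isOpen_Ioo.ae_eq_zero_of_integral_contDiff_smul_eq_zero (μ := MeasureTheory.volume)
    (U := Ioo a b) (f := f) (hf.locallyIntegrable.locallyIntegrableOn _) (fun θ hθ _ hsub => by
      rw [← h θ hθ hsub, intervalIntegral.integral_eq_integral_of_support_subset]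
      · simp
      · intro z hz
        have : z ∈ Function.support θ := fun h0 => hz (by simp [h0])
        exact Ioo_subset_Ioc_self (hsub (subset_tsupport θ this)))
  have h2 : f =ᵐ[MeasureTheory.volume.restrict (Ioo a b)] fun _ => 0 :=
    (MeasureTheory.ae_restrict_iff' measurableSet_Ioo).2 key
  exact MeasureTheory.Measure.eqOn_open_of_ae_eq h2 isOpen_Ioo hf.continuousOn continuousOn_const

theorem eq_of_hasDerivAt_eq {f g f' : ℝ → ℝ} (hf : ∀ t, HasDerivAt f (f' t) t)
    (hg : ∀ t, HasDerivAt g (f' t) t) (h0 : f 0 = g 0) (t : ℝ) : f t = g t := by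
  have h : ∀ t, HasDerivAt (fun t => f t - g t) 0 t := fun t =>
    ((hf t).fun_sub (hg t)).congr_deriv (sub_self _)
  have := is_const_of_deriv_eq_zero (fun t => (h t).differentiableAt) (fun t => (h t).deriv) t 0
  simp only [h0, sub_self] at this
  exact sub_eq_zero.1 this

variable {U V : ℝ → ℝ} (hU : IsExtProfile d U V)
include hU

/-- The functions B, D, M stand for the sums of c²/k₁², e²/k₁², ce/k₁², and C, M₂ for those of c²,
ce; the derivative hypotheses are the mode equation. The given integrand plus 2θ(V/U³)(D + C - K²B)
is the exact derivative of (θ'M + θ(D + K²B - C))/U², which vanishes at both ends. -/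
theorem integral_mul_flux_eq_zero {K : ℝ} {B D M C M₂ θ θ' θ'' : ℝ → ℝ}
    (cB : Continuous B) (cD : Continuous D) (cM : Continuous M) (cC : Continuous C)
    (hB : ∀ z ∈ Ioo (-d) 0, HasDerivAt B (2 * M z) z)
    (hC : ∀ z ∈ Ioo (-d) 0, HasDerivAt C (2 * M₂ z) z)
    (hM : ∀ z ∈ Ioo (-d) 0, HasDerivAt M (D z + 2 * (V z / U z) * M z + K ^ 2 * B z + C z) z)
    (hD : ∀ z ∈ Ioo (-d) 0,
      HasDerivAt D (4 * (V z / U z) * D z + 2 * M₂ z + 2 * K ^ 2 * M z) z)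
    (hθ : ∀ z, HasDerivAt θ (θ' z) z) (hθ' : ∀ z, HasDerivAt θ' (θ'' z) z) (cθ'' : Continuous θ'')
    (h0 : θ 0 = 0 ∧ θ (-d) = 0) (h0' : θ' 0 = 0 ∧ θ' (-d) = 0)
    (h : ∫ z in (-d)..0, (U z ^ 2)⁻¹ * (2 * θ' z * (K ^ 2 * B z + D z) +
      (θ'' z + 4 * K ^ 2 * θ z) * M z) = 0) :
    ∫ z in (-d)..0, θ z * (V z / U z ^ 3 * (D z + C z - K ^ 2 * B z)) = 0 := by
  have cU := hU.cont_ext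
  have cV := hU.cont_deriv_ext
  have cθ : Continuous θ := continuous_iff_continuousAt.2 fun z => (hθ z).continuousAt
  have cθ' : Continuous θ' := continuous_iff_continuousAt.2 fun z => (hθ' z).continuousAt
  have cW : Continuous fun z => (U z ^ 2)⁻¹ :=
    Continuous.inv₀ (by fun_prop) fun z => pow_ne_zero 2 (hU.ne_zero_ext z)
  have cW3 : Continuous fun z => V z / U z ^ 3 :=
    cV.div (by fun_prop) fun z => pow_ne_zero 3 (hU.ne_zero_ext z)
  have c1 : Continuous fun z => (U z ^ 2)⁻¹ * (2 * θ' z * (K ^ 2 * B z + D z) +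
      (θ'' z + 4 * K ^ 2 * θ z) * M z) := by fun_prop
  have c2 : Continuous fun z => 2 * (θ z * (V z / U z ^ 3 * (D z + C z - K ^ 2 * B z))) := by
    fun_prop
  have hderiv : ∀ z ∈ Ioo (-d) 0, HasDerivAt
      (fun z => (θ' z * M z + θ z * (D z + K ^ 2 * B z - C z)) / U z ^ 2)
      ((U z ^ 2)⁻¹ * (2 * θ' z * (K ^ 2 * B z + D z) + (θ'' z + 4 * K ^ 2 * θ z) * M z) +
        2 * (θ z * (V z / U z ^ 3 * (D z + C z - K ^ 2 * B z)))) z := by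
    intro z hz
    have hne := hU.ne_zero_ext z
    refine ((((hθ' z).fun_mul (hM z hz)).fun_add ((hθ z).fun_mul (((hD z hz).fun_add
      ((hB z hz).const_mul (K ^ 2))).fun_sub (hC z hz)))).fun_div ((hU.hasDerivAt z hz).fun_pow 2)
        (pow_ne_zero 2 hne)).congr_deriv ?_
    push_cast
    field_simp
    ring
  have hint := intervalIntegral.integral_eq_sub_of_hasDerivAt_of_le (by linarith [hU.pos])
    (Continuous.continuousOn (by
      refine Continuous.div (by fun_prop) (by fun_prop) fun z => pow_ne_zero 2 (hU.ne_zero_ext z)))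
    hderiv ((c1.add c2).intervalIntegrable _ _)
  rw [intervalIntegral.integral_add (c1.intervalIntegrable _ _) (c2.intervalIntegrable _ _), h,
    intervalIntegral.integral_const_mul, h0.1, h0.2, h0'.1, h0'.2] at hint
  simpa using hint

end OneDim

section Expansion

variable {U V : ℝ → ℝ} (hU : IsExtProfile d U V) {w : State d l₁ l₂}

/-- The wave number of the index `n` in a direction of period `l`. -/
noncomputable def waveNumber (l : ℝ) (n : ℕ) : ℝ := 2 * Real.pi / l * n

theorem waveNumber_pos {l : ℝ} (hl : 0 < l) {n : ℕ} (hn : n ≠ 0) : 0 < waveNumber l n := by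
  have := Real.pi_pos
  have : (0 : ℝ) < n := by exact_mod_cast Nat.pos_of_ne_zero hn
  unfold waveNumber
  positivity

noncomputable section

/-- The normalized pressure modes. -/
def prsCoef (hd : 0 < d) (w : State d l₁ l₂) (q : ℕ × ℕ) (z : ℝ) : ℝ :=
  prsMode hd q.1 q.2 w z / modeNorm l₁ l₂ q

/-- The normalized modes of `∂₃℘`. -/
def dprsCoef (hd : 0 < d) (w : State d l₁ l₂) (q : ℕ × ℕ) (z : ℝ) : ℝ :=
  dprsMode hd q.1 q.2 w z / modeNorm l₁ l₂ q

end

theorem continuous_prsCoef (hd : 0 < d) (q : ℕ × ℕ) : Continuous (prsCoef hd w q) :=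
  (continuous_moment (hasPartials_prs hd w).cont (continuous_cosMode _ _)
    (continuous_cosMode _ _)).div_const _

theorem continuous_dprsCoef (hd : 0 < d) (q : ℕ × ℕ) : Continuous (dprsCoef hd w q) :=
  (continuous_moment (hasPartials_prs hd w).cont₂ (continuous_cosMode _ _)
    (continuous_cosMode _ _)).div_const _

theorem isSymmScalar_prs (hd : 0 < d) : IsSymmScalar fun x => prs hd x w :=
  ⟨fun x => (prs_reflect hd x w).1, fun x => (prs_reflect hd x w).2⟩

theorem isSymmScalar_elv : IsSymmScalar fun x : R3 => elv x w :=
  ⟨fun x => (elv_reflect x w).1, fun x => (elv_reflect x w).2⟩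

/-- η is even in x₁. -/
theorem dphi_zero_axis (w : State d l₁ l₂) (y : ℝ) {z : ℝ} (hz : z ∈ Ioo (-d) 0) :
    dphi d 0 ![0, y, z] w = 0 := by
  have h := (hasPartials_phi (d := d) w).hasDerivAt₀ hz 0 y
  have hs : ∀ t, elv ![-t, y, z] w = elv ![t, y, z] w := fun t =>
    (symm_apply (isSymmScalar_elv (w := w)) t y).1
  have h2 := HasDerivAt.scomp (0 : ℝ) (g₁ := fun t : ℝ => (1 + (![t, y, z] : R3) 2 / d) *
    elv ![t, y, z] w) (by simpa using h) (hasDerivAt_neg (0 : ℝ))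
  have h3 : (fun t : ℝ => (1 + (![t, y, z] : R3) 2 / d) * elv ![t, y, z] w) ∘ Neg.neg =
      fun t : ℝ => (1 + (![t, y, z] : R3) 2 / d) * elv ![t, y, z] w := by
    funext t; simp [hs]
  rw [h3] at h2
  have := h.unique h2
  simp at this
  linarith

theorem vec_eq (x : R3) : ![x 0, x 1, x 2] = x := by
  ext i; fin_cases i <;> rfl

variable {T : Finset (ℕ × ℕ)} (hl₁ : 0 < l₁) (hl₂ : 0 < l₂) (hT : ∀ q ∈ T, q.1 ≠ 0)
  (hsupp : ∀ q : ℕ × ℕ, q ≠ 0 → q ∉ T → ∀ z ∈ Icc (-d) 0, prsMode hU.pos q.1 q.2 w z = 0)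
include hl₁ hl₂ hT hsupp

theorem prs_expansion {z : ℝ} (hz : z ∈ Icc (-d) 0) (x y : ℝ) :
    prs hU.pos ![x, y, z] w = prsCoef hU.pos w 0 z + ∑ q ∈ T, prsCoef hU.pos w q z *
      (cosMode l₁ q.1 x * cosMode l₂ q.2 y) := by
  have h0 : (0 : ℕ × ℕ) ∉ T := fun h => hT 0 h rfl
  rw [eq_sum_of_moment hl₁ hl₂ (hasPartials_prs hU.pos w).cont
    (hasPartials_prs hU.pos w).periodic (isSymmScalar_prs hU.pos) (insert 0 T)
    (fun q hq => ?_) x y, Finset.sum_insert h0]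
  · simp [cosMode, prsCoef, prsMode]
  · rw [Finset.mem_insert, not_or] at hq
    exact hsupp q hq.1 hq.2 z hz

theorem dprs_one_expansion {z : ℝ} (hz : z ∈ Ioo (-d) 0) (x y : ℝ) :
    dprs hU.pos 1 ![x, y, z] w = -∑ q ∈ T, waveNumber l₂ q.2 * prsCoef hU.pos w q z *
      (cosMode l₁ q.1 x * sinMode l₂ q.2 y) := by
  have h1 := (hasPartials_prs hU.pos w).hasDerivAt₁ hz x y
  simp only [prs_expansion hU hl₁ hl₂ hT hsupp (Ioo_subset_Icc_self hz)] at h1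
  have h2 := (HasDerivAt.fun_sum (u := T) fun q _ => ((hasDerivAt_cosMode l₂ q.2 y).const_mul
    (cosMode l₁ q.1 x)).const_mul (prsCoef hU.pos w q z)).const_add (prsCoef hU.pos w 0 z)
  rw [h1.unique h2, ← Finset.sum_neg_distrib]
  refine Finset.sum_congr rfl fun q _ => ?_
  rw [waveNumber]
  ring

theorem dprs_two_expansion (h : LinearizedJet hU.pos U V w) {z : ℝ} (hz : z ∈ Ioo (-d) 0)
    (x y : ℝ) :
    dprs hU.pos 2 ![x, y, z] w = ∑ q ∈ T, dprsCoef hU.pos w q z *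
      (cosMode l₁ q.1 x * cosMode l₂ q.2 y) := by
  have h1 := (hasPartials_prs hU.pos w).hasDerivAt₂ hz x y
  have hev : (fun t => prsCoef hU.pos w 0 t + ∑ q ∈ T, prsCoef hU.pos w q t *
      (cosMode l₁ q.1 x * cosMode l₂ q.2 y)) =ᶠ[𝓝 z] fun t => prs hU.pos ![x, y, t] w := by
    filter_upwards [Icc_mem_nhds hz.1 hz.2] with t ht
    rw [prs_expansion hU hl₁ hl₂ hT hsupp ht]
  have hd : ∀ q, HasDerivAt (prsCoef hU.pos w q) (dprsCoef hU.pos w q z) z := fun q =>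
    ((h.isMode hl₁ hl₂ hU q.1 q.2).1.hasDerivAt z hz).div_const _
  have h2 := (hd 0).fun_add (HasDerivAt.fun_sum (u := T) fun q _ =>
    (hd q).mul_const (cosMode l₁ q.1 x * cosMode l₂ q.2 y))
  -- The horizontal mean of the pressure does not depend on the depth.
  have h0 : dprsCoef hU.pos w 0 z = 0 := by
    have := ((h.isMode hl₁ hl₂ hU 0 0).2.2 rfl z (Ioo_subset_Icc_self hz)).1
    simp only [dprsCoef, Prod.fst_zero, Prod.snd_zero, this, zero_div]
  rw [(h1.congr_of_eventuallyEq hev).unique h2, h0, zero_add]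

/-- Both sides vanish at x₁ = 0, the left one because u₂ is odd in x₁, and both have the
x₁-derivative -∂₂℘. Integration in x₁ divides by k₁, which is where `hT` is indispensable. -/
theorem transMom_expansion (h : LinearizedJet hU.pos U V w) {x : R3} (hx : x ∈ closedDomain d) :
    transMom hU.pos U w x = ∑ q ∈ T, (waveNumber l₂ q.2 / waveNumber l₁ q.1 *
      prsCoef hU.pos w q (x 2)) * (sinMode l₁ q.1 (x 0) * sinMode l₂ q.2 (x 1)) := by
  have cq : ∀ q : ℕ × ℕ, Continuous fun x : R3 => (waveNumber l₂ q.2 / waveNumber l₁ q.1 *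
      prsCoef hU.pos w q (x 2)) * (sinMode l₁ q.1 (x 0) * sinMode l₂ q.2 (x 1)) := fun q => by
    have c1 := continuous_prsCoef (w := w) hU.pos q
    have c2 := continuous_sinMode l₁ q.1
    have c3 := continuous_sinMode l₂ q.2
    fun_prop
  have cs := continuous_finsetSum T fun q _ => cq q
  refine eq_on_closedDomain hU.pos (hasPartials_transMom hU).cont cs (fun x hx => ?_) x hx
  set y := x 1
  set z := x 2
  have hz : z ∈ Ioo (-d) 0 := hx
  have key := eq_of_hasDerivAt_eq (g := fun t => ∑ q ∈ T, (waveNumber l₂ q.2 / waveNumber l₁ q.1 *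
      prsCoef hU.pos w q z) * (sinMode l₁ q.1 t * sinMode l₂ q.2 y))
    (fun t => (hasPartials_transMom hU (w := w)).hasDerivAt₀ hz t y) (fun t => ?_) ?_ (x 0)
  · rw [← vec_eq x]; exact key
  · refine (HasDerivAt.fun_sum (u := T) fun q _ => ((hasDerivAt_sinMode l₁ q.1 t).mul_const
      (sinMode l₂ q.2 y)).const_mul (waveNumber l₂ q.2 / waveNumber l₁ q.1 *
      prsCoef hU.pos w q z)).congr_deriv ?_
    have e := h.momentum₁ ![t, y, z] (domain_subset_closedDomain (by simpa [domain] using hz))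
    rw [dprs_one_expansion hU hl₁ hl₂ hT hsupp hz, add_neg_eq_zero] at e
    rw [e]
    refine Finset.sum_congr rfl fun q hq => ?_
    have := (waveNumber_pos hl₁ (hT q hq)).ne'
    rw [← waveNumber]
    field_simp
  · have := vel_one_reflect hU.pos ![0, y, z] w
    have e : reflect 0 ![0, y, z] = ![0, y, z] := by ext i; fin_cases i <;> simp [reflect]
    rw [e] at this
    have h0 : vel hU.pos 1 ![0, y, z] w = 0 := by linarith
    simp [transMom, h0, sinMode]

/-- The same argument with ∂₁b = -∂₃℘; at x₁ = 0 both u₃ and ∂₁φ vanish by parity. -/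
theorem vertMom_expansion (h : LinearizedJet hU.pos U V w) {x : R3} (hx : x ∈ closedDomain d) :
    vertMom hU.pos U w x = ∑ q ∈ T, (-1 / waveNumber l₁ q.1 *
      dprsCoef hU.pos w q (x 2)) * (sinMode l₁ q.1 (x 0) * cosMode l₂ q.2 (x 1)) := by
  obtain ⟨b₁, b₂, hb⟩ := exists_hasPartials_vertMom hU (w := w)
  have cq : ∀ q : ℕ × ℕ, Continuous fun x : R3 => (-1 / waveNumber l₁ q.1 *
      dprsCoef hU.pos w q (x 2)) * (sinMode l₁ q.1 (x 0) * cosMode l₂ q.2 (x 1)) := fun q => by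
    have c1 := continuous_dprsCoef (w := w) hU.pos q
    have c2 := continuous_sinMode l₁ q.1
    have c3 := continuous_cosMode l₂ q.2
    fun_prop
  have cs := continuous_finsetSum T fun q _ => cq q
  refine eq_on_closedDomain hU.pos hb.cont cs (fun x hx => ?_) x hx
  set y := x 1
  set z := x 2
  have hz : z ∈ Ioo (-d) 0 := hx
  have key := eq_of_hasDerivAt_eq (g := fun t => ∑ q ∈ T, (-1 / waveNumber l₁ q.1 *
      dprsCoef hU.pos w q z) * (sinMode l₁ q.1 t * cosMode l₂ q.2 y))
    (fun t => hb.hasDerivAt₀ hz t y) (fun t => ?_) ?_ (x 0)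
  · rw [← vec_eq x]; exact key
  · refine (HasDerivAt.fun_sum (u := T) fun q _ => ((hasDerivAt_sinMode l₁ q.1 t).mul_const
      (cosMode l₂ q.2 y)).const_mul (-1 / waveNumber l₁ q.1 *
      dprsCoef hU.pos w q z)).congr_deriv ?_
    have e := h.momentum₂ ![t, y, z] (domain_subset_closedDomain (by simpa [domain] using hz))
    rw [dprs_two_expansion hU hl₁ hl₂ hT hsupp h hz] at e
    rw [eq_neg_of_add_eq_zero_left e, ← Finset.sum_neg_distrib]
    refine Finset.sum_congr rfl fun q hq => ?_
    have := (waveNumber_pos hl₁ (hT q hq)).ne'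
    rw [← waveNumber]
    field_simp
  · have := vel_two_reflect hU.pos ![0, y, z] w
    have e : reflect 0 ![0, y, z] = ![0, y, z] := by ext i; fin_cases i <;> simp [reflect]
    rw [e] at this
    have h0 : vel hU.pos 2 ![0, y, z] w = 0 := by linarith
    simp [vertMom, h0, sinMode, dphi_zero_axis w y hz]

end Expansion

end WaterWave

/-! ### Projection of the quadratic identity onto the highest transverse frequency. -/

namespace WaterWave

variable {d l₁ l₂ : ℝ}

section Products

/-- The integral of a product of two horizontal Fourier sums, when only the modes with transverse
index `N` interact with the weight. -/
theorem integral_sum_mul_sum (hd : 0 < d) (hl₁ : 0 < l₁) (hl₂ : 0 < l₂) (T : Finset (ℕ × ℕ))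
    {X Y Y' α β : ℕ × ℕ → ℝ → ℝ} {s τ : ℝ → ℝ} (N : ℕ) (c₁ c₂ : ℝ)
    (cX : ∀ q, Continuous (X q)) (cY : ∀ q, Continuous (Y q)) (cY' : ∀ q, Continuous (Y' q))
    (cα : ∀ q, Continuous (α q)) (cβ : ∀ q, Continuous (β q)) (cs : Continuous s)
    (cτ : Continuous τ)
    (hX : ∀ q ∈ T, ∀ r ∈ T, ∫ x in (0 : ℝ)..l₁, X q x * X r x = if q.1 = r.1 then c₁ else 0)
    (hY : ∀ q ∈ T, ∀ r ∈ T, ∫ y in (0 : ℝ)..l₂, Y q y * Y' r y * s y =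
      if q.2 = N ∧ r.2 = N then c₂ else 0) :
    ∫ x in periodBox d l₁ l₂, (∑ q ∈ T, α q (x 2) * (X q (x 0) * Y q (x 1))) *
      (∑ q ∈ T, β q (x 2) * (X q (x 0) * Y' q (x 1))) * (s (x 1) * τ (x 2)) =
    c₁ * c₂ * ∫ z in (-d)..0, (∑ q ∈ T with q.2 = N, α q z * β q z) * τ z := by
  have e : ∀ x : R3, (∑ q ∈ T, α q (x 2) * (X q (x 0) * Y q (x 1))) *
      (∑ q ∈ T, β q (x 2) * (X q (x 0) * Y' q (x 1))) * (s (x 1) * τ (x 2)) =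
      ∑ q ∈ T, ∑ r ∈ T, (fun t => X q t * X r t) (x 0) * (fun t => Y q t * Y' r t * s t) (x 1) *
        (fun t => α q t * β r t * τ t) (x 2) := fun x => by
    rw [Finset.sum_mul_sum, Finset.sum_mul]
    refine Finset.sum_congr rfl fun q _ => ?_
    rw [Finset.sum_mul]
    refine Finset.sum_congr rfl fun r _ => ?_
    ring
  have hint : ∀ q r : ℕ × ℕ, MeasureTheory.Integrable (fun x : R3 => (fun t => X q t * X r t) (x 0) *
      (fun t => Y q t * Y' r t * s t) (x 1) * (fun t => α q t * β r t * τ t) (x 2))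
      (MeasureTheory.volume.restrict (periodBox d l₁ l₂)) := fun q r => by
    apply integrableOn_periodBox
    have h1 := cX q
    have h2 := cX r
    have h3 := cY q
    have h4 := cY' r
    have h5 := cα q
    have h6 := cβ r
    fun_prop
  simp only [e]
  rw [MeasureTheory.integral_finsetSum _ fun q _ =>
    MeasureTheory.integrable_finsetSum _ fun r _ => hint q r]
  simp only [Finset.sum_mul]
  rw [intervalIntegral.integral_finsetSum fun q _ => by
    have h5 := cα q
    have h6 := cβ q
    apply Continuous.intervalIntegrable
    fun_prop, Finset.sum_filter, Finset.mul_sum]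
  refine Finset.sum_congr rfl fun q hq => ?_
  rw [MeasureTheory.integral_finsetSum _ fun r _ => hint q r]
  have key : ∀ r ∈ T, ∫ x in periodBox d l₁ l₂, (fun t => X q t * X r t) (x 0) *
      (fun t => Y q t * Y' r t * s t) (x 1) * (fun t => α q t * β r t * τ t) (x 2) =
      (if q.1 = r.1 then c₁ else 0) * (if q.2 = N ∧ r.2 = N then c₂ else 0) *
        ∫ t in (-d)..0, α q t * β r t * τ t := fun r hr => by
    refine (integral_periodBox_mul hd hl₁ hl₂ (fun t => X q t * X r t)
      (fun t => Y q t * Y' r t * s t) fun t => α q t * β r t * τ t).trans ?_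
    rw [hX q hq r hr, hY q hq r hr]
  rw [Finset.sum_congr rfl key, Finset.sum_eq_single q]
  · by_cases h : q.2 = N <;> simp [h]
  · intro r _ hne
    by_cases h1 : q.1 = r.1
    · by_cases h2 : q.2 = N ∧ r.2 = N
      · exact absurd (Prod.ext h1 (h2.1.trans h2.2.symm)).symm hne
      · simp [h2]
    · simp [h1]
  · exact fun h => absurd hq h

end Products

section Vanishing

variable {U V : ℝ → ℝ} (hU : IsExtProfile d U V) {w : State d l₁ l₂}
  {T : Finset (ℕ × ℕ)} (hl₁ : 0 < l₁) (hl₂ : 0 < l₂) (hT : ∀ q ∈ T, q.1 ≠ 0)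
  (hsupp : ∀ q : ℕ × ℕ, q ≠ 0 → q ∉ T → ∀ z ∈ Icc (-d) 0, prsMode hU.pos q.1 q.2 w z = 0)
  (h : LinearizedJet hU.pos U V w)
include hl₁ hl₂ hT hsupp h

/-- The quadratic identity for the modes with the highest transverse frequency `N`. -/
theorem integral_top_modes {N : ℕ} (hN : 1 ≤ N) (hmax : ∀ q ∈ T, q.2 ≤ N) {θ θ' θ'' : ℝ → ℝ}
    (cθ : Continuous θ) (cθ' : Continuous θ') (cθ'' : Continuous θ'')
    (hI : ∫ x in periodBox d l₁ l₂, (U (x 2) ^ 2)⁻¹ *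
      ((transMom hU.pos U w x ^ 2 - vertMom hU.pos U w x ^ 2) *
          (2 * waveNumber l₂ N * cosMode l₂ (2 * N) (x 1) * θ' (x 2)) +
        transMom hU.pos U w x * vertMom hU.pos U w x *
          (sinMode l₂ (2 * N) (x 1) * θ'' (x 2) +
            (2 * waveNumber l₂ N) ^ 2 * sinMode l₂ (2 * N) (x 1) * θ (x 2))) = 0) :
    ∫ z in (-d)..0, (U z ^ 2)⁻¹ * (2 * θ' z * (waveNumber l₂ N ^ 2 *
        (∑ q ∈ T with q.2 = N, prsCoef hU.pos w q z ^ 2 / waveNumber l₁ q.1 ^ 2) +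
        (∑ q ∈ T with q.2 = N, dprsCoef hU.pos w q z ^ 2 / waveNumber l₁ q.1 ^ 2)) +
      (θ'' z + 4 * waveNumber l₂ N ^ 2 * θ z) *
        ∑ q ∈ T with q.2 = N, prsCoef hU.pos w q z * dprsCoef hU.pos w q z /
          waveNumber l₁ q.1 ^ 2) = 0 := by
  have hd := hU.pos
  set K := waveNumber l₂ N with hK
  have hKpos : 0 < K := waveNumber_pos hl₂ (by omega)
  have cU := hU.cont_ext
  have cW : Continuous fun z => (U z ^ 2)⁻¹ :=
    Continuous.inv₀ (by fun_prop) fun z => pow_ne_zero 2 (hU.ne_zero_ext z)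
  have cWx : Continuous fun x : R3 => (U (x 2) ^ 2)⁻¹ := cW.comp (continuous_apply 2)
  set α : ℕ × ℕ → ℝ → ℝ := fun q z => waveNumber l₂ q.2 / waveNumber l₁ q.1 * prsCoef hd w q z
    with hα
  set β : ℕ × ℕ → ℝ → ℝ := fun q z => -1 / waveNumber l₁ q.1 * dprsCoef hd w q z with hβ
  have cα : ∀ q, Continuous (α q) := fun q => continuous_const.mul (continuous_prsCoef hd q)
  have cβ : ∀ q, Continuous (β q) := fun q => continuous_const.mul (continuous_dprsCoef hd q)
  have cS₁ := continuous_sinMode l₁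
  have cS₂ := continuous_sinMode l₂
  have cC₂ := continuous_cosMode l₂
  have hX : ∀ q ∈ T, ∀ r ∈ T, ∫ x in (0 : ℝ)..l₁, sinMode l₁ q.1 x * sinMode l₁ r.1 x =
      if q.1 = r.1 then l₁ / 2 else 0 := fun q hq r _ => integral_sin_mul_sin hl₁ (hT q hq)
  -- Orthogonality in x₁ pairs equal first indices, and resonance with 2N in x₂ requires both second
  -- indices to be N, so only squares and products within a single mode remain. The coefficient
  -- -l₂/4 for a², against l₂/4 for b² and for ab, gives all three contributions the common factor
  -- -(l₂/4)K.
  have I1 := integral_sum_mul_sum hd hl₁ hl₂ T (X := fun q => sinMode l₁ q.1)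
    (Y := fun q => sinMode l₂ q.2) (Y' := fun q => sinMode l₂ q.2) (α := α) (β := α)
    (s := cosMode l₂ (2 * N)) (τ := fun z => 2 * K * ((U z ^ 2)⁻¹ * θ' z)) N (l₁ / 2) (-(l₂ / 4))
    (fun q => cS₁ _) (fun q => cS₂ _) (fun q => cS₂ _) cα cα (cC₂ _) (by fun_prop) hX
    (fun q hq r hr => integral_sin_sin_cos hl₂ hN (hmax q hq) (hmax r hr))
  have I2 := integral_sum_mul_sum hd hl₁ hl₂ T (X := fun q => sinMode l₁ q.1)
    (Y := fun q => cosMode l₂ q.2) (Y' := fun q => cosMode l₂ q.2) (α := β) (β := β)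
    (s := cosMode l₂ (2 * N)) (τ := fun z => 2 * K * ((U z ^ 2)⁻¹ * θ' z)) N (l₁ / 2) (l₂ / 4)
    (fun q => cS₁ _) (fun q => cC₂ _) (fun q => cC₂ _) cβ cβ (cC₂ _) (by fun_prop) hX
    (fun q hq r hr => integral_cos_cos_cos hl₂ hN (hmax q hq) (hmax r hr))
  have I3 := integral_sum_mul_sum hd hl₁ hl₂ T (X := fun q => sinMode l₁ q.1)
    (Y := fun q => sinMode l₂ q.2) (Y' := fun q => cosMode l₂ q.2) (α := α) (β := β)
    (s := sinMode l₂ (2 * N)) (τ := fun z => (U z ^ 2)⁻¹ * (θ'' z + 4 * K ^ 2 * θ z)) N (l₁ / 2)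
    (l₂ / 4)
    (fun q => cS₁ _) (fun q => cS₂ _) (fun q => cC₂ _) cα cβ (cS₂ _) (by fun_prop) hX
    (fun q hq r hr => integral_sin_cos_sin hl₂ hN (hmax q hq) (hmax r hr))
  set S₁ : ℝ → ℝ := fun z => ∑ q ∈ T with q.2 = N, prsCoef hd w q z ^ 2 / waveNumber l₁ q.1 ^ 2
    with hS₁
  set S₂ : ℝ → ℝ := fun z => ∑ q ∈ T with q.2 = N, dprsCoef hd w q z ^ 2 / waveNumber l₁ q.1 ^ 2
    with hS₂
  set S₃ : ℝ → ℝ := fun z => ∑ q ∈ T with q.2 = N, prsCoef hd w q z * dprsCoef hd w q z /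
    waveNumber l₁ q.1 ^ 2 with hS₃
  have e1 : ∀ z, ∑ q ∈ T with q.2 = N, α q z * α q z = K ^ 2 * S₁ z := fun z => by
    rw [hS₁, Finset.mul_sum]
    refine Finset.sum_congr rfl fun q hq => ?_
    simp only [hα, hK, (Finset.mem_filter.1 hq).2]
    ring
  have e2 : ∀ z, ∑ q ∈ T with q.2 = N, β q z * β q z = S₂ z := fun z => by
    refine Finset.sum_congr rfl fun q hq => ?_
    rw [hβ]
    ring
  have e3 : ∀ z, ∑ q ∈ T with q.2 = N, α q z * β q z = -K * S₃ z := fun z => by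
    rw [hS₃, Finset.mul_sum]
    refine Finset.sum_congr rfl fun q hq => ?_
    simp only [hα, hβ, hK, (Finset.mem_filter.1 hq).2]
    ring
  simp only [e1, e2, e3] at I1 I2 I3
  have cP := continuous_prsCoef (w := w) hd
  have cE := continuous_dprsCoef (w := w) hd
  have cS1 : Continuous S₁ := continuous_finsetSum _ fun q _ => ((cP q).pow 2).div_const _
  have cS2 : Continuous S₂ := continuous_finsetSum _ fun q _ => ((cE q).pow 2).div_const _
  have cS3 : Continuous S₃ := continuous_finsetSum _ fun q _ => ((cP q).mul (cE q)).div_const _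
  set A : R3 → ℝ := fun x => ∑ q ∈ T, α q (x 2) * (sinMode l₁ q.1 (x 0) * sinMode l₂ q.2 (x 1))
    with hA
  set B : R3 → ℝ := fun x => ∑ q ∈ T, β q (x 2) * (sinMode l₁ q.1 (x 0) * cosMode l₂ q.2 (x 1))
    with hB
  have cA : Continuous A := continuous_finsetSum _ fun q _ => by
    have := cα q
    have := cS₁ q.1
    have := cS₂ q.2
    fun_prop
  have cB : Continuous B := continuous_finsetSum _ fun q _ => by
    have := cβ q
    have := cS₁ q.1
    have := cC₂ q.2
    fun_prop
  have cc := cC₂ (2 * N)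
  have cs := cS₂ (2 * N)
  have i1 := integrableOn_periodBox (d := d) (l₁ := l₁) (l₂ := l₂) (f := fun x => A x * A x *
    (cosMode l₂ (2 * N) (x 1) * (2 * K * ((U (x 2) ^ 2)⁻¹ * θ' (x 2))))) (by fun_prop)
  have i2 := integrableOn_periodBox (d := d) (l₁ := l₁) (l₂ := l₂) (f := fun x => B x * B x *
    (cosMode l₂ (2 * N) (x 1) * (2 * K * ((U (x 2) ^ 2)⁻¹ * θ' (x 2))))) (by fun_prop)
  have i3 := integrableOn_periodBox (d := d) (l₁ := l₁) (l₂ := l₂) (f := fun x => A x * B x *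
    (sinMode l₂ (2 * N) (x 1) * ((U (x 2) ^ 2)⁻¹ * (θ'' (x 2) + 4 * K ^ 2 * θ (x 2)))))
    (by fun_prop)
  have htot : (∫ x in periodBox d l₁ l₂, A x * A x *
    (cosMode l₂ (2 * N) (x 1) * (2 * K * ((U (x 2) ^ 2)⁻¹ * θ' (x 2))))) -
    (∫ x in periodBox d l₁ l₂, B x * B x *
    (cosMode l₂ (2 * N) (x 1) * (2 * K * ((U (x 2) ^ 2)⁻¹ * θ' (x 2))))) +
    (∫ x in periodBox d l₁ l₂, A x * B x *
    (sinMode l₂ (2 * N) (x 1) * ((U (x 2) ^ 2)⁻¹ * (θ'' (x 2) + 4 * K ^ 2 * θ (x 2))))) = 0 := by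
    rw [← MeasureTheory.integral_sub i1 i2, ← MeasureTheory.integral_add (integrableOn_periodBox (by fun_prop)) i3, ← hI]
    refine MeasureTheory.setIntegral_congr_fun isCompact_periodBox.measurableSet fun x hx => ?_
    have hx' := periodBox_subset hx
    simp only [transMom_expansion hU hl₁ hl₂ hT hsupp h hx',
      vertMom_expansion hU hl₁ hl₂ hT hsupp h hx']
    simp only [hA, hB, hα, hβ]
    ring
  rw [I1, I2, I3, mul_assoc, mul_assoc, mul_assoc, ← mul_sub, ← mul_add,
    mul_eq_zero, or_iff_right (by positivity), ← intervalIntegral.integral_const_mul,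
    ← intervalIntegral.integral_const_mul, ← intervalIntegral.integral_const_mul,
    ← intervalIntegral.integral_sub (by apply Continuous.intervalIntegrable; fun_prop)
      (by apply Continuous.intervalIntegrable; fun_prop),
    ← intervalIntegral.integral_add (by apply Continuous.intervalIntegrable; fun_prop)
      (by apply Continuous.intervalIntegrable; fun_prop)] at htot
  have hc : -(l₂ / 4 * K) ≠ 0 := by
    have : 0 < l₂ / 4 * K := by positivity
    linarith
  refine by_contra fun hne => mul_ne_zero hc hne ?_
  refine Eq.trans ?_ htot
  rw [← intervalIntegral.integral_const_mul]
  refine intervalIntegral.integral_congr fun z _ => ?_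
  ring

end Vanishing

end WaterWave

/-! ### Vanishing of the pressure modes that depend on x₂. -/

namespace WaterWave

variable {d l₁ l₂ : ℝ}

theorem IsMode.div_const {U V : ℝ → ℝ} {κ : ℝ} {c e : ℝ → ℝ} (h : IsMode d U V κ c e) (r : ℝ) :
    IsMode d U V κ (fun z => c z / r) (fun z => e z / r) where
  cont := h.cont.div_const r
  cont_deriv := h.cont_deriv.div_const r
  hasDerivAt := fun z hz => (h.hasDerivAt z hz).div_const r
  hasDerivAt_deriv := fun z hz => ((h.hasDerivAt_deriv z hz).div_const r).congr_deriv (by ring)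
  bottom := by simp [h.bottom]

theorem testPair_sinMode (hl₂ : 0 < l₂) (N : ℕ) {θ : ℝ → ℝ} (hθ : ContDiff ℝ (⊤ : ℕ∞) θ)
    (hsub : tsupport θ ⊆ Ioo (-d) 0) :
    TestPair d l₂ θ (deriv θ) (deriv (deriv θ)) (sinMode l₂ (2 * N))
      (fun y => 2 * waveNumber l₂ N * cosMode l₂ (2 * N) y)
      (fun y => -((2 * waveNumber l₂ N) ^ 2 * sinMode l₂ (2 * N) y)) := by
  have h1 := contDiff_infty_iff_deriv.1 hθ
  have h2 := contDiff_infty_iff_deriv.1 h1.2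
  have hz : ∀ {f : ℝ → ℝ}, tsupport f ⊆ Ioo (-d) 0 → f 0 = 0 ∧ f (-d) = 0 := fun hf =>
    ⟨image_eq_zero_of_notMem_tsupport fun h => (hf h).2.false,
      image_eq_zero_of_notMem_tsupport fun h => (hf h).1.false⟩
  have hk : 2 * Real.pi / l₂ * ((2 * N : ℕ) : ℝ) = 2 * waveNumber l₂ N := by
    rw [waveNumber]; push_cast; ring
  exact {
    hasDerivAt_θ := fun z => (h1.1 z).hasDerivAt
    hasDerivAt_θ' := fun z => (h2.1 z).hasDerivAt
    cont_θ'' := h2.2.continuous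
    θ_zero := hz hsub
    θ'_zero := hz (tsupport_deriv_subset.trans hsub)
    hasDerivAt_s := fun y => (hasDerivAt_sinMode l₂ (2 * N) y).congr_deriv (by rw [hk])
    hasDerivAt_s' := fun y => ((hasDerivAt_cosMode l₂ (2 * N) y).const_mul
      (2 * waveNumber l₂ N)).congr_deriv (by rw [hk]; ring)
    cont_s'' := by have := continuous_sinMode l₂ (2 * N); fun_prop
    periodic_s := sinMode_add _ hl₂
    periodic_s' := fun y => by rw [cosMode_add _ hl₂] }

variable {U V : ℝ → ℝ} (hU : IsExtProfile d U V) {w : State d l₁ l₂} (hl₁ : 0 < l₁) (hl₂ : 0 < l₂)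
  (h : LinearizedJet hU.pos U V w)
include hl₁ hl₂ h

/-- The modes of the pressure with nonzero transverse frequency vanish, if there are finitely many
of them. -/
theorem prsMode_eq_zero
    (hflux : ∀ {θ θ' θ'' s s' s'' : ℝ → ℝ}, TestPair d l₂ θ θ' θ'' s s' s'' →
      ∫ x in periodBox d l₁ l₂,
      (vel hU.pos 1 x w * (vel hU.pos 1 x w * (θ' (x 2) * s' (x 1)) +
          vel hU.pos 2 x w * (θ'' (x 2) * s (x 1))) -
        (vel hU.pos 2 x w + U (x 2) * dphi d 0 x w) *
          (vel hU.pos 1 x w * (θ (x 2) * s'' (x 1)) + vel hU.pos 2 x w * (θ' (x 2) * s' (x 1))) +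
        prs hU.pos x w *
          (θ' (x 2) * s' (x 1) * dphi d 2 x w - θ'' (x 2) * s (x 1) * dphi d 1 x w)) = 0)
    (hV : ∃ z ∈ Ioo (-d) 0, V z ≠ 0)
    (hfin : {q : ℕ × ℕ | q ≠ 0 ∧ ∃ z ∈ Icc (-d) 0, prsMode hU.pos q.1 q.2 w z ≠ 0}.Finite)
    (hne : ∀ q : ℕ × ℕ, q ≠ 0 → (∃ z ∈ Icc (-d) 0, prsMode hU.pos q.1 q.2 w z ≠ 0) → q.1 ≠ 0)
    (m n : ℕ) (hn : 1 ≤ n) : ∀ z ∈ Icc (-d) 0, prsMode hU.pos m n w z = 0 := by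
  by_contra! hmn
  set T := hfin.toFinset with hTdef
  have hmem : ∀ q, q ∈ T ↔ q ≠ 0 ∧ ∃ z ∈ Icc (-d) 0, prsMode hU.pos q.1 q.2 w z ≠ 0 := fun q => by
    rw [hTdef, Finite.mem_toFinset, mem_ofPred_eq]
  have hT : ∀ q ∈ T, q.1 ≠ 0 := fun q hq => hne q ((hmem q).1 hq).1 ((hmem q).1 hq).2
  have hsupp : ∀ q : ℕ × ℕ, q ≠ 0 → q ∉ T → ∀ z ∈ Icc (-d) 0, prsMode hU.pos q.1 q.2 w z = 0 := by
    intro q hq hqT z hz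
    by_contra hc
    exact hqT ((hmem q).2 ⟨hq, z, hz, hc⟩)
  have hmnT : (m, n) ∈ T := (hmem _).2 ⟨fun h => by
    have := congrArg Prod.snd h
    simp only [Prod.snd_zero] at this
    omega, hmn⟩
  -- Finiteness of the set of modes is used for the existence of a highest transverse frequency.
  obtain ⟨q₀, hq₀, hmax⟩ := T.exists_max_image Prod.snd ⟨_, hmnT⟩
  set N := q₀.2 with hN
  have hN1 : 1 ≤ N := hn.trans (hmax _ hmnT)
  set K := waveNumber l₂ N with hK
  have hd := hU.pos
  set s := T.filter fun q => q.2 = N with hs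
  have hk : ∀ q ∈ s, 0 < waveNumber l₁ q.1 := fun q hq =>
    waveNumber_pos hl₁ (hT q (Finset.mem_filter.1 hq).1)
  have hmode : ∀ q ∈ s, IsMode d U V (waveNumber l₁ q.1 ^ 2 + K ^ 2) (prsCoef hd w q)
      (dprsCoef hd w q) := fun q hq => by
    have := (h.isMode hl₁ hl₂ hU q.1 q.2).1.div_const (modeNorm l₁ l₂ q)
    have e : (2 * Real.pi / l₂ * q.2) ^ 2 = K ^ 2 := by
      rw [hK, waveNumber, (Finset.mem_filter.1 hq).2]
    rw [e] at this
    exact this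
  have cP := continuous_prsCoef (w := w) hd
  have cE := continuous_dprsCoef (w := w) hd
  have cV := hU.cont_deriv_ext
  set B : ℝ → ℝ := fun z => ∑ q ∈ s, prsCoef hd w q z ^ 2 / waveNumber l₁ q.1 ^ 2 with hB
  set D : ℝ → ℝ := fun z => ∑ q ∈ s, dprsCoef hd w q z ^ 2 / waveNumber l₁ q.1 ^ 2 with hD
  set M : ℝ → ℝ := fun z => ∑ q ∈ s, prsCoef hd w q z * dprsCoef hd w q z / waveNumber l₁ q.1 ^ 2
    with hM
  set C : ℝ → ℝ := fun z => ∑ q ∈ s, prsCoef hd w q z ^ 2 with hC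
  set M₂ : ℝ → ℝ := fun z => ∑ q ∈ s, prsCoef hd w q z * dprsCoef hd w q z with hM₂
  have cB : Continuous B := continuous_finsetSum _ fun q _ => ((cP q).pow 2).div_const _
  have cD : Continuous D := continuous_finsetSum _ fun q _ => ((cE q).pow 2).div_const _
  have cM : Continuous M := continuous_finsetSum _ fun q _ => ((cP q).mul (cE q)).div_const _
  have cC : Continuous C := continuous_finsetSum _ fun q _ => (cP q).pow 2
  have cW3 : Continuous fun z => V z / U z ^ 3 :=
    cV.div (hU.cont_ext.pow 3) fun z => pow_ne_zero 3 (hU.ne_zero_ext z)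
  have key := eq_zero_of_integral_smooth_mul (a := -d) (b := 0)
    (f := fun z => V z / U z ^ 3 * (D z + C z - K ^ 2 * B z)) (by fun_prop) (fun θ hθ hsub => by
    -- The transverse profile has twice the highest frequency; the vertical one is an arbitrary test
    -- function, so the integral identities obtained below become pointwise.
    have T₁ := testPair_sinMode hl₂ N hθ hsub
    have T₂ := testPair_sinMode hl₂ N (contDiff_infty_iff_deriv.1 hθ).2
      (tsupport_deriv_subset.trans hsub)
    have hI := h.integral_quadratic hU hl₁ hl₂ T₁ T₂ (hflux T₁)
    have htop := integral_top_modes hU hl₁ hl₂ hT hsupp h hN1 hmax T₁.cont_θ T₁.cont_θ'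
      T₁.cont_θ'' (by simpa only [neg_mul, sub_neg_eq_add] using hI)
    refine integral_mul_flux_eq_zero hU (M₂ := M₂) cB cD cM cC (fun z hz => ?_) (fun z hz => ?_)
      (fun z hz => ?_) (fun z hz => ?_) T₁.hasDerivAt_θ T₁.hasDerivAt_θ' T₁.cont_θ'' T₁.θ_zero
      T₁.θ'_zero htop
    · refine (HasDerivAt.fun_sum fun q hq => (((hmode q hq).hasDerivAt z hz).fun_pow
        2).div_const (waveNumber l₁ q.1 ^ 2)).congr_deriv ?_
      simp only [hM, Finset.mul_sum]
      refine Finset.sum_congr rfl fun q _ => ?_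
      push_cast
      ring
    · refine (HasDerivAt.fun_sum fun q hq => (((hmode q hq).hasDerivAt z hz).fun_pow
        2)).congr_deriv ?_
      simp only [hM₂, Finset.mul_sum]
      refine Finset.sum_congr rfl fun q _ => ?_
      push_cast
      ring
    · refine (HasDerivAt.fun_sum fun q hq => (((hmode q hq).hasDerivAt z hz).fun_mul
        ((hmode q hq).hasDerivAt_deriv z hz)).div_const (waveNumber l₁ q.1 ^ 2)).congr_deriv ?_
      simp only [hM, hD, hB, hC, Finset.mul_sum, ← Finset.sum_add_distrib]
      refine Finset.sum_congr rfl fun q hq => ?_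
      have := (hk q hq).ne'
      field_simp
      ring
    · refine (HasDerivAt.fun_sum fun q hq => (((hmode q hq).hasDerivAt_deriv z hz).fun_pow
        2).div_const (waveNumber l₁ q.1 ^ 2)).congr_deriv ?_
      simp only [hM, hD, hM₂, Finset.mul_sum, ← Finset.sum_add_distrib]
      refine Finset.sum_congr rfl fun q hq => ?_
      have := (hk q hq).ne'
      push_cast
      field_simp
      ring)
  obtain ⟨z₀, hz₀, hVz₀⟩ := hV
  refine hVz₀ (deriv_eq_zero_of_modes hU.toIsProfile s (fun q => waveNumber l₁ q.1) hk K
    (fun q => prsCoef hd w q) (fun q => dprsCoef hd w q) hmode (fun z hz => ?_)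
    ⟨q₀, Finset.mem_filter.2 ⟨hq₀, rfl⟩, ?_⟩ z₀ hz₀)
  · have hz0 := key z hz
    have hUz := hU.ne_zero_ext z
    have e : ∑ q ∈ s, (dprsCoef hd w q z ^ 2 + (waveNumber l₁ q.1 ^ 2 - K ^ 2) *
        prsCoef hd w q z ^ 2) / waveNumber l₁ q.1 ^ 2 = D z + C z - K ^ 2 * B z := by
      simp only [hD, hC, hB, Finset.mul_sum, ← Finset.sum_add_distrib, ← Finset.sum_sub_distrib]
      refine Finset.sum_congr rfl fun q hq => ?_
      have := (hk q hq).ne'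
      field_simp
      ring
    rw [e]
    rw [div_mul_eq_mul_div, div_eq_zero_iff] at hz0
    exact hz0.resolve_right (pow_ne_zero 3 hUz)
  · obtain ⟨z, hz, hc⟩ := ((hmem q₀).1 hq₀).2
    exact ⟨z, hz, div_ne_zero hc (modeNorm_pos hl₁ hl₂ q₀).ne'⟩

end WaterWave

/-! ### From the modes back to two-dimensionality. -/

namespace WaterWave

variable {d l₁ l₂ : ℝ}

theorem pd_one_eq_zero {f : R3 → ℝ} (h : ∀ x ∈ closedDomain d, f x = f ![x 0, 0, x 2]) {x : R3}
    (hx : x ∈ closedDomain d) : pd 1 f x = 0 := by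
  have e : (fun t : ℝ => f (x + t • Pi.single 1 1)) = fun _ => f ![x 0, 0, x 2] := by
    funext t
    rw [h _ (by simpa [closedDomain] using hx)]
    simp
  rw [pd, lineDeriv, e, deriv_const]

theorem pd_one_eq_zero_horizontal {f : R2 → ℝ} (h : ∀ x, f x = f ![x 0, 0]) (x : R2) :
    pd 1 f x = 0 := by
  have e : (fun t : ℝ => f (x + t • Pi.single 1 1)) = fun _ => f ![x 0, 0] := by
    funext t
    rw [h]
    simp
  rw [pd, lineDeriv, e, deriv_const]

variable {U V : ℝ → ℝ} (hU : IsExtProfile d U V) {w : State d l₁ l₂} (hl₁ : 0 < l₁) (hl₂ : 0 < l₂)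
  (h : LinearizedJet hU.pos U V w)
include hl₁ hl₂ h

/-- If c vanishes then so does e up to the surface, where e(0) = U(0)²k₁²η. For k₁ = 0 this relation
says nothing about η. -/
theorem elvMode_eq_zero {m n : ℕ} (hm : m ≠ 0)
    (hp : ∀ z ∈ Icc (-d) 0, prsMode hU.pos m n w z = 0) : elvMode m n w = 0 := by
  have hd := hU.pos
  obtain ⟨hmode, htop, -⟩ := h.isMode hl₁ hl₂ hU m n
  have h1 : ∀ z ∈ Ioo (-d) 0, dprsMode hd m n w z = 0 := fun z hz =>
    (hmode.hasDerivAt z hz).unique ((hasDerivAt_const z (0 : ℝ)).congr_of_eventuallyEq (by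
      filter_upwards [Icc_mem_nhds hz.1 hz.2] with t ht using hp t ht))
  have cE : Continuous (dprsMode hd m n w) := continuous_moment (hasPartials_prs hd w).cont₂
    (continuous_cosMode _ _) (continuous_cosMode _ _)
  have h2 : dprsMode hd m n w 0 = 0 := by
    have := EqOn.closure (f := dprsMode hd m n w) (g := fun _ => 0) h1 cE continuous_const
    rw [closure_Ioo (by linarith)] at this
    exact this hU.right_mem
  rw [h2] at htop
  have h3 := hU.ne_zero_ext 0
  have h4 := (waveNumber_pos hl₁ hm).ne'
  rw [waveNumber] at h4
  exact (mul_eq_zero.1 htop.symm).resolve_left (mul_ne_zero (pow_ne_zero 2 h3) (pow_ne_zero 2 h4))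

/-- A solution of the linearized equations whose pressure and elevation do not depend on `x₂` is
two-dimensional. -/
theorem isTwoDimensional_of_modes
    (hp : ∀ m n, 1 ≤ n → ∀ z ∈ Icc (-d) 0, prsMode hU.pos m n w z = 0)
    (hη : ∀ m n, 1 ≤ n → elvMode m n w = 0) : IsTwoDimensional d w.u w.p w.eta := by
  have hd := hU.pos
  have p := hasPartials_prs hd w
  have φ := hasPartials_phi (d := d) w
  have ip : ∀ z ∈ Icc (-d) 0, ∀ x y, prs hd ![x, y, z] w = prs hd ![x, 0, z] w := fun z hz =>
    eq_of_moment hl₁ hl₂ p.cont p.periodic (isSymmScalar_prs hd) fun m n hn => hp m n hn z hz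
  have iη : ∀ z x y, elv ![x, y, z] w = elv ![x, 0, z] w := fun z =>
    eq_of_moment hl₁ hl₂ (hasPartials_elv (d := d) w).cont (hasPartials_elv (d := d) w).periodic
      isSymmScalar_elv fun m n hn => (elvMode_eq m n w z).trans (hη m n hn)
  have hmem : ∀ z ∈ Ioo (-d) 0, ∀ x y, (![x, y, z] : R3) ∈ closedDomain d := fun z hz x y =>
    ⟨by simpa using hz.1.le, by simpa using hz.2.le⟩
  have ip1 : ∀ z ∈ Ioo (-d) 0, ∀ x y, dprs hd 1 ![x, y, z] w = 0 := fun z hz x y => by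
    have h1 := p.hasDerivAt₁ hz x y
    simp only [ip z (Ioo_subset_Icc_self hz) x] at h1
    exact h1.unique (hasDerivAt_const y _)
  have ip2 : ∀ z ∈ Ioo (-d) 0, ∀ x y, dprs hd 2 ![x, y, z] w = dprs hd 2 ![x, 0, z] w :=
    fun z hz x y => (p.hasDerivAt₂ hz x y).unique
      ((p.hasDerivAt₂ hz x 0).congr_of_eventuallyEq (by
        filter_upwards [Icc_mem_nhds hz.1 hz.2] with t ht using ip t ht x y))
  have iφ : ∀ z ∈ Ioo (-d) 0, ∀ x y, dphi d 0 ![x, y, z] w = dphi d 0 ![x, 0, z] w :=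
    fun z hz x y => by
      have h1 := φ.hasDerivAt₀ hz x y
      simp only [iη z _ y] at h1
      exact h1.unique (φ.hasDerivAt₀ hz x 0)
  -- With ∂₂℘ = 0 the transverse momentum equation makes u₂ constant in x₁, and oddness makes the
  -- constant zero.
  have v1 : ∀ x ∈ closedDomain d, vel hd 1 x w = 0 := by
    refine eq_on_closedDomain hd (hasPartials_vel hd 1 w).cont continuous_const fun x hx => ?_
    have hz : x 2 ∈ Ioo (-d) 0 := hx
    have key := eq_of_hasDerivAt_eq (g := fun _ => 0)
      (fun t => (hasPartials_vel hd 1 w).hasDerivAt₀ hz t (x 1)) (fun t => ?_) ?_ (x 0)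
    · rwa [vec_eq] at key
    · have e := h.momentum₁ ![t, x 1, x 2] (hmem _ hz _ _)
      rw [ip1 _ hz, add_zero] at e
      rw [(mul_eq_zero.1 e).resolve_left (hU.ne_zero_ext _)]
      exact hasDerivAt_const t 0
    · have := vel_one_reflect hd ![0, x 1, x 2] w
      have e : reflect 0 ![0, x 1, x 2] = ![0, x 1, x 2] := by
        ext i; fin_cases i <;> simp [reflect]
      rw [e] at this
      linarith
  have b0 : ∀ z ∈ Ioo (-d) 0, ∀ y, vertMom hd U w ![0, y, z] = 0 := fun z hz y => by
    have := vel_two_reflect hd ![0, y, z] w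
    have e : reflect 0 ![0, y, z] = ![0, y, z] := by ext i; fin_cases i <;> simp [reflect]
    rw [e] at this
    have h0 : vel hd 2 ![0, y, z] w = 0 := by linarith
    rw [vertMom, h0, dphi_zero_axis w y hz]
    ring
  obtain ⟨b₁, b₂, hb⟩ := exists_hasPartials_vertMom hU (w := w)
  -- The x₁-derivative of the vertical momentum is -∂₃℘, independent of x₂, and its value at x₁ = 0
  -- is zero. As ∂₁φ does not depend on x₂ either, u₃ can be isolated.
  have v2 : ∀ x ∈ closedDomain d, vel hd 2 x w = vel hd 2 ![x 0, 0, x 2] w := by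
    have cv := (hasPartials_vel hd 2 w).cont
    refine eq_on_closedDomain hd cv (cv.comp (f := fun x : R3 => ![x 0, 0, x 2]) (by fun_prop))
      fun x hx => ?_
    have hz : x 2 ∈ Ioo (-d) 0 := hx
    have hder : ∀ t y, U (x 2) * dvel hd 2 0 ![t, y, x 2] w +
        U (x 2) ^ 2 * ddphi d 0 0 ![t, y, x 2] w = -dprs hd 2 ![t, 0, x 2] w := fun t y => by
      rw [← ip2 _ hz t y]
      exact eq_neg_of_add_eq_zero_left (h.momentum₂ ![t, y, x 2] (hmem _ hz _ _))
    have key := eq_of_hasDerivAt_eq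
      (fun t => (hb.hasDerivAt₀ hz t (x 1)).congr_deriv (hder t (x 1)))
      (fun t => (hb.hasDerivAt₀ hz t 0).congr_deriv (hder t 0))
      (by rw [b0 _ hz, b0 _ hz]) (x 0)
    have hUz := hU.ne_zero_ext (x 2)
    simp only [vertMom, iφ _ hz (x 0) (x 1)] at key
    have key2 := add_right_cancel (mul_left_cancel₀ hUz key)
    rwa [vec_eq] at key2
  refine ⟨fun x hx => ?_, fun x hx => pd_one_eq_zero (fun x hx => ?_) hx,
    fun x hx => pd_one_eq_zero (fun x hx => ?_) hx, fun x => pd_one_eq_zero_horizontal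
      (fun x => ?_) x⟩
  · rw [u_apply_eq hd w hx, v1 x hx]
  · rw [u_apply_eq hd w hx, v2 x hx, u_apply_eq hd w (by simpa [closedDomain] using hx)]
  · rw [p_apply_eq hd w hx, p_apply_eq hd w (by simpa [closedDomain] using hx), ← ip _ hx _ (x 1),
      vec_eq]
  · have h1 := eta_apply_eq w ![x 0, x 1, 0]
    have h2 := eta_apply_eq w ![x 0, 0, 0]
    simp only [Matrix.cons_val_zero, Matrix.cons_val_one] at h1 h2
    have e : x = ![x 0, x 1] := by ext i; fin_cases i <;> rfl
    rw [h2, ← iη 0 (x 0) (x 1), ← h1, ← e]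

end WaterWave

/-! ### The linearized capillary-gravity condition. -/

namespace WaterWave

variable {d l₁ l₂ : ℝ}

section Capillary

/-- A point of the fluid domain above the horizontal position `y`. -/
noncomputable def interiorPoint (d : ℝ) (y : R2) : R3 := ![y 0, y 1, -d / 2]

theorem interiorPoint_mem (hd : 0 < d) (y : R2) : interiorPoint d y ∈ domain d := by
  simp only [interiorPoint, domain, mem_ofPred_eq, Matrix.cons_val, mem_Ioo]
  constructor <;> linarith

theorem interiorPoint_add (y : R2) (t : ℝ) (j : Fin 2) :
    interiorPoint d (y + t • Pi.single j 1) = interiorPoint d y + t • Pi.single j.castSucc 1 := by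
  ext i; fin_cases i <;> fin_cases j <;> simp [interiorPoint]

theorem eta_eq_elv (w : State d l₁ l₂) (y : R2) : w.eta y = elv (interiorPoint d y) w := by
  rw [← eta_apply_eq]
  congr 1
  ext i; fin_cases i <;> rfl

theorem hasDerivAt_elv (hd : 0 < d) (w : State d l₁ l₂) (y : R2) (j : Fin 2) :
    HasDerivAt (fun t : ℝ => elv (interiorPoint d (y + t • Pi.single j 1)) w)
      (delv j (interiorPoint d y) w) 0 := by
  have := (hasPartials_elv w).hasDerivAt_line (interiorPoint_mem hd y) j.castSucc
  simp only [interiorPoint_add]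
  refine this.congr_deriv ?_
  fin_cases j <;> rfl

theorem hasDerivAt_delv (hd : 0 < d) (w : State d l₁ l₂) (y : R2) (i j : Fin 2) :
    HasDerivAt (fun t : ℝ => delv i (interiorPoint d (y + t • Pi.single j 1)) w)
      (ddelv i j (interiorPoint d y) w) 0 := by
  have := (hasPartials_delv i w).hasDerivAt_line (interiorPoint_mem hd y) j.castSucc
  simp only [interiorPoint_add]
  refine this.congr_deriv ?_
  fin_cases j <;> rfl

theorem grad_eta (hd : 0 < d) (w : State d l₁ l₂) (y : R2) (j : Fin 2) :
    grad w.eta y j = delv j (interiorPoint d y) w := by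
  rw [grad, pd, lineDeriv]
  simp only [eta_eq_elv]
  exact (hasDerivAt_elv hd w y j).deriv

/-- The mean curvature operator in terms of the derivatives of the elevation. -/
theorem div_curvature (hd : 0 < d) (w : State d l₁ l₂) (y : R2) :
    div (fun y => (Real.sqrt (1 + ∑ j, grad w.eta y j ^ 2))⁻¹ • grad w.eta y) y =
      ∑ j, (-((∑ i, 2 * delv i (interiorPoint d y) w * ddelv i j (interiorPoint d y) w) /
          (2 * Real.sqrt (1 + ∑ i, delv i (interiorPoint d y) w ^ 2))) /
            Real.sqrt (1 + ∑ i, delv i (interiorPoint d y) w ^ 2) ^ 2 *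
          delv j (interiorPoint d y) w +
        (Real.sqrt (1 + ∑ i, delv i (interiorPoint d y) w ^ 2))⁻¹ *
          ddelv j j (interiorPoint d y) w) := by
  rw [div]
  refine Finset.sum_congr rfl fun j _ => ?_
  rw [pd, lineDeriv]
  simp only [Pi.smul_apply, smul_eq_mul, grad_eta hd]
  have hS : 0 < 1 + ∑ i, delv i (interiorPoint d y) w ^ 2 := by positivity
  have h1 : HasDerivAt (fun t : ℝ => 1 + ∑ i : Fin 2, delv i (interiorPoint d
      (y + t • Pi.single j 1)) w ^ 2)
      (∑ i, 2 * delv i (interiorPoint d y) w * ddelv i j (interiorPoint d y) w) 0 := by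
    refine ((HasDerivAt.fun_sum (u := Finset.univ) fun i _ =>
      (hasDerivAt_delv hd w y i j).fun_pow 2).const_add 1).congr_deriv ?_
    refine Finset.sum_congr rfl fun i _ => ?_
    simp
  have h2 := (h1.sqrt (by simpa using hS.ne')).fun_inv
    (by simpa using (Real.sqrt_pos.2 hS).ne')
  have h3 := h2.fun_mul (hasDerivAt_delv hd w y j j)
  rw [h3.deriv]
  simp

/-- Where one factor vanishes, continuity of the other suffices for the product rule. The nonlinear
coefficients of the curvature therefore need not be differentiated in ε. -/
theorem HasDerivAt.mul_of_eq_zero {b c : ℝ → ℝ} {b' : ℝ} (hb : HasDerivAt b b' 0) (h0 : b 0 = 0)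
    (hc : ContinuousAt c 0) : HasDerivAt (fun t => c t * b t) (c 0 * b') 0 := by
  rw [hasDerivAt_iff_tendsto_slope] at hb ⊢
  refine ((hc.tendsto.mono_left nhdsWithin_le_nhds).mul hb).congr fun t => ?_
  simp only [slope_def_field, h0]
  ring

variable {U V : ℝ → ℝ} (hU : IsExtProfile d U V) {γ : ℝ → State d l₁ l₂} {w₁ : State d l₁ l₂}
  (hγ : HasDerivAt γ w₁ 0) (h0 : IsShearFlow d U (γ 0).u (γ 0).p (γ 0).eta)
include hU hγ h0

/-- The linearized capillary-gravity condition. -/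
theorem linearized_capillary {g σ : ℝ}
    (hB : ∀ᶠ ε in 𝓝 (0 : ℝ), CapillaryGravity g σ (γ ε).p (γ ε).eta) (y : R2) :
    prs hU.pos ![y 0, y 1, 0] w₁ - g * elv (interiorPoint d y) w₁ +
      σ * ∑ j, ddelv j j (interiorPoint d y) w₁ = 0 := by
  have hd := hU.pos
  have hx : (![y 0, y 1, 0] : R3) ∈ closedDomain d := by simp [closedDomain, hd.le]
  have D := fun L => hasDerivAt_apply hγ L
  have hη : ∀ y, elv (interiorPoint d y) (γ 0) = 0 := fun y => by rw [← eta_eq_elv, h0.2.2]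
  have hdη : ∀ y i, delv i (interiorPoint d y) (γ 0) = 0 := fun y i => by
    have := hasDerivAt_elv hd (γ 0) y i
    simp only [hη] at this
    exact this.unique (hasDerivAt_const _ _)
  have hddη : ∀ y i j, ddelv i j (interiorPoint d y) (γ 0) = 0 := fun y i j => by
    have := hasDerivAt_delv hd (γ 0) y i j
    simp only [hdη] at this
    exact this.unique (hasDerivAt_const _ _)
  have cS : ContinuousAt (fun ε => Real.sqrt (1 + ∑ i, delv i (interiorPoint d y) (γ ε) ^ 2)) 0 := by
    refine Real.continuous_sqrt.continuousAt.comp (continuousAt_const.add ?_)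
    exact tendsto_finsetSum _ fun i _ => ((D (delv i (interiorPoint d y))).continuousAt.pow 2)
  have hS0 : Real.sqrt (1 + ∑ i, delv i (interiorPoint d y) (γ 0) ^ 2) = 1 := by simp [hdη]
  have hSne : Real.sqrt (1 + ∑ i, delv i (interiorPoint d y) (γ 0) ^ 2) ≠ 0 := by rw [hS0]; simp
  have hcurv := HasDerivAt.fun_sum (u := Finset.univ) fun (j : Fin 2) _ =>
    (HasDerivAt.mul_of_eq_zero (D (delv j (interiorPoint d y))) (hdη y j)
      (c := fun ε => -((∑ i, 2 * delv i (interiorPoint d y) (γ ε) *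
          ddelv i j (interiorPoint d y) (γ ε)) /
          (2 * Real.sqrt (1 + ∑ i, delv i (interiorPoint d y) (γ ε) ^ 2))) /
            Real.sqrt (1 + ∑ i, delv i (interiorPoint d y) (γ ε) ^ 2) ^ 2)
      (ContinuousAt.div (ContinuousAt.neg (ContinuousAt.div (tendsto_finsetSum _ fun i _ =>
        ((D (delv i (interiorPoint d y))).continuousAt.const_mul 2).mul
          (D (ddelv i j (interiorPoint d y))).continuousAt) (cS.const_mul 2)
          (mul_ne_zero two_ne_zero hSne))) (cS.pow 2) (pow_ne_zero 2 hSne))).fun_add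
    (HasDerivAt.mul_of_eq_zero (D (ddelv j j (interiorPoint d y))) (hddη y j j)
      (c := fun ε => (Real.sqrt (1 + ∑ i, delv i (interiorPoint d y) (γ ε) ^ 2))⁻¹)
      (cS.inv₀ hSne))
  have htot := ((D (prs hd ![y 0, y 1, 0])).fun_sub ((D (elv (interiorPoint d y))).const_mul
    g)).fun_add (hcurv.const_mul σ)
  have hz : (fun ε => prs hd ![y 0, y 1, 0] (γ ε) - g * elv (interiorPoint d y) (γ ε) + σ * ∑ j,
      (-((∑ i, 2 * delv i (interiorPoint d y) (γ ε) * ddelv i j (interiorPoint d y) (γ ε)) /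
          (2 * Real.sqrt (1 + ∑ i, delv i (interiorPoint d y) (γ ε) ^ 2))) /
            Real.sqrt (1 + ∑ i, delv i (interiorPoint d y) (γ ε) ^ 2) ^ 2 *
          delv j (interiorPoint d y) (γ ε) +
        (Real.sqrt (1 + ∑ i, delv i (interiorPoint d y) (γ ε) ^ 2))⁻¹ *
          ddelv j j (interiorPoint d y) (γ ε))) =ᶠ[𝓝 0] fun _ => 0 := by
    filter_upwards [hB] with ε hε
    refine Eq.trans ?_ (hε y)
    rw [div_curvature hd, p_apply_eq hd _ hx, eta_eq_elv]
  have hfin := htot.unique ((hasDerivAt_const (0 : ℝ) (0 : ℝ)).congr_of_eventuallyEq hz)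
  simpa [hdη] using hfin

theorem prsMode_zero_of_capillary (hl₁ : 0 < l₁) (hl₂ : 0 < l₂) {g σ : ℝ}
    (hB : ∀ᶠ ε in 𝓝 (0 : ℝ), CapillaryGravity g σ (γ ε).p (γ ε).eta) (m n : ℕ) :
    prsMode hU.pos m n w₁ 0 =
      (g + σ * (waveNumber l₁ m ^ 2 + waveNumber l₂ n ^ 2)) * elvMode m n w₁ := by
  have hd := hU.pos
  -- Integration by parts for moments is available only at interior heights; η does not depend on
  -- x₃, so any such height will do.
  have hz : -d / 2 ∈ Ioo (-d) 0 := by constructor <;> linarith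
  have E := hasPartials_elv (d := d) w₁
  have E₀ := hasPartials_delv (d := d) 0 w₁
  have E₁ := hasPartials_delv (d := d) 1 w₁
  have cC := continuous_cosMode l₁ m
  have cS := continuous_sinMode l₁ m
  have cC' := continuous_cosMode l₂ n
  have cS' := continuous_sinMode l₂ n
  have m0 : moment l₁ l₂ (fun x => ddelv 0 0 x w₁) (cosMode l₁ m) (cosMode l₂ n) (-d / 2) =
      -(waveNumber l₁ m ^ 2 * elvMode m n w₁) := by
    rw [E₀.moment₀ hz (hasDerivAt_cosMode l₁ m) (by fun_prop) cC' (cosMode_period m hl₁),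
      moment_left_mul, E.moment₀ hz (hasDerivAt_sinMode l₁ m) (by fun_prop) cC'
      (sinMode_period m hl₁), moment_left_mul, elvMode_eq, waveNumber]
    ring
  have m1 : moment l₁ l₂ (fun x => ddelv 1 1 x w₁) (cosMode l₁ m) (cosMode l₂ n) (-d / 2) =
      -(waveNumber l₂ n ^ 2 * elvMode m n w₁) := by
    rw [E₁.moment₁ hz (hasDerivAt_cosMode l₂ n) (by fun_prop) (cosMode_period n hl₂),
      moment_right_mul, E.moment₁ hz (hasDerivAt_sinMode l₂ n) (by fun_prop)
      (sinMode_period n hl₂), moment_right_mul, elvMode_eq, waveNumber]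
    ring
  have e : ∀ x y, prs hd ![x, y, 0] w₁ = (fun x => g * elv x w₁ + (-σ) * (ddelv 0 0 x w₁ +
      ddelv 1 1 x w₁)) ![x, y, -d / 2] := fun x y => by
    have := linearized_capillary hU hγ h0 hB ![x, y]
    simp only [Fin.sum_univ_two, interiorPoint, Matrix.cons_val_zero, Matrix.cons_val_one] at this
    simp only
    linarith
  have e2 : prsMode hd m n w₁ 0 = moment l₁ l₂ (fun x => g * elv x w₁ + (-σ) * (ddelv 0 0 x w₁ +
      ddelv 1 1 x w₁)) (cosMode l₁ m) (cosMode l₂ n) (-d / 2) := by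
    simp only [prsMode, moment, e]
  rw [e2, moment_add (continuous_const.fun_mul E.cont)
    (continuous_const.fun_mul (E₀.cont₀.fun_add E₁.cont₁)) cC cC', moment_const_mul,
    moment_const_mul, moment_add E₀.cont₀ E₁.cont₁ cC cC', m0, m1, elvMode_eq]
  ring

end Capillary

end WaterWave

/-! ### Complex Fourier coefficients and finiteness of the set of modes. -/

namespace WaterWave

variable {d l₁ l₂ : ℝ}

section FourierCoefficients

theorem continuous_horizontal_integrand {E : Type*} [NormedAddCommGroup E] {F : ℝ → ℝ → E}
    (hF : Continuous fun q : ℝ × ℝ => F q.1 q.2) (x : ℝ) : Continuous (F x) :=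
  hF.comp (f := fun y => (x, y)) (by fun_prop)

theorem re_integral_integral {F : ℝ → ℝ → ℂ} (hF : Continuous fun q : ℝ × ℝ => F q.1 q.2) :
    (∫ x in (0 : ℝ)..l₁, ∫ y in (0 : ℝ)..l₂, F x y).re =
      ∫ x in (0 : ℝ)..l₁, ∫ y in (0 : ℝ)..l₂, (F x y).re := by
  have h1 : Continuous fun x => ∫ y in (0 : ℝ)..l₂, F x y :=
    intervalIntegral.continuous_parametric_intervalIntegral_of_continuous' hF _ _
  rw [← Complex.reCLM_apply, ← Complex.reCLM.intervalIntegral_comp_comm (h1.intervalIntegrable _ _)]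
  refine intervalIntegral.integral_congr fun x _ => ?_
  rw [← Complex.reCLM.intervalIntegral_comp_comm
    ((continuous_horizontal_integrand hF x).intervalIntegrable _ _)]
  rfl

theorem integral_integral_add {F G : ℝ → ℝ → ℝ} (hF : Continuous fun q : ℝ × ℝ => F q.1 q.2)
    (hG : Continuous fun q : ℝ × ℝ => G q.1 q.2) :
    ∫ x in (0 : ℝ)..l₁, ∫ y in (0 : ℝ)..l₂, (F x y + G x y) =
      (∫ x in (0 : ℝ)..l₁, ∫ y in (0 : ℝ)..l₂, F x y) +
        ∫ x in (0 : ℝ)..l₁, ∫ y in (0 : ℝ)..l₂, G x y := by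
  have h1 : Continuous fun x => ∫ y in (0 : ℝ)..l₂, F x y :=
    intervalIntegral.continuous_parametric_intervalIntegral_of_continuous' hF _ _
  have h2 : Continuous fun x => ∫ y in (0 : ℝ)..l₂, G x y :=
    intervalIntegral.continuous_parametric_intervalIntegral_of_continuous' hG _ _
  rw [← intervalIntegral.integral_add (h1.intervalIntegrable _ _) (h2.intervalIntegrable _ _)]
  refine intervalIntegral.integral_congr fun x _ => ?_
  exact intervalIntegral.integral_add
    ((continuous_horizontal_integrand hF x).intervalIntegrable _ _)
    ((continuous_horizontal_integrand hG x).intervalIntegrable _ _)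

/-- A real Fourier mode is seen by a complex Fourier coefficient. -/
theorem exists_horizCoeff_ne_zero (hl₁ : 0 < l₁) (hl₂ : 0 < l₂) {f : R3 → ℝ} (hf : Continuous f)
    {m n : ℕ} {z : ℝ} (h : moment l₁ l₂ f (cosMode l₁ m) (cosMode l₂ n) z ≠ 0) :
    ∃ k ∈ dualLattice l₁ l₂, |k.1| = waveNumber l₁ m ∧ |k.2| = waveNumber l₂ n ∧
      horizCoeff l₁ l₂ (fun x' => f ![x' 0, x' 1, z]) k ≠ 0 := by
  have hk : ∀ {l : ℝ}, 0 < l → ∀ n, 0 ≤ waveNumber l n := fun hl n => by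
    have := Real.pi_pos
    unfold waveNumber
    positivity
  by_contra! hc
  refine h ?_
  have hfc : Continuous fun q : ℝ × ℝ => f ![q.1, q.2, z] :=
    hf.comp (f := fun q : ℝ × ℝ => (![q.1, q.2, z] : R3)) (by fun_prop)
  -- The real parts of the coefficients at (k₁, k₂) and (k₁, -k₂); half their sum is the
  -- cosine-cosine moment, up to the normalization.
  have key : ∀ t : ℤ, |t| = 1 → ∫ x in (0 : ℝ)..l₁, ∫ y in (0 : ℝ)..l₂,
      f ![x, y, z] * Real.cos (waveNumber l₁ m * x + waveNumber l₂ n * t * y) = 0 := by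
    intro t ht
    have ht' : |(t : ℝ)| = 1 := by exact_mod_cast ht
    have h1 := hc (waveNumber l₁ m, waveNumber l₂ n * t)
      ⟨m, n * t, by simp [waveNumber, mul_assoc]⟩ (abs_of_nonneg (hk hl₁ m))
      (by rw [abs_mul, ht', mul_one, abs_of_nonneg (hk hl₂ n)])
    rw [horizCoeff, mul_eq_zero, or_iff_right
      (Complex.ofReal_ne_zero.2 (one_div_ne_zero (mul_pos hl₁ hl₂).ne'))] at h1
    have h2 := congrArg Complex.re h1
    simp only [Matrix.cons_val_zero, Matrix.cons_val_one] at h2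
    rw [re_integral_integral (F := fun x y => (f ![x, y, z] : ℂ) * Complex.exp (-Complex.I *
      ((waveNumber l₁ m * x + waveNumber l₂ n * t * y : ℝ) : ℂ))) (by fun_prop),
      Complex.zero_re] at h2
    refine Eq.trans ?_ h2
    refine intervalIntegral.integral_congr fun x _ => intervalIntegral.integral_congr fun y _ => ?_
    rw [Complex.re_ofReal_mul, neg_mul, ← mul_neg, mul_comm Complex.I, ← Complex.ofReal_neg,
      Complex.exp_ofReal_mul_I_re, Real.cos_neg]
  have e : ∀ x y, f ![x, y, z] * cosMode l₁ m x * cosMode l₂ n y = (1 / 2) *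
      (f ![x, y, z] * Real.cos (waveNumber l₁ m * x + waveNumber l₂ n * (1 : ℤ) * y) +
      f ![x, y, z] * Real.cos (waveNumber l₁ m * x + waveNumber l₂ n * (-1 : ℤ) * y)) := by
    intro x y
    have := Real.two_mul_cos_mul_cos (waveNumber l₁ m * x) (waveNumber l₂ n * y)
    have e1 : waveNumber l₁ m * x + waveNumber l₂ n * (1 : ℤ) * y =
      waveNumber l₁ m * x + waveNumber l₂ n * y := by push_cast; ring
    have e2 : waveNumber l₁ m * x + waveNumber l₂ n * (-1 : ℤ) * y =
      waveNumber l₁ m * x - waveNumber l₂ n * y := by push_cast; ring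
    rw [e1, e2]
    simp only [cosMode]
    simp only [waveNumber] at this ⊢
    linear_combination (1 / 2) * f ![x, y, z] * this
  simp only [moment, e, intervalIntegral.integral_const_mul]
  rw [integral_integral_add (F := fun x y => f ![x, y, z] * Real.cos (waveNumber l₁ m * x +
    waveNumber l₂ n * (1 : ℤ) * y)) (G := fun x y => f ![x, y, z] * Real.cos (waveNumber l₁ m * x +
    waveNumber l₂ n * (-1 : ℤ) * y)) (by fun_prop) (by fun_prop), key 1 (by simp),
    key (-1) (by simp)]
  simp

theorem waveNumber_injective {l : ℝ} (hl : 0 < l) : Function.Injective (waveNumber l) := by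
  intro m n h
  have := Real.pi_pos
  have hc : 2 * Real.pi / l ≠ 0 := by positivity
  exact_mod_cast mul_left_cancel₀ hc h

end FourierCoefficients

section Cases

variable {U V : ℝ → ℝ} (hU : IsExtProfile d U V) {w : State d l₁ l₂} (hl₁ : 0 < l₁) (hl₂ : 0 < l₂)
  (h : LinearizedJet hU.pos U V w)
include hl₁ hl₂ h

/-- For k₁ = 0 the transverse momentum equation reduces to k₂c = 0. Purely transverse pressure modes
are thus excluded under any dynamic boundary condition. -/
theorem ne_zero_of_prsMode {q : ℕ × ℕ} (hq : q ≠ 0)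
    (hz : ∃ z ∈ Icc (-d) 0, prsMode hU.pos q.1 q.2 w z ≠ 0) : q.1 ≠ 0 := by
  intro h1
  obtain ⟨z, hz, hc⟩ := hz
  have h2 := ((h.isMode hl₁ hl₂ hU q.1 q.2).2.2 h1 z hz).2
  have h3 : q.2 ≠ 0 := fun h2 => hq (Prod.ext h1 h2)
  exact (waveNumber_pos hl₂ h3).ne' ((mul_eq_zero.1 h2).resolve_right hc)

/-- The pressure of a solution of the linearized equations with the capillary-gravity condition has
finitely many Fourier modes. -/
theorem finite_prsMode_of_capillary {g σ : ℝ} (hg : 0 < g) (hσ : 0 < σ)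
    (hB : ∀ m n, prsMode hU.pos m n w 0 =
      (g + σ * (waveNumber l₁ m ^ 2 + waveNumber l₂ n ^ 2)) * elvMode m n w) :
    {q : ℕ × ℕ | q ≠ 0 ∧ ∃ z ∈ Icc (-d) 0, prsMode hU.pos q.1 q.2 w z ≠ 0}.Finite := by
  obtain ⟨R, hR⟩ := exists_wavenumber_bound hU.toIsProfile hg hσ
  have hbound : ∀ {l : ℝ}, 0 < l → {n : ℕ | waveNumber l n ≤ R}.Finite := fun {l} hl => by
    refine (finite_Iic ⌊R / (2 * Real.pi / l)⌋₊).subset fun n hn => Nat.le_floor ?_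
    have := Real.pi_pos
    rw [le_div_iff₀ (by positivity), mul_comm]
    exact hn
  refine ((hbound hl₁).prod (hbound hl₂)).subset fun q hq => ?_
  obtain ⟨hmode, htop, -⟩ := h.isMode hl₁ hl₂ hU q.1 q.2
  have hsq : Real.sqrt (waveNumber l₁ q.1 ^ 2 + waveNumber l₂ q.2 ^ 2) ^ 2 =
    waveNumber l₁ q.1 ^ 2 + waveNumber l₂ q.2 ^ 2 := Real.sq_sqrt (by positivity)
  have hn₁ := sq_nonneg (waveNumber l₁ q.1)
  have hn₂ := sq_nonneg (waveNumber l₂ q.2)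
  -- The bound is applied with κ = |k|, which dominates both components.
  have hle := hR (waveNumber l₁ q.1) (Real.sqrt (waveNumber l₁ q.1 ^ 2 + waveNumber l₂ q.2 ^ 2))
    (elvMode q.1 q.2 w) _ _ (Real.sqrt_nonneg _) (by rw [hsq]; linarith)
    (by rw [hsq]; exact hmode) (by rw [hsq]; exact hB q.1 q.2) htop hq.2
  exact ⟨(Real.le_sqrt_of_sq_le (by linarith)).trans hle,
    (Real.le_sqrt_of_sq_le (by linarith)).trans hle⟩

omit h in
/-- The wave vectors of a solution belong to the kernel modes. -/
theorem exists_mem_kernelModes {U₀ : ℝ → ℝ} {Y : Type*} [NormedAddCommGroup Y] [NormedSpace ℝ Y]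
    {L : State d l₁ l₂ →L[ℝ] Y} (hsol : SolvesLinearized d U₀ w.u w.p w.eta) (hL : L w = 0)
    {q : ℕ × ℕ} (hq : q ≠ 0)
    (hne : (∃ z ∈ Icc (-d) 0, prsMode hU.pos q.1 q.2 w z ≠ 0) ∨ elvMode q.1 q.2 w ≠ 0) :
    ∃ k ∈ kernelModes U₀ L, |k.1| = waveNumber l₁ q.1 ∧ |k.2| = waveNumber l₂ q.2 := by
  have hd := hU.pos
  have hk0 : ∀ k : ℝ × ℝ, |k.1| = waveNumber l₁ q.1 → |k.2| = waveNumber l₂ q.2 → k ≠ 0 := by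
    rintro k h1 h2 rfl
    have h0 : ∀ l : ℝ, waveNumber l 0 = 0 := fun l => by simp [waveNumber]
    refine hq (Prod.ext (waveNumber_injective hl₁ ?_) (waveNumber_injective hl₂ ?_))
    · rw [← h1]; simp [h0]
    · rw [← h2]; simp [h0]
  rcases hne with ⟨z, hz, hne⟩ | hne
  · obtain ⟨k, hk, h1, h2, h3⟩ :=
      exists_horizCoeff_ne_zero hl₁ hl₂ (hasPartials_prs hd w).cont hne
    refine ⟨k, ⟨hk, hk0 k h1 h2, w, hsol, hL, Or.inr ⟨z, hz, ?_⟩⟩, h1, h2⟩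
    have e : (fun x' : R2 => w.p ![x' 0, x' 1, z]) = fun x' => prs hd ![x' 0, x' 1, z] w := by
      funext x'
      exact p_apply_eq hd w (by simpa [closedDomain] using hz)
    rwa [e]
  · obtain ⟨k, hk, h1, h2, h3⟩ :=
      exists_horizCoeff_ne_zero hl₁ hl₂ (hasPartials_elv (d := d) w).cont hne
    refine ⟨k, ⟨hk, hk0 k h1 h2, w, hsol, hL, Or.inl ?_⟩, h1, h2⟩
    have e : w.eta = fun x' => elv ![x' 0, x' 1, 0] w := by
      funext x'
      rw [← eta_apply_eq]
      congr 1
      ext i; fin_cases i <;> rfl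
    rwa [e]

omit h in
-- An index is determined by its pair of wave numbers, which is the pair of absolute values of some
-- kernel wave vector.
theorem finite_prsMode_of_kernelModes {U₀ : ℝ → ℝ} {Y : Type*} [NormedAddCommGroup Y]
    [NormedSpace ℝ Y] {L : State d l₁ l₂ →L[ℝ] Y} (hsol : SolvesLinearized d U₀ w.u w.p w.eta)
    (hL : L w = 0) (hfin : (kernelModes U₀ L).Finite) :
    {q : ℕ × ℕ | q ≠ 0 ∧ ∃ z ∈ Icc (-d) 0, prsMode hU.pos q.1 q.2 w z ≠ 0}.Finite := by
  refine ((hfin.image fun k => (|k.1|, |k.2|)).preimage (f := fun q : ℕ × ℕ =>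
    (waveNumber l₁ q.1, waveNumber l₂ q.2)) ?_).subset fun q hq => ?_
  · rintro q - r - hqr
    simp only [Prod.mk.injEq] at hqr
    exact Prod.ext (waveNumber_injective hl₁ hqr.1) (waveNumber_injective hl₂ hqr.2)
  · obtain ⟨k, hk, h1, h2⟩ := exists_mem_kernelModes hU hl₁ hl₂ hsol hL hq.1 (Or.inl hq.2)
    exact ⟨k, hk, Prod.ext h1 h2⟩

/-- The common core of both cases. The hypothesis `hη` covers the elevation modes with k₁ = 0, which
the linearized Euler equations do not control; it has to come from the dynamic boundary condition.
-/
theorem isTwoDimensional_of_finite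
    (hflux : ∀ {θ θ' θ'' s s' s'' : ℝ → ℝ}, TestPair d l₂ θ θ' θ'' s s' s'' →
      ∫ x in periodBox d l₁ l₂,
      (vel hU.pos 1 x w * (vel hU.pos 1 x w * (θ' (x 2) * s' (x 1)) +
          vel hU.pos 2 x w * (θ'' (x 2) * s (x 1))) -
        (vel hU.pos 2 x w + U (x 2) * dphi d 0 x w) *
          (vel hU.pos 1 x w * (θ (x 2) * s'' (x 1)) + vel hU.pos 2 x w * (θ' (x 2) * s' (x 1))) +
        prs hU.pos x w *
          (θ' (x 2) * s' (x 1) * dphi d 2 x w - θ'' (x 2) * s (x 1) * dphi d 1 x w)) = 0)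
    (hV : ∃ z ∈ Ioo (-d) 0, V z ≠ 0)
    (hfin : {q : ℕ × ℕ | q ≠ 0 ∧ ∃ z ∈ Icc (-d) 0, prsMode hU.pos q.1 q.2 w z ≠ 0}.Finite)
    (hη : ∀ n, 1 ≤ n → (∀ z ∈ Icc (-d) 0, prsMode hU.pos 0 n w z = 0) → elvMode 0 n w = 0) :
    IsTwoDimensional d w.u w.p w.eta := by
  have hp := prsMode_eq_zero hU hl₁ hl₂ h hflux hV hfin
    fun q hq hz => ne_zero_of_prsMode hU hl₁ hl₂ h hq hz
  refine isTwoDimensional_of_modes hU hl₁ hl₂ h hp fun m n hn => ?_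
  rcases eq_or_ne m 0 with rfl | hm
  · exact hη n hn (hp 0 n hn)
  · exact elvMode_eq_zero hU hl₁ hl₂ h hm (hp m n hn)

end Cases

/-! ### Extension of the profile beyond the fluid and the Taylor expansion of the curve. -/

section Extension

theorem clampZ_mem (hd : 0 < d) (z : ℝ) : max (-d) (min z 0) ∈ Icc (-d) 0 :=
  ⟨le_max_left _ _, max_le (by linarith) (min_le_right _ _)⟩

theorem clampZ_of_mem {z : ℝ} (hz : z ∈ Icc (-d) 0) : max (-d) (min z 0) = z := by
  rw [min_eq_left hz.2, max_eq_right hz.1]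

/-- The constant extension of a profile. -/
theorem isExtProfile_extend (hd : 0 < d) {U : ℝ → ℝ} (hU : ContDiffOn ℝ 2 U (Icc (-d) 0))
    (hne : ∀ z ∈ Icc (-d) 0, U z ≠ 0) :
    IsExtProfile d (fun z => U (max (-d) (min z 0)))
      (fun z => derivWithin U (Icc (-d) 0) (max (-d) (min z 0))) := by
  have hc : Continuous fun z : ℝ => max (-d) (min z 0) := by fun_prop
  have c1 := hU.continuousOn.comp_continuous hc (clampZ_mem hd)
  have c2 := (hU.continuousOn_derivWithin (uniqueDiffOn_Icc (by linarith))
    (by norm_num)).comp_continuous hc (clampZ_mem hd)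
  refine ⟨⟨hd, c1.continuousOn, c2.continuousOn, fun z hz => ?_, fun z hz => hne _ (clampZ_mem hd z)⟩,
    c1, c2, fun z => hne _ (clampZ_mem hd z)⟩
  have hn := Icc_mem_nhds hz.1 hz.2
  have h1 := ((hU.differentiableOn (by norm_num) z
    (Ioo_subset_Icc_self hz)).hasDerivWithinAt).hasDerivAt hn
  simp only [clampZ_of_mem (Ioo_subset_Icc_self hz)]
  refine h1.congr_of_eventuallyEq ?_
  filter_upwards [hn] with t ht
  rw [clampZ_of_mem ht]

theorem IsProfile.exists_deriv_ne_zero {U V : ℝ → ℝ} (hU : IsProfile d U V)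
    (h : ¬∃ c, ∀ z ∈ Icc (-d) 0, U z = c) : ∃ z ∈ Ioo (-d) 0, V z ≠ 0 := by
  by_contra! hV
  have h1 := monotoneOn_of_hasDerivAt_nonneg hU.cont hU.hasDerivAt fun z hz => (hV z hz).ge
  have h2 := monotoneOn_of_hasDerivAt_nonneg hU.cont.neg (fun z hz => (hU.hasDerivAt z hz).neg)
    fun z hz => by rw [hV z hz, neg_zero]
  refine h ⟨U (-d), fun z hz => le_antisymm ?_ (h1 hU.left_mem hz hz.1)⟩
  simpa using h2 hU.left_mem hz hz.1

/-- Second-order Taylor expansion of a curve. -/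
theorem hasExpansion_of_contDiffAt {X : Type*} [NormedAddCommGroup X] [NormedSpace ℝ X]
    {γ : ℝ → X} (hγ : ContDiffAt ℝ 2 γ 0) : ∃ w₂, HasExpansion γ (deriv γ 0) w₂ := by
  obtain ⟨u, hu, hγu⟩ := hγ.contDiffOn (m := 2) le_rfl (by simp)
  obtain ⟨r, hr, hsub⟩ := Metric.mem_nhds_iff.1 hu
  have h0 : (0 : ℝ) ∈ Metric.ball (0 : ℝ) r := Metric.mem_ball_self hr
  have ho : IsOpen (Metric.ball (0 : ℝ) r) := Metric.isOpen_ball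
  refine ⟨((2 : ℝ)⁻¹) • iteratedDerivWithin 2 γ (Metric.ball (0 : ℝ) r) 0, ?_⟩
  have := taylor_isLittleO (n := 2) (convex_ball (0 : ℝ) r) h0 (by exact_mod_cast hγu.mono hsub)
  rw [ho.nhdsWithin_eq h0] at this
  rw [HasExpansion]
  refine this.congr (fun ε => ?_) fun ε => by rw [sub_zero]
  rw [taylorWithinEval_succ, taylorWithinEval_succ, taylor_within_zero_eval, zero_add,
    iteratedDerivWithin_one, derivWithin_of_isOpen ho h0]
  norm_num [smul_smul, mul_comm]

end Extension

end WaterWave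

/-! ### The two cases of the theorem. -/

theorem theorem3p1 (d l₁ l₂ : ℝ) (hd : 0 < d) (hl₁ : 0 < l₁) (hl₂ : 0 < l₂)
    (U : ℝ → ℝ) (hU : ContDiffOn ℝ 2 U (Set.Icc (-d) 0))
    (hU_nonconst : ¬ ∃ c : ℝ, ∀ z ∈ Set.Icc (-d) 0, U z = c)
    (hU_ne : ∀ z ∈ Set.Icc (-d) 0, U z ≠ 0)
    (γ : ℝ → WaterWave.State d l₁ l₂) (hγ : ContDiffAt ℝ 2 γ 0)
    (hγ0 : WaterWave.IsShearFlow d U (γ 0).u (γ 0).p (γ 0).eta)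
    (hE : ∀ᶠ ε in 𝓝 (0 : ℝ), WaterWave.SolvesEuler d (γ ε).u (γ ε).p (γ ε).eta) :
    ∃ w₁ w₂ : WaterWave.State d l₁ l₂, WaterWave.HasExpansion γ w₁ w₂ ∧
      (∀ g σ : ℝ, 0 < g → 0 < σ →
        (∀ᶠ ε in 𝓝 (0 : ℝ), WaterWave.CapillaryGravity g σ (γ ε).p (γ ε).eta) →
        WaterWave.IsTwoDimensional d w₁.u w₁.p w₁.eta) ∧
      (∀ (Y : Type*) [NormedAddCommGroup Y] [NormedSpace ℝ Y]
        (B : WaterWave.State d l₁ l₂ → Y) (L : WaterWave.State d l₁ l₂ →L[ℝ] Y),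
        HasFDerivAt B L (γ 0) → (∀ᶠ ε in 𝓝 (0 : ℝ), B (γ ε) = 0) →
        (WaterWave.kernelModes U L).Finite → (∀ k ∈ WaterWave.kernelModes U L, k.1 ≠ 0) →
        WaterWave.IsTwoDimensional d w₁.u w₁.p w₁.eta) := by
  open WaterWave in
  obtain ⟨w₂, hexp⟩ := hasExpansion_of_contDiffAt hγ
  have hγ1 : HasDerivAt γ (deriv γ 0) 0 := (hγ.differentiableAt (by norm_num)).hasDerivAt
  have hext := isExtProfile_extend hd hU hU_ne
  set Ue : ℝ → ℝ := fun z => U (max (-d) (min z 0)) with hUe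
  set Ve : ℝ → ℝ := fun z => derivWithin U (Icc (-d) 0) (max (-d) (min z 0)) with hVe
  have hUeq : ∀ z ∈ Icc (-d) 0, Ue z = U z := fun z hz => by rw [hUe]; simp only [clampZ_of_mem hz]
  have hγe : IsShearFlow d Ue (γ 0).u (γ 0).p (γ 0).eta :=
    ⟨fun x hx => by rw [hγ0.1 x hx, hUeq _ hx], hγ0.2⟩
  have hjet := isShearJet hext hγe
  have hlin := linearizedJet hext hγ1 hjet hE
  have hV : ∃ z ∈ Ioo (-d) 0, Ve z ≠ 0 := hext.exists_deriv_ne_zero fun ⟨c, hc⟩ =>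
    hU_nonconst ⟨c, fun z hz => by rw [← hUeq z hz, hc z hz]⟩
  have hfinal := isTwoDimensional_of_finite hext hl₁ hl₂ hlin
    (fun T => integral_flux_linear hl₁ hl₂ hext hγ1 hjet hE T) hV
  refine ⟨deriv γ 0, w₂, hexp, fun g σ hg hσ hB => ?_, fun Y _ _ B L hBL hB hfin hk => ?_⟩
  · have hcap := prsMode_zero_of_capillary hext hγ1 hγe hl₁ hl₂ hB
    refine hfinal (finite_prsMode_of_capillary hext hl₁ hl₂ hlin hg hσ hcap) fun n _ hp => ?_
    -- The pressure mode vanishes at the surface and g + σ|k|² is positive, so the elevation mode is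
    -- zero.
    have h0 := hcap 0 n
    rw [hp 0 hext.right_mem, eq_comm, mul_eq_zero] at h0
    exact h0.resolve_left (by positivity)
  · have hsol := hlin.solvesLinearized hext
    -- The kernel is defined with the original profile, which agrees with the extended one near
    -- every interior height.
    have hsolU : SolvesLinearized d U (deriv γ 0).u (deriv γ 0).p (deriv γ 0).eta := by
      refine ⟨fun x hx i => ?_, hsol.incompressible, hsol.kinematic⟩
      have h1 : Ue =ᶠ[𝓝 (x 2)] U := by
        filter_upwards [Icc_mem_nhds hx.1 hx.2] with z hz using hUeq z hz
      rw [← h1.deriv_eq, ← h1.self_of_nhds]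
      exact hsol.momentum x hx i
    have hL : L (deriv γ 0) = 0 := by
      have h1 := hBL.comp_hasDerivAt (0 : ℝ) hγ1
      exact h1.unique ((hasDerivAt_const (0 : ℝ) (0 : Y)).congr_of_eventuallyEq hB)
    refine hfinal (finite_prsMode_of_kernelModes hext hl₁ hl₂ hsolU hL hfin) fun n hn _ => ?_
    by_contra hne
    -- A remaining elevation mode with k₁ = 0 would put a wave vector with vanishing first component
    -- into the kernel.
    obtain ⟨k, hkm, h1, -⟩ := exists_mem_kernelModes hext hl₁ hl₂ hsolU hL (q := (0, n))
      (fun h => by have := congrArg Prod.snd h; simp at this; omega) (Or.inr hne)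
    exact hk k hkm (abs_eq_zero.1 (by rw [h1]; simp [waveNumber]))
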